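/- Let $d\ge 2$ and let $(\tau_e)$ be i.i.d. nonnegative, nondegenerate, almost surely bounded weights on the nearest-neighbour edges of $\mathbb Z^d$ with $\mathbb P(\tau_e=0)<p_c(d)$, where $p_c(d)$ is the critical probability of Bernoulli bond percolation on $\mathbb Z^d$. Let $T(\mathbf x,\mathbf y)$ be the infimum of $\sum_{e\in\gamma}\tau_e$ over lattice paths $\gamma$ from $\lfloor\mathbf x\rfloor$ to $\lfloor\mathbf y\rfloor$ (coordinatewise floor, $\mathbf x,\mathbf y\in\mathbb R^d$), and let $\mu(\mathbf x)=\lim_{N\to\infty}\mathbb E[T(\mathbf 0,N\mathbf x)]/N$ be the time constant. Write $|\cdot|$ for the Euclidean norm and $|\cdot|_1$ for the $\ell^1$-norm. Fix $\mathbf u\in\mathbb R^d$ with $|\mathbf u|=1$, and let $W\subset\mathbb R^d$ be a linear subspace of dimension $d-1$ such that $\mathbf u+W$ is a tangent (supporting) hyperplane at $\mathbf u$ of $\{\mathbf x:\mu(\mathbf x)\le\mu(\mathbf u)\}$, i.e. $\mu(\mathbf u+\mathbf w)\ge\mu(\mathbf u)$ for all $\mathbf w\in W$. Assume: * (Directional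 finite curvature) there is $C>0$ with $\mu(\mathbf u+\mathbf w)-\mu(\mathbf u)\le C|\mathbf w|^2$ for all $\mathbf w\in W$. * (Directional positive curvature) there are $C,r>0$ with $\mu(\mathbf u+\mathbf w)-\mu(\mathbf u)\ge|\mathbf w|^2/C$ for all $\mathbf w\in W$ with $|\mathbf w|\le r$. * (Fluctuation exponent and full concentration) there is $\chi\in[0,1)$ such that, for $\mathbf x$ ranging over $\mathbb Z^d$, $$\lim_{|\mathbf x|\to\infty}\frac{\log\mathrm{Var}(T(\mathbf 0,\mathbf x))}{2\log|\mathbf x|}=\chi\ \ge\ \limsup_{|\mathbf x|\to\infty}\frac{\log(\mathbb E T(\mathbf 0,\mathbf x)-\mu(\mathbf x))}{\log|\mathbf x|},$$ and for every $\epsilon>0$ there is $\theta>0$ such that $\mathbb P(|T(\mathbf 0,\mathbf x)-\mathbb E T(\mathbf 0,\mathbf x)|>|\mathbf x|^{\chi+\epsilon})\le e^{-|\mathbf x|^\theta}$ for all $\mathbf x\in\mathbb Z^d\setminus\{\mathbf 0\}$. Then: 1. For every $\varepsilon>0$ and every $a\in[\chi+\varepsilon,1)$, for all sufficiently large $N\in\mathbb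 N$ (depending on $\varepsilon$ and $a$), $$\mathbb P\big(T(\mathbf 0,N\mathbf u)>N\mu(\mathbf u)+N^a\big)\ \ge\ \exp\Big(-N^{\frac{d(1+\varepsilon)}{1-\chi}(a-\chi)}\Big).$$ If $\chi+\varepsilon\le1$, the same holds for $a=1$ provided that there is $b\in\mathbb R$ with $\mathbb P(\tau_e\ge b)>0$ and $b\,|\mathbf u|_1>\mu(\mathbf u)+1$. 2. For every $\varepsilon>0$, for all sufficiently small $\zeta>0$, $$\liminf_{N\to\infty}N^{-d}\log\mathbb P\big(T(\mathbf 0,N\mathbf u)>N\mu(\mathbf u)+\zeta N\big)\ \ge\ -\zeta^{(1-\varepsilon)\frac{d}{1-\chi}}.$$ -/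

import Mathlib

open MeasureTheory ProbabilityTheory Filter Topology

noncomputable section

namespace FPP

/-- The nearest-neighbour graph on `ℤ^d`: two points are adjacent iff their `ℓ¹` distance is one. -/
def lattice (d : ℕ) : SimpleGraph (Fin d → ℤ) where
  Adj x y := ∑ i, |x i - y i| = 1
  symm := ⟨fun x y h => by
    rw [← h]
    exact Finset.sum_congr rfl fun i _ => abs_sub_comm _ _⟩
  loopless := ⟨fun x h => by simp at h⟩

/-- The nearest-neighbour edges of `ℤ^d`. -/
abbrev Edge (d : ℕ) : Type := (lattice d).edgeSet

/-- Percolation probability: the probability that the open cluster of the origin is infinite when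
every nearest-neighbour edge is open independently with probability `p`.
(`setBernoulli s p` is the law of the random subset of `s` that keeps each point independently
with probability `p`; here it is the random set of open edges.) -/
def percolationProb (d : ℕ) (p : unitInterval) : ENNReal :=
  setBernoulli (lattice d).edgeSet p
    {S : Set (Sym2 (Fin d → ℤ)) |
      {y : Fin d → ℤ | (SimpleGraph.fromEdgeSet S).Reachable 0 y}.Infinite}

/-- The critical probability `p_c(d)` of Bernoulli bond percolation on `ℤ^d`. -/
def criticalProb (d : ℕ) : ℝ :=
  sSup {p : ℝ | ∃ h : p ∈ Set.Icc (0 : ℝ) 1, percolationProb d ⟨p, h⟩ = 0}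

variable {d : ℕ} {Ω : Type*}

/-- The passage time of a lattice path: the sum of the weights of its edges. -/
def pathTime (w : Edge d → ℝ) {x y : Fin d → ℤ} (γ : (lattice d).Walk x y) : ℝ :=
  (γ.edges.attach.map fun e => w ⟨e.1, γ.edges_subset_edgeSet e.2⟩).sum

/-- The first-passage time between two lattice points. -/
def latticeTime (w : Edge d → ℝ) (x y : Fin d → ℤ) : ℝ :=
  ⨅ γ : (lattice d).Walk x y, pathTime w γ

/-- The lattice point `⌊x⌋` with `x ∈ ⌊x⌋ + [0,1)^d`. -/
def floorPt (x : EuclideanSpace ℝ (Fin d)) : Fin d → ℤ := fun i => ⌊x i⌋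

/-- A lattice point seen as a point of Euclidean space. -/
def toEuclid (z : Fin d → ℤ) : EuclideanSpace ℝ (Fin d) := WithLp.toLp 2 fun i => (z i : ℝ)

/-- The first-passage time `T(x, y) = T(⌊x⌋, ⌊y⌋)` between two points of `ℝ^d`, as a random
variable. -/
def T (τ : Edge d → Ω → ℝ) (x y : EuclideanSpace ℝ (Fin d)) (ω : Ω) : ℝ :=
  latticeTime (fun e => τ e ω) (floorPt x) (floorPt y)

variable [MeasurableSpace Ω]

/-- The standing assumptions on the edge weights: i.i.d., nonnegative, nondegenerate, bounded,
and `ℙ(τ_e = 0) < p_c(d)`. -/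
structure IsWeights (P : Measure Ω) (τ : Edge d → Ω → ℝ) : Prop where
  measurable : ∀ e, Measurable (τ e)
  indep : iIndepFun τ P
  identDistrib : ∀ e e', IdentDistrib (τ e) (τ e') P P
  nonneg : ∀ e, ∀ᵐ ω ∂P, 0 ≤ τ e ω
  nondegenerate : ∀ e, ¬ ∃ c : ℝ, ∀ᵐ ω ∂P, τ e ω = c
  bounded : ∃ C : ℝ, ∀ e, ∀ᵐ ω ∂P, τ e ω ≤ C
  subcritical : ∀ e, P.real {ω | τ e ω = 0} < criticalProb d

/-- The time constant `μ(x) = lim_{N → ∞} 𝔼[T(0, N x)] / N`, for `x ∈ ℝ^d`. For bounded weights the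
limit exists for every `x ∈ ℝ^d`; it is the `L¹` (and almost sure) limit of `T(0, N x) / N`. -/
def timeConstant (P : Measure Ω) (τ : Edge d → Ω → ℝ) (x : EuclideanSpace ℝ (Fin d)) : ℝ :=
  limUnder atTop fun N : ℕ => (∫ ω, T τ 0 ((N : ℝ) • x) ω ∂P) / N

/-- `u + W` is a tangent (that is, supporting) hyperplane at `u` of the set `{μ ≤ μ(u)}`, i.e. of
`μ(u)` times the limit shape: `W` has dimension `d - 1` and `u + W` does not meet `{μ < μ(u)}`. -/
def IsTangentHyperplane (P : Measure Ω) (τ : Edge d → Ω → ℝ) (u : EuclideanSpace ℝ (Fin d))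
    (W : Submodule ℝ (EuclideanSpace ℝ (Fin d))) : Prop :=
  Module.finrank ℝ W + 1 = d ∧ ∀ w ∈ W, timeConstant P τ u ≤ timeConstant P τ (u + w)

/-- Directional finite curvature. -/
def FiniteCurvature (P : Measure Ω) (τ : Edge d → Ω → ℝ) (u : EuclideanSpace ℝ (Fin d))
    (W : Submodule ℝ (EuclideanSpace ℝ (Fin d))) : Prop :=
  ∃ C : ℝ, 0 < C ∧ ∀ w ∈ W, timeConstant P τ (u + w) - timeConstant P τ u ≤ C * ‖w‖ ^ 2

/-- Directional positive curvature. The bound is local: since `μ` grows linearly it cannot hold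
for all `w ∈ W`. -/
def PositiveCurvature (P : Measure Ω) (τ : Edge d → Ω → ℝ) (u : EuclideanSpace ℝ (Fin d))
    (W : Submodule ℝ (EuclideanSpace ℝ (Fin d))) : Prop :=
  ∃ C : ℝ, 0 < C ∧ ∃ r : ℝ, 0 < r ∧ ∀ w ∈ W, ‖w‖ ≤ r →
    ‖w‖ ^ 2 / C ≤ timeConstant P τ (u + w) - timeConstant P τ u

/-- `χ ∈ [0,1)` is the fluctuation exponent, it bounds the exponent of the nonrandom fluctuations,
and the passage times concentrate at scale `|x|^{χ+ε}`. On lattice points, `|x| → ∞` is the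
filter `cofinite`. -/
structure FullConcentration (P : Measure Ω) (τ : Edge d → Ω → ℝ) (χ : ℝ) : Prop where
  nonneg : 0 ≤ χ
  lt_one : χ < 1
  variance_exponent :
    Tendsto (fun x : Fin d → ℤ =>
      Real.log (variance (T τ 0 (toEuclid x)) P) / (2 * Real.log ‖toEuclid x‖)) cofinite (𝓝 χ)
  nonrandom_exponent :
    limsup (fun x : Fin d → ℤ =>
      ((Real.log ((∫ ω, T τ 0 (toEuclid x) ω ∂P) - timeConstant P τ (toEuclid x)) /
        Real.log ‖toEuclid x‖ : ℝ) : EReal)) cofinite ≤ (χ : EReal)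
  concentration : ∀ ε : ℝ, 0 < ε → ∃ θ : ℝ, 0 < θ ∧ ∀ x : Fin d → ℤ, x ≠ 0 →
    P.real {ω | ‖toEuclid x‖ ^ (χ + ε) <
        |T τ 0 (toEuclid x) ω - ∫ ω', T τ 0 (toEuclid x) ω' ∂P|}
      ≤ Real.exp (-(‖toEuclid x‖ ^ θ))

end FPP

end

/-! Let ζN be the excess over Nμ(u), so ζ = N^(a-1) in part 1, and let first χ > 0. Choose a length
n with ζ ≈ n^(-(1-χ)), up to small powers of n. At scale n a passage time fluctuates by about n^χ,
which is an excess ζ per unit length. The slow event forces such an excess everywhere in a tube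
around the segment from 0 to Nu and leaves the rest of space typical.

The tube has half-width A ≈ √ζ N. By positive curvature a path leaving it sideways pays about A²/N ≈
ζN more than Nμ(u) (`CurvedFrame.exit_excess`), provided that no passage from either endpoint is
abnormally fast, which has probability bounded below (`FullConcentration.lowerSet_prob`). A path
staying in the tube crosses N/n consecutive slabs of thickness L ≈ n; if each crossing is slow by
L^(χ-δ), the total excess is at least of order ζN (`CurvedFrame.chain_le_pathTime`).

To make all crossings slow, cut each slab into cells of side about L^((1+χ)/2), the transversal
scale at which curvature costs as much as the fluctuations. The variance exponent and concentration
together make one fixed passage slow with probability at least a negative power of its length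
(`FullConcentration.exceed`). Finite curvature carries this over to all pairs of points in two
nearby cells, by fixing one point behind the first cell and one beyond the second
(`CurvedFrame.near`). Distant cells are slow by positive curvature with probability at least 1/2
(`CurvedFrame.far`). The tube holds about (N/n)·(A/n^((1+χ)/2))^(d-1) ≈ (N/n)^d cells, each costing
a small power of n in the exponent (`CurvedFrame.chain_prob`, `cell_count_le`). As n^(-d) ≈
ζ^(d/(1-χ)), this is the claimed rate. All events are increasing in the weights, so the Harris
inequality multiplies their probabilities without any independence (`IsWeights.harris`).

For χ = 0 the fluctuations give nothing, but the target exponent is d. It then suffices to make all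
edges in a ball of radius of order ζN heavier than their mean (`FullConcentration.ball_upper_tail`).
The endpoint a = 1 uses a heavy ball of radius N|u|₁ (`IsWeights.linear_upper_tail`). Both parts of
the theorem follow from one bound uniform in ζ and N, `FullConcentration.exp_neg_le_upper_tail`. -/

noncomputable section

namespace FPP

/-! ### Paths, passage times and lattice symmetries for deterministic weights. -/

section Paths

variable {d : ℕ}

open Classical in
/-- The extension by zero of edge weights to all unordered pairs. -/
def extendWeight (w : Edge d → ℝ) (e : Sym2 (Fin d → ℤ)) : ℝ :=
  if h : e ∈ (lattice d).edgeSet then w ⟨e, h⟩ else 0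

lemma extendWeight_of_mem (w : Edge d → ℝ) {e : Sym2 (Fin d → ℤ)} (h : e ∈ (lattice d).edgeSet) :
    extendWeight w e = w ⟨e, h⟩ := dif_pos h

/-- Extending the weights by zero removes the membership proofs from the sum, so that list lemmas on
append and reverse apply. -/
lemma pathTime_eq_sum (w : Edge d → ℝ) {x y : Fin d → ℤ} (γ : (lattice d).Walk x y) :
    pathTime w γ = (γ.edges.map (extendWeight w)).sum := by
  unfold pathTime
  congr 1
  conv_rhs => rw [← List.attach_map_subtype_val γ.edges, List.map_map]
  refine List.map_congr_left fun e _ => ?_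
  simp only [Function.comp]
  rw [extendWeight_of_mem w (γ.edges_subset_edgeSet e.2)]

lemma pathTime_nil (w : Edge d → ℝ) (x : Fin d → ℤ) :
    pathTime w (SimpleGraph.Walk.nil : (lattice d).Walk x x) = 0 := by
  simp [pathTime_eq_sum]

lemma pathTime_cons (w : Edge d → ℝ) {x y z : Fin d → ℤ} (h : (lattice d).Adj x y)
    (γ : (lattice d).Walk y z) :
    pathTime w (.cons h γ) = w ⟨s(x, y), h⟩ + pathTime w γ := by
  simp only [pathTime_eq_sum, SimpleGraph.Walk.edges_cons, List.map_cons, List.sum_cons]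
  rw [extendWeight_of_mem w (e := s(x, y)) h]

lemma pathTime_append (w : Edge d → ℝ) {x y z : Fin d → ℤ} (γ : (lattice d).Walk x y)
    (γ' : (lattice d).Walk y z) :
    pathTime w (γ.append γ') = pathTime w γ + pathTime w γ' := by
  simp [pathTime_eq_sum, SimpleGraph.Walk.edges_append]

lemma pathTime_reverse (w : Edge d → ℝ) {x y : Fin d → ℤ} (γ : (lattice d).Walk x y) :
    pathTime w γ.reverse = pathTime w γ := by
  simp [pathTime_eq_sum, SimpleGraph.Walk.edges_reverse, List.sum_reverse]

lemma pathTime_nonneg {w : Edge d → ℝ} (hw : ∀ e, 0 ≤ w e) {x y : Fin d → ℤ}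
    (γ : (lattice d).Walk x y) : 0 ≤ pathTime w γ := by
  unfold pathTime
  refine List.sum_nonneg fun a ha => ?_
  obtain ⟨e, -, rfl⟩ := List.mem_map.1 ha
  exact hw _

lemma pathTime_le {w : Edge d → ℝ} {C : ℝ} (hw : ∀ e, w e ≤ C) {x y : Fin d → ℤ}
    (γ : (lattice d).Walk x y) : pathTime w γ ≤ C * γ.length := by
  induction γ with
  | nil => simp [pathTime_nil]
  | cons h γ ih =>
    rw [pathTime_cons, SimpleGraph.Walk.length_cons]
    push_cast
    linarith [hw ⟨s(_, _), h⟩]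

lemma le_pathTime {w : Edge d → ℝ} {b : ℝ} {x y : Fin d → ℤ}
    (γ : (lattice d).Walk x y) (hw : ∀ e : Edge d, e.1 ∈ γ.edges → b ≤ w e) :
    b * γ.length ≤ pathTime w γ := by
  induction γ with
  | nil => simp [pathTime_nil]
  | cons h γ ih =>
    rw [pathTime_cons, SimpleGraph.Walk.length_cons]
    push_cast
    have h1 := hw ⟨s(_, _), h⟩ (by simp)
    have h2 := ih fun e he => hw e (by simp [he])
    linarith

/-- The `ℓ¹` norm of a lattice point. -/
def l1 (z : Fin d → ℤ) : ℝ := ∑ i, |(z i : ℝ)|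

lemma l1_add_le (x y : Fin d → ℤ) : l1 (x + y) ≤ l1 x + l1 y := by
  unfold l1
  rw [← Finset.sum_add_distrib]
  refine Finset.sum_le_sum fun i _ => ?_
  simp only [Pi.add_apply, Int.cast_add]
  exact abs_add_le _ _

lemma l1_neg (x : Fin d → ℤ) : l1 (-x) = l1 x := by simp [l1]

lemma l1_sub_of_adj {x y : Fin d → ℤ} (h : (lattice d).Adj x y) : l1 (y - x) = 1 := by
  have h' : ∑ i, |x i - y i| = 1 := h
  have : ((∑ i, |x i - y i| : ℤ) : ℝ) = 1 := by rw [h']; simp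
  rw [← this]
  simp only [l1, Pi.sub_apply]
  push_cast
  exact Finset.sum_congr rfl fun i _ => abs_sub_comm _ _

lemma l1_sub_le_length {x y : Fin d → ℤ} (γ : (lattice d).Walk x y) :
    l1 (y - x) ≤ γ.length := by
  induction γ with
  | nil => simp [l1]
  | @cons x y z h γ ih =>
    rw [SimpleGraph.Walk.length_cons]
    push_cast
    have := l1_add_le (z - y) (y - x)
    rw [sub_add_sub_cancel, l1_sub_of_adj h] at this
    linarith

lemma exists_walk_length_eq (x y : Fin d → ℤ) :
    ∃ γ : (lattice d).Walk x y, (γ.length : ℝ) = l1 (y - x) := by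
  obtain ⟨n, hn⟩ : ∃ n : ℕ, ∑ i, (y i - x i).natAbs = n := ⟨_, rfl⟩
  have key : ∀ n : ℕ, ∀ x : Fin d → ℤ, ∑ i, (y i - x i).natAbs = n →
      ∃ γ : (lattice d).Walk x y, γ.length = n := by
    intro n
    induction n with
    | zero =>
      intro x hx
      have : x = y := by
        funext i
        have := (Finset.sum_eq_zero_iff.1 hx) i (Finset.mem_univ i)
        omega
      subst this
      exact ⟨.nil, rfl⟩
    | succ n ih =>
      intro x hx
      obtain ⟨i, hi⟩ : ∃ i, y i ≠ x i := by
        by_contra! hcon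
        rw [Finset.sum_eq_zero fun i _ => by simp [hcon i]] at hx
        omega
      set x' : Fin d → ℤ := Function.update x i (x i + (y i - x i).sign) with hx'
      have hs : (y i - x i).sign.natAbs = 1 := Int.natAbs_sign_of_ne_zero (by omega)
      have hadj : (lattice d).Adj x x' := by
        change ∑ j, |x j - x' j| = 1
        rw [Finset.sum_eq_single i]
        · simp only [hx', Function.update_self]
          rw [Int.abs_eq_natAbs]; omega
        · intro j _ hj; simp [hx', Function.update_of_ne hj]
        · simp
      have hsum : ∑ j, (y j - x' j).natAbs = n := by
        rw [← Finset.add_sum_erase _ _ (Finset.mem_univ i)] at hx ⊢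
        have h1 : ∑ j ∈ Finset.univ.erase i, (y j - x' j).natAbs =
            ∑ j ∈ Finset.univ.erase i, (y j - x j).natAbs :=
          Finset.sum_congr rfl fun j hj => by
            simp [hx', Function.update_of_ne (Finset.ne_of_mem_erase hj)]
        rw [h1]
        have h2 : (y i - x' i).natAbs + 1 = (y i - x i).natAbs := by
          simp only [hx', Function.update_self]
          rcases lt_or_gt_of_ne hi with h | h
          · rw [Int.sign_eq_neg_one_of_neg (by omega)]; omega
          · rw [Int.sign_eq_one_of_pos (by omega)]; omega
        omega
      obtain ⟨γ, hγ⟩ := ih x' hsum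
      exact ⟨.cons hadj γ, by simp [hγ]⟩
  obtain ⟨γ, hγ⟩ := key n x hn
  refine ⟨γ, ?_⟩
  rw [hγ, ← hn, l1]
  push_cast
  exact Finset.sum_congr rfl fun i _ => by
    rw [Pi.sub_apply, Nat.cast_natAbs, Int.cast_abs]

/-- Without a path the real infimum in `latticeTime` would be a default value; with one, lower
bounds on all paths pass to the infimum. -/
instance nonempty_walk (x y : Fin d → ℤ) : Nonempty ((lattice d).Walk x y) :=
  ⟨(exists_walk_length_eq x y).choose⟩

/-- Countability makes passage times measurable and makes the slow events countable intersections.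
-/
instance countable_walk (x y : Fin d → ℤ) : Countable ((lattice d).Walk x y) := by
  refine Function.Injective.countable
    (f := fun γ : (lattice d).Walk x y => γ.support) ?_
  exact fun γ γ' h => SimpleGraph.Walk.ext_support h

lemma latticeTime_le_pathTime {w : Edge d → ℝ} (hw : ∀ e, 0 ≤ w e) {x y : Fin d → ℤ}
    (γ : (lattice d).Walk x y) : latticeTime w x y ≤ pathTime w γ :=
  ciInf_le ⟨0, by rintro _ ⟨γ, rfl⟩; exact pathTime_nonneg hw γ⟩ γ

lemma le_latticeTime {w : Edge d → ℝ} {x y : Fin d → ℤ} {t : ℝ}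
    (h : ∀ γ : (lattice d).Walk x y, t ≤ pathTime w γ) : t ≤ latticeTime w x y :=
  le_ciInf h

lemma le_latticeTime_iff {w : Edge d → ℝ} (hw : ∀ e, 0 ≤ w e) {x y : Fin d → ℤ} {t : ℝ} :
    t ≤ latticeTime w x y ↔ ∀ γ : (lattice d).Walk x y, t ≤ pathTime w γ :=
  ⟨fun h γ => h.trans (latticeTime_le_pathTime hw γ), le_latticeTime⟩

lemma latticeTime_nonneg {w : Edge d → ℝ} (hw : ∀ e, 0 ≤ w e) (x y : Fin d → ℤ) :
    0 ≤ latticeTime w x y := le_latticeTime fun γ => pathTime_nonneg hw γ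

lemma latticeTime_triangle {w : Edge d → ℝ} (hw : ∀ e, 0 ≤ w e) (x y z : Fin d → ℤ) :
    latticeTime w x z ≤ latticeTime w x y + latticeTime w y z := by
  rw [← sub_le_iff_le_add]
  refine le_latticeTime fun γ => ?_
  rw [sub_le_comm]
  refine le_latticeTime fun γ' => ?_
  have := latticeTime_le_pathTime hw (γ.append γ')
  rw [pathTime_append] at this
  linarith

lemma latticeTime_comm {w : Edge d → ℝ} (hw : ∀ e, 0 ≤ w e) (x y : Fin d → ℤ) :
    latticeTime w x y = latticeTime w y x := by
  have key : ∀ x y, latticeTime w x y ≤ latticeTime w y x := fun x y =>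
    le_latticeTime fun γ => by
      rw [← pathTime_reverse]
      exact latticeTime_le_pathTime hw _
  exact le_antisymm (key x y) (key y x)

lemma latticeTime_le {w : Edge d → ℝ} (hw : ∀ e, 0 ≤ w e) {C : ℝ} (hC : ∀ e, w e ≤ C)
    (x y : Fin d → ℤ) : latticeTime w x y ≤ C * l1 (y - x) := by
  obtain ⟨γ, hγ⟩ := exists_walk_length_eq x y
  rw [← hγ]
  exact (latticeTime_le_pathTime hw γ).trans (pathTime_le hC γ)

lemma pathTime_map (φ : lattice d ≃g lattice d) (w : Edge d → ℝ) {x y : Fin d → ℤ}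
    (γ : (lattice d).Walk x y) :
    pathTime w (γ.map φ.toHom) = pathTime (fun e => w (φ.mapEdgeSet e)) γ := by
  induction γ with
  | nil => simp [pathTime_nil]
  | cons h γ ih =>
    rw [SimpleGraph.Walk.map_cons, pathTime_cons, pathTime_cons, ih]
    rfl

lemma latticeTime_map (φ : lattice d ≃g lattice d) {w : Edge d → ℝ} (hw : ∀ e, 0 ≤ w e)
    (x y : Fin d → ℤ) :
    latticeTime (fun e => w (φ.mapEdgeSet e)) x y = latticeTime w (φ x) (φ y) := by
  have key : ∀ (φ : lattice d ≃g lattice d) (w : Edge d → ℝ) (_ : ∀ e, 0 ≤ w e) (x y : Fin d → ℤ),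
      latticeTime w (φ x) (φ y) ≤ latticeTime (fun e => w (φ.mapEdgeSet e)) x y :=
    fun φ w hw x y => le_latticeTime fun γ => by
      rw [← pathTime_map]
      exact latticeTime_le_pathTime hw (γ.map φ.toHom)
  refine le_antisymm ?_ (key φ w hw x y)
  have := key φ.symm (fun e => w (φ.mapEdgeSet e)) (fun e => hw _) (φ x) (φ y)
  have h2 : (fun e => w (φ.mapEdgeSet (φ.symm.mapEdgeSet e))) = w := by
    funext e
    congr 1
    exact φ.mapEdgeSet.apply_symm_apply e
  rw [h2] at this
  have e1 : φ.symm (φ x) = x := φ.symm_apply_apply x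
  have e2 : φ.symm (φ y) = y := φ.symm_apply_apply y
  rwa [e1, e2] at this

/-- Splitting a path at its first vertex with a given property. -/
lemma exists_first_vertex (Q : (Fin d → ℤ) → Prop) {x y : Fin d → ℤ} (γ : (lattice d).Walk x y)
    (hx : ¬ Q x) (hy : Q y) :
    ∃ (p z : Fin d → ℤ) (γ₁ : (lattice d).Walk x z) (γ₂ : (lattice d).Walk z y),
      γ₁.append γ₂ = γ ∧ (lattice d).Adj p z ∧ ¬ Q p ∧ Q z ∧
      (∀ v ∈ γ₁.support, v = z ∨ ¬ Q v) := by
  induction γ with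
  | nil => exact absurd hy hx
  | @cons x x' y h γ ih =>
    by_cases hx' : Q x'
    · refine ⟨x, x', .cons h .nil, γ, rfl, h, hx, hx', ?_⟩
      simp [hx]
    · obtain ⟨p, z, γ₁, γ₂, h1, h2, h3, h4, h5⟩ := ih hx' hy
      refine ⟨p, z, .cons h γ₁, γ₂, by rw [SimpleGraph.Walk.cons_append, h1], h2, h3, h4, ?_⟩
      intro v hv
      rw [SimpleGraph.Walk.support_cons, List.mem_cons] at hv
      rcases hv with rfl | hv
      · exact Or.inr hx
      · exact h5 v hv

end Paths

/-! ### Random weights: measurability, invariance in law and mean passage times. -/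

section Basics

variable {d : ℕ} {Ω : Type*}

lemma floorPt_zero : floorPt (0 : EuclideanSpace ℝ (Fin d)) = 0 := by
  funext i; simp [floorPt]

lemma floorPt_toEuclid (z : Fin d → ℤ) : floorPt (toEuclid z) = z := by
  funext i; simp [floorPt, toEuclid]

lemma T_zero_left (τ : Edge d → Ω → ℝ) (x : EuclideanSpace ℝ (Fin d)) (ω : Ω) :
    T τ 0 x ω = latticeTime (fun e => τ e ω) 0 (floorPt x) := by
  rw [T, floorPt_zero]

lemma T_toEuclid (τ : Edge d → Ω → ℝ) (z : Fin d → ℤ) :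
    T τ 0 (toEuclid z) = fun ω => latticeTime (fun e => τ e ω) 0 z := by
  funext ω; rw [T_zero_left, floorPt_toEuclid]

instance countable_edge : Countable (Edge d) := inferInstance

variable [MeasurableSpace Ω]

lemma measurable_pathTime {x y : Fin d → ℤ} (γ : (lattice d).Walk x y) :
    Measurable fun w : Edge d → ℝ => pathTime w γ := by
  induction γ with
  | nil => simp only [pathTime_nil]; exact measurable_const
  | cons h γ ih =>
    simp only [pathTime_cons]
    exact (measurable_pi_apply _).add ih

lemma measurable_latticeTime (x y : Fin d → ℤ) :
    Measurable fun w : Edge d → ℝ => latticeTime w x y :=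
  Measurable.iInf fun γ => measurable_pathTime γ

variable {P : Measure Ω} {τ : Edge d → Ω → ℝ}

namespace IsWeights

lemma measurable_pi (hτ : IsWeights P τ) : Measurable fun ω e => τ e ω :=
  measurable_pi_iff.2 hτ.measurable

lemma measurable_time (hτ : IsWeights P τ) (x y : Fin d → ℤ) :
    Measurable fun ω => latticeTime (fun e => τ e ω) x y :=
  (measurable_latticeTime x y).comp hτ.measurable_pi

lemma ae_nonneg (hτ : IsWeights P τ) : ∀ᵐ ω ∂P, ∀ e, 0 ≤ τ e ω :=
  ae_all_iff.2 hτ.nonneg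

lemma exists_bound (hτ : IsWeights P τ) : ∃ C : ℝ, 0 < C ∧ ∀ᵐ ω ∂P, ∀ e, τ e ω ≤ C := by
  obtain ⟨C, hC⟩ := hτ.bounded
  refine ⟨max C 1, by positivity, ae_all_iff.2 fun e => ?_⟩
  filter_upwards [hC e] with ω h using h.trans (le_max_left _ _)

/-- By independence both laws are infinite products, and their factors agree because the weights are
identically distributed. -/
lemma map_reindex [IsProbabilityMeasure P] (hτ : IsWeights P τ) (σ : Edge d ≃ Edge d) :
    P.map (fun ω e => τ (σ e) ω) = P.map (fun ω e => τ e ω) := by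
  have h1 : iIndepFun (fun e => τ (σ e)) P := hτ.indep.precomp σ.injective
  rw [h1.map_fun_eq_infinitePi_map fun e => hτ.measurable _,
    hτ.indep.map_fun_eq_infinitePi_map hτ.measurable]
  congr 1
  funext e
  exact (hτ.identDistrib _ _).map_eq

/-- The law of the weights is invariant under permutations of the edges. The two passage times are
matched only almost everywhere, because `latticeTime_map` needs nonnegative weights. -/
lemma identDistrib_map [IsProbabilityMeasure P] (hτ : IsWeights P τ) (φ : lattice d ≃g lattice d)
    (x y : Fin d → ℤ) :
    IdentDistrib (fun ω => latticeTime (fun e => τ e ω) x y)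
      (fun ω => latticeTime (fun e => τ e ω) (φ x) (φ y)) P P := by
  have h1 : IdentDistrib (fun ω e => τ e ω) (fun ω e => τ (φ.mapEdgeSet e) ω) P P :=
    ⟨hτ.measurable_pi.aemeasurable,
      (measurable_pi_iff.2 fun e => hτ.measurable _).aemeasurable, (hτ.map_reindex _).symm⟩
  have h2 := h1.comp (measurable_latticeTime x y)
  refine ⟨h2.aemeasurable_fst, (hτ.measurable_time _ _).aemeasurable, h2.map_eq.trans ?_⟩
  refine Measure.map_congr ?_
  filter_upwards [hτ.ae_nonneg] with ω hω
  exact latticeTime_map φ hω x y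

end IsWeights

/-- Translations of the lattice. -/
def translateIso (a : Fin d → ℤ) : lattice d ≃g lattice d where
  toEquiv := Equiv.addLeft a
  map_rel_iff' := by
    intro x y
    simp [lattice]

/-- Reflection of the lattice in a coordinate hyperplane. -/
def reflectIso (i : Fin d) : lattice d ≃g lattice d where
  toEquiv := ⟨fun x j => if j = i then - x j else x j, fun x j => if j = i then - x j else x j,
    fun x => by funext j; by_cases h : j = i <;> simp [h],
    fun x => by funext j; by_cases h : j = i <;> simp [h]⟩
  map_rel_iff' := by
    intro x y
    simp only [lattice, Equiv.coe_fn_mk]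
    rw [Finset.sum_congr rfl]
    intro j _
    split_ifs
    · rw [neg_sub_neg, abs_sub_comm]
    · rfl

/-- Permutations of the coordinates of the lattice. -/
def permIso (π : Equiv.Perm (Fin d)) : lattice d ≃g lattice d where
  toEquiv := Equiv.arrowCongr π (Equiv.refl ℤ)
  map_rel_iff' := by
    intro x y
    simp only [lattice, Equiv.arrowCongr_apply, Equiv.coe_refl, Function.comp, id]
    rw [Equiv.sum_comp π.symm fun i => |x i - y i|]

/-- The mean passage time from the origin to a lattice point. -/
def meanTime (P : Measure Ω) (τ : Edge d → Ω → ℝ) (z : Fin d → ℤ) : ℝ :=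
  ∫ ω, latticeTime (fun e => τ e ω) 0 z ∂P

namespace IsWeights

lemma ae_time_nonneg (hτ : IsWeights P τ) :
    ∀ᵐ ω ∂P, ∀ x y, 0 ≤ latticeTime (fun e => τ e ω) x y := by
  filter_upwards [hτ.ae_nonneg] with ω hω x y using latticeTime_nonneg hω x y

lemma exists_time_bound (hτ : IsWeights P τ) : ∃ C : ℝ, 0 < C ∧
    ∀ᵐ ω ∂P, ∀ x y, latticeTime (fun e => τ e ω) x y ≤ C * l1 (y - x) := by
  obtain ⟨C, hC, h⟩ := hτ.exists_bound
  refine ⟨C, hC, ?_⟩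
  filter_upwards [hτ.ae_nonneg, h] with ω hω h x y using latticeTime_le hω h x y

lemma meanTime_nonneg (hτ : IsWeights P τ) (x : Fin d → ℤ) : 0 ≤ meanTime P τ x :=
  integral_nonneg_of_ae (by filter_upwards [hτ.ae_time_nonneg] with ω h using h _ _)

variable [IsProbabilityMeasure P]

lemma integrable_time (hτ : IsWeights P τ) (x y : Fin d → ℤ) :
    Integrable (fun ω => latticeTime (fun e => τ e ω) x y) P := by
  obtain ⟨C, hC, h⟩ := hτ.exists_time_bound
  refine Integrable.of_bound (hτ.measurable_time x y).aestronglyMeasurable (C * l1 (y - x)) ?_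
  filter_upwards [h, hτ.ae_time_nonneg] with ω h h'
  rw [Real.norm_of_nonneg (h' x y)]
  exact h x y

lemma identDistrib_translate (hτ : IsWeights P τ) (x y : Fin d → ℤ) :
    IdentDistrib (fun ω => latticeTime (fun e => τ e ω) 0 (y - x))
      (fun ω => latticeTime (fun e => τ e ω) x y) P P := by
  have := hτ.identDistrib_map (translateIso x) 0 (y - x)
  have e1 : translateIso x 0 = x := add_zero x
  have e2 : translateIso x (y - x) = y := add_sub_cancel x y
  rwa [e1, e2] at this

lemma integral_time (hτ : IsWeights P τ) (x y : Fin d → ℤ) :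
    ∫ ω, latticeTime (fun e => τ e ω) x y ∂P = meanTime P τ (y - x) :=
  (hτ.identDistrib_translate x y).integral_eq.symm

lemma meanTime_add_le (hτ : IsWeights P τ) (x y : Fin d → ℤ) :
    meanTime P τ (x + y) ≤ meanTime P τ x + meanTime P τ y := by
  have h1 := hτ.integral_time x (x + y)
  rw [add_sub_cancel_left] at h1
  rw [← h1, meanTime, meanTime,
    ← integral_add (hτ.integrable_time _ _) (hτ.integrable_time _ _)]
  refine integral_mono_ae (hτ.integrable_time _ _)
    ((hτ.integrable_time _ _).add (hτ.integrable_time _ _)) ?_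
  filter_upwards [hτ.ae_nonneg] with ω hω using latticeTime_triangle hω _ _ _

lemma meanTime_neg (hτ : IsWeights P τ) (x : Fin d → ℤ) :
    meanTime P τ (-x) = meanTime P τ x := by
  have h1 := hτ.integral_time x 0
  rw [zero_sub] at h1
  rw [← h1, meanTime]
  refine integral_congr_ae ?_
  filter_upwards [hτ.ae_nonneg] with ω hω using latticeTime_comm hω _ _

lemma exists_meanTime_le (hτ : IsWeights P τ) : ∃ C : ℝ, 0 < C ∧
    ∀ z, meanTime P τ z ≤ C * l1 z := by
  obtain ⟨C, hC, h⟩ := hτ.exists_time_bound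
  refine ⟨C, hC, fun z => ?_⟩
  have := integral_mono_ae (hτ.integrable_time 0 z) (integrable_const (C * l1 z)) (by
    filter_upwards [h] with ω h using by simpa using h 0 z)
  simpa [meanTime] using this

lemma meanTime_map (hτ : IsWeights P τ) (φ : lattice d ≃g lattice d) (h0 : φ 0 = 0)
    (z : Fin d → ℤ) : meanTime P τ (φ z) = meanTime P τ z := by
  have := (hτ.identDistrib_map φ 0 z).integral_eq
  rw [h0] at this
  exact this.symm

/-- The mean passage time is at most the mean weight times the `ℓ¹` distance. -/
lemma meanTime_le_mean (hτ : IsWeights P τ) (e₀ : Edge d) (z : Fin d → ℤ) :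
    meanTime P τ z ≤ (∫ ω, τ e₀ ω ∂P) * l1 z := by
  obtain ⟨C, hC, hb⟩ := hτ.exists_bound
  have hint : ∀ e, Integrable (τ e) P := fun e =>
    Integrable.of_bound (hτ.measurable e).aestronglyMeasurable C (by
      filter_upwards [hb, hτ.ae_nonneg] with ω h h'
      rw [Real.norm_of_nonneg (h' e)]; exact h e)
  have key : ∀ {x y : Fin d → ℤ} (γ : (lattice d).Walk x y),
      Integrable (fun ω => pathTime (fun e => τ e ω) γ) P ∧
      ∫ ω, pathTime (fun e => τ e ω) γ ∂P = (∫ ω, τ e₀ ω ∂P) * γ.length := by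
    intro x y γ
    induction γ with
    | nil => simp [pathTime_nil]
    | cons h γ ih =>
      simp only [pathTime_cons, SimpleGraph.Walk.length_cons]
      refine ⟨(hint _).add ih.1, ?_⟩
      rw [integral_add (hint _) ih.1, ih.2, (hτ.identDistrib _ e₀).integral_eq]
      push_cast; ring
  obtain ⟨γ, hγ⟩ := exists_walk_length_eq 0 z
  rw [sub_zero] at hγ
  rw [← hγ, ← (key γ).2, meanTime]
  refine integral_mono_ae (hτ.integrable_time _ _) (key γ).1 ?_
  filter_upwards [hτ.ae_nonneg] with ω hω using latticeTime_le_pathTime hω γ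

end IsWeights

end Basics

/-! ### The time constant as a symmetric, homogeneous, subadditive function. -/

section TimeConstant

variable {d : ℕ} {Ω : Type*}

/-- The `ℓ¹` norm of a point of Euclidean space. -/
def l1E (x : EuclideanSpace ℝ (Fin d)) : ℝ := ∑ i, |x i|

lemma l1E_nonneg (x : EuclideanSpace ℝ (Fin d)) : 0 ≤ l1E x :=
  Finset.sum_nonneg fun _ _ => abs_nonneg _

lemma l1E_le (x : EuclideanSpace ℝ (Fin d)) : l1E x ≤ d * ‖x‖ := by
  have : ∑ i, |x i| ≤ ∑ _i : Fin d, ‖x‖ :=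
    Finset.sum_le_sum fun i _ => PiLp.norm_apply_le x i
  simpa [l1E] using this

lemma norm_le_l1E (x : EuclideanSpace ℝ (Fin d)) : ‖x‖ ≤ l1E x := by
  rw [EuclideanSpace.norm_eq]
  refine Real.sqrt_le_iff.2 ⟨l1E_nonneg x, ?_⟩
  exact Finset.sum_sq_le_sq_sum_of_nonneg (fun i _ => norm_nonneg (x i))

lemma l1E_smul (c : ℝ) (x : EuclideanSpace ℝ (Fin d)) : l1E (c • x) = |c| * l1E x := by
  simp [l1E, abs_mul, Finset.mul_sum]

lemma l1E_toEuclid (z : Fin d → ℤ) : l1E (toEuclid z) = l1 z := rfl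

lemma l1_floorPt_sub_le (x y : EuclideanSpace ℝ (Fin d)) :
    l1 (floorPt x - floorPt y) ≤ l1E (x - y) + d := by
  have : ∑ i, |((floorPt x - floorPt y) i : ℝ)| ≤ ∑ i : Fin d, (|(x - y) i| + 1) := by
    refine Finset.sum_le_sum fun i _ => ?_
    simp only [Pi.sub_apply, floorPt, PiLp.sub_apply, Int.cast_sub]
    have h1 := Int.floor_le (x i)
    have h2 := Int.lt_floor_add_one (x i)
    have h3 := Int.floor_le (y i)
    have h4 := Int.lt_floor_add_one (y i)
    have h5 := le_abs_self (x i - y i)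
    have h6 := neg_abs_le (x i - y i)
    rw [abs_le]; constructor <;> linarith
  simpa [l1, l1E, Finset.sum_add_distrib] using this

lemma l1_floorPt_add_le (x y : EuclideanSpace ℝ (Fin d)) :
    l1 (floorPt (x + y) - (floorPt x + floorPt y)) ≤ d := by
  have : ∑ i, |((floorPt (x + y) - (floorPt x + floorPt y)) i : ℝ)| ≤ ∑ _i : Fin d, (1 : ℝ) := by
    refine Finset.sum_le_sum fun i _ => ?_
    simp only [Pi.sub_apply, Pi.add_apply, floorPt, PiLp.add_apply, Int.cast_sub, Int.cast_add]
    have h1 := Int.floor_le (x i)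
    have h2 := Int.lt_floor_add_one (x i)
    have h3 := Int.floor_le (y i)
    have h4 := Int.lt_floor_add_one (y i)
    have h5 := Int.floor_le (x i + y i)
    have h6 := Int.lt_floor_add_one (x i + y i)
    have h7 : ⌊x i⌋ + ⌊y i⌋ ≤ ⌊x i + y i⌋ := Int.le_floor_add _ _
    have h8 : ((⌊x i⌋ + ⌊y i⌋ : ℤ) : ℝ) ≤ ⌊x i + y i⌋ := by exact_mod_cast h7
    push_cast at h8
    have h9 : ⌊x i + y i⌋ < ⌊x i⌋ + ⌊y i⌋ + 2 :=
      Int.floor_lt.2 (by push_cast; linarith)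
    have h10 : ((⌊x i + y i⌋ : ℤ) : ℝ) ≤ ⌊x i⌋ + ⌊y i⌋ + 1 := by
      exact_mod_cast (by omega : ⌊x i + y i⌋ ≤ ⌊x i⌋ + ⌊y i⌋ + 1)
    rw [abs_le]; constructor <;> linarith
  simpa [l1] using this

variable [MeasurableSpace Ω] {P : Measure Ω} {τ : Edge d → Ω → ℝ}

namespace IsWeights

variable [IsProbabilityMeasure P]

lemma exists_meanTime_lipschitz (hτ : IsWeights P τ) : ∃ C : ℝ, 0 < C ∧
    ∀ z z', |meanTime P τ z - meanTime P τ z'| ≤ C * l1 (z - z') := by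
  obtain ⟨C, hC, h⟩ := hτ.exists_meanTime_le
  have key : ∀ z z', meanTime P τ z - meanTime P τ z' ≤ C * l1 (z - z') := fun z z' => by
    have h1 := hτ.meanTime_add_le (z - z') z'
    rw [sub_add_cancel] at h1
    linarith [h (z - z')]
  refine ⟨C, hC, fun z z' => abs_le.2 ⟨?_, key z z'⟩⟩
  have := key z' z
  rw [← neg_sub z z', l1_neg] at this
  linarith

/-- Fekete's lemma: the limit in the definition of the time constant exists. -/
lemma tendsto_meanTime_nat (hτ : IsWeights P τ) (x : EuclideanSpace ℝ (Fin d)) :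
    Tendsto (fun N : ℕ => meanTime P τ (floorPt ((N : ℝ) • x)) / N) atTop
      (𝓝 (timeConstant P τ x)) := by
  obtain ⟨C, hC, hL⟩ := hτ.exists_meanTime_lipschitz
  -- Flooring a sum moves the point by at most `d` in ℓ¹, hence the mean by at most `C * d`; adding
  -- this constant makes the sequence exactly subadditive and does not change the limit.
  set a : ℕ → ℝ := fun N => meanTime P τ (floorPt ((N : ℝ) • x)) + C * d with ha
  have hsub : Subadditive a := by
    intro m n
    have h1 := hL (floorPt ((m : ℝ) • x + (n : ℝ) • x))
      (floorPt ((m : ℝ) • x) + floorPt ((n : ℝ) • x))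
    have h2 := hτ.meanTime_add_le (floorPt ((m : ℝ) • x)) (floorPt ((n : ℝ) • x))
    have h3 := mul_le_mul_of_nonneg_left (l1_floorPt_add_le ((m : ℝ) • x) ((n : ℝ) • x)) hC.le
    have h4 := le_abs_self (meanTime P τ (floorPt ((m : ℝ) • x + (n : ℝ) • x)) -
      meanTime P τ (floorPt ((m : ℝ) • x) + floorPt ((n : ℝ) • x)))
    simp only [ha]
    push_cast
    rw [add_smul]
    linarith
  have hbdd : BddBelow (Set.range fun n => a n / n) := by
    refine ⟨0, ?_⟩
    rintro _ ⟨n, rfl⟩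
    have := hτ.meanTime_nonneg (floorPt ((n : ℝ) • x))
    simp only [ha]; positivity
  have h1 := hsub.tendsto_lim hbdd
  have h2 : Tendsto (fun N : ℕ => (C * d) / (N : ℝ)) atTop (𝓝 0) :=
    tendsto_const_div_atTop_nhds_zero_nat _
  have h3 := h1.sub h2
  simp only [ha, add_div, add_sub_cancel_right, sub_zero] at h3
  have h4 : timeConstant P τ x = hsub.lim := by
    refine Tendsto.limUnder_eq (h3.congr fun N => ?_)
    simp only [meanTime, T_zero_left]
  rw [h4]
  exact h3

/-- Comparison of `t` with its integer part; a continuous parameter is what makes homogeneity under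
real factors a change of variable. -/
lemma tendsto_meanTime_real (hτ : IsWeights P τ) (x : EuclideanSpace ℝ (Fin d)) :
    Tendsto (fun t : ℝ => meanTime P τ (floorPt (t • x)) / t) atTop
      (𝓝 (timeConstant P τ x)) := by
  obtain ⟨C, hC, hL⟩ := hτ.exists_meanTime_lipschitz
  have h1 := ((hτ.tendsto_meanTime_nat x).comp (tendsto_nat_floor_atTop (α := ℝ))).mul
    (tendsto_nat_floor_div_atTop (R := ℝ))
  rw [mul_one] at h1
  have h2 : Tendsto (fun t : ℝ => C * (l1E x + d) / t) atTop (𝓝 0) :=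
    tendsto_const_nhds.div_atTop tendsto_id
  refine tendsto_of_tendsto_of_dist h1 (squeeze_zero' (.of_forall fun _ => dist_nonneg) ?_ h2)
  filter_upwards [eventually_ge_atTop 1] with t ht
  have hf : (0 : ℝ) < ⌊t⌋₊ := by exact_mod_cast Nat.floor_pos.2 ht
  have ht0 : 0 < t := by linarith
  simp only [Function.comp]
  rw [div_mul_div_cancel₀ hf.ne', Real.dist_eq, ← sub_div, abs_div, abs_of_pos ht0]
  gcongr
  refine (hL _ _).trans ?_
  gcongr
  refine (l1_floorPt_sub_le _ _).trans ?_
  rw [← sub_smul, l1E_smul]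
  gcongr
  refine mul_le_of_le_one_left (l1E_nonneg x) ?_
  rw [abs_le]
  constructor <;> linarith [Nat.floor_le ht0.le, Nat.lt_floor_add_one t]

lemma timeConstant_congr (hτ : IsWeights P τ) {x y : EuclideanSpace ℝ (Fin d)} {B : ℝ}
    (h : ∀ t : ℝ, |meanTime P τ (floorPt (t • x)) - meanTime P τ (floorPt (t • y))| ≤ B) :
    timeConstant P τ x = timeConstant P τ y := by
  have h1 := hτ.tendsto_meanTime_real x
  refine tendsto_nhds_unique ?_ (hτ.tendsto_meanTime_real y)
  have h2 : Tendsto (fun t : ℝ => B / t) atTop (𝓝 0) :=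
    tendsto_const_nhds.div_atTop tendsto_id
  refine tendsto_of_tendsto_of_dist h1 (squeeze_zero' (.of_forall fun _ => dist_nonneg) ?_ h2)
  filter_upwards [eventually_gt_atTop 0] with t ht
  rw [Real.dist_eq, ← sub_div, abs_div, abs_of_pos ht]
  gcongr
  exact h t

lemma timeConstant_nonneg (hτ : IsWeights P τ) (x : EuclideanSpace ℝ (Fin d)) :
    0 ≤ timeConstant P τ x := by
  refine ge_of_tendsto' (hτ.tendsto_meanTime_nat x) fun N => ?_
  have := hτ.meanTime_nonneg (floorPt ((N : ℝ) • x))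
  positivity

lemma timeConstant_neg (hτ : IsWeights P τ) (x : EuclideanSpace ℝ (Fin d)) :
    timeConstant P τ (-x) = timeConstant P τ x := by
  obtain ⟨C, hC, hL⟩ := hτ.exists_meanTime_lipschitz
  refine hτ.timeConstant_congr (B := C * d) fun t => ?_
  rw [← hτ.meanTime_neg (floorPt (t • x))]
  refine (hL _ _).trans ?_
  gcongr
  have := l1_floorPt_add_le (t • -x) (t • x)
  have h0 : floorPt (t • -x + t • x) = 0 := by rw [smul_neg, neg_add_cancel, floorPt_zero]
  rw [h0, zero_sub, l1_neg] at this
  rwa [sub_neg_eq_add]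

lemma timeConstant_smul_of_pos (hτ : IsWeights P τ) {c : ℝ} (hc : 0 < c)
    (x : EuclideanSpace ℝ (Fin d)) : timeConstant P τ (c • x) = c * timeConstant P τ x := by
  have h1 := (hτ.tendsto_meanTime_real x).comp (tendsto_id.atTop_mul_const hc)
  refine tendsto_nhds_unique (hτ.tendsto_meanTime_real (c • x)) ((h1.const_mul c).congr fun t => ?_)
  simp only [Function.comp, id, smul_smul]
  rcases eq_or_ne t 0 with rfl | ht
  · simp
  · field_simp

lemma timeConstant_zero (hτ : IsWeights P τ) :
    timeConstant P τ (0 : EuclideanSpace ℝ (Fin d)) = 0 := by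
  have := hτ.timeConstant_smul_of_pos two_pos (0 : EuclideanSpace ℝ (Fin d))
  rw [smul_zero] at this
  linarith

lemma timeConstant_smul (hτ : IsWeights P τ) (c : ℝ) (x : EuclideanSpace ℝ (Fin d)) :
    timeConstant P τ (c • x) = |c| * timeConstant P τ x := by
  rcases lt_trichotomy c 0 with hc | rfl | hc
  · rw [← hτ.timeConstant_neg, ← neg_smul, hτ.timeConstant_smul_of_pos (neg_pos.2 hc),
      abs_of_neg hc]
  · simp [hτ.timeConstant_zero]
  · rw [hτ.timeConstant_smul_of_pos hc, abs_of_pos hc]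

lemma timeConstant_add_le (hτ : IsWeights P τ) (x y : EuclideanSpace ℝ (Fin d)) :
    timeConstant P τ (x + y) ≤ timeConstant P τ x + timeConstant P τ y := by
  obtain ⟨C, hC, hL⟩ := hτ.exists_meanTime_lipschitz
  have h2 : Tendsto (fun t : ℝ => C * d / t) atTop (𝓝 0) :=
    tendsto_const_nhds.div_atTop tendsto_id
  have h3 := ((hτ.tendsto_meanTime_real x).add (hτ.tendsto_meanTime_real y)).add h2
  rw [add_zero] at h3
  refine le_of_tendsto_of_tendsto (hτ.tendsto_meanTime_real (x + y)) h3 ?_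
  filter_upwards [eventually_gt_atTop 0] with t ht
  rw [← add_div, ← add_div, smul_add]
  gcongr
  have h4 := hL (floorPt (t • x + t • y)) (floorPt (t • x) + floorPt (t • y))
  have h5 := hτ.meanTime_add_le (floorPt (t • x)) (floorPt (t • y))
  have h6 := mul_le_mul_of_nonneg_left (l1_floorPt_add_le (t • x) (t • y)) hC.le
  have h7 := le_abs_self (meanTime P τ (floorPt (t • x + t • y)) -
      meanTime P τ (floorPt (t • x) + floorPt (t • y)))
  linarith

/-- Subadditivity along the multiples of a lattice point. Thus the mean is never below the time
constant, and hypotheses on nonrandom fluctuations are needed in one direction only. -/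
lemma timeConstant_toEuclid_le (hτ : IsWeights P τ) (z : Fin d → ℤ) :
    timeConstant P τ (toEuclid z) ≤ meanTime P τ z := by
  have key : ∀ N : ℕ, meanTime P τ (N • z) ≤ N * meanTime P τ z := by
    intro N
    induction N with
    | zero =>
      obtain ⟨C, hC, h⟩ := hτ.exists_meanTime_le
      simpa [l1] using h 0
    | succ n ih =>
      rw [succ_nsmul]
      push_cast
      linarith [hτ.meanTime_add_le (n • z) z]
  refine le_of_tendsto (hτ.tendsto_meanTime_nat (toEuclid z)) ?_
  filter_upwards [eventually_gt_atTop 0] with N hN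
  have h1 : floorPt ((N : ℝ) • toEuclid z) = N • z := by
    rw [← floorPt_toEuclid (N • z)]
    congr 1
    ext i
    simp [toEuclid]
  rw [h1, div_le_iff₀ (by exact_mod_cast hN), mul_comm]
  exact key N

lemma timeConstant_le_of_meanTime_le (hτ : IsWeights P τ) {C : ℝ} (hC : 0 ≤ C)
    (h : ∀ z, meanTime P τ z ≤ C * l1 z)
    (x : EuclideanSpace ℝ (Fin d)) : timeConstant P τ x ≤ C * l1E x := by
  have h2 : Tendsto (fun t : ℝ => C * d / t) atTop (𝓝 0) :=
    tendsto_const_nhds.div_atTop tendsto_id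
  have h3 := h2.const_add (C * l1E x)
  rw [add_zero] at h3
  refine le_of_tendsto_of_tendsto (hτ.tendsto_meanTime_real x) h3 ?_
  filter_upwards [eventually_gt_atTop 0] with t ht
  rw [div_le_iff₀ ht, add_mul, div_mul_cancel₀ _ ht.ne']
  refine (h _).trans ?_
  have := l1_floorPt_sub_le (t • x) 0
  rw [floorPt_zero, sub_zero, sub_zero, l1E_smul, abs_of_pos ht] at this
  nlinarith

lemma exists_timeConstant_le (hτ : IsWeights P τ) : ∃ C : ℝ, 0 < C ∧
    ∀ x, timeConstant P τ x ≤ C * ‖x‖ := by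
  obtain ⟨C, hC, h⟩ := hτ.exists_meanTime_le
  refine ⟨C * (d + 1), by positivity, fun x =>
    (hτ.timeConstant_le_of_meanTime_le hC.le h x).trans ?_⟩
  rw [mul_assoc]
  gcongr
  linarith [l1E_le x, norm_nonneg x]

/-- Reflections preserve the mean passage time; the reflection of the floor and the floor of the
reflection differ by at most one in each coordinate. -/
lemma timeConstant_reflect (hτ : IsWeights P τ) (i : Fin d) (x : EuclideanSpace ℝ (Fin d)) :
    timeConstant P τ (x - (2 * x i) • EuclideanSpace.single i 1) = timeConstant P τ x := by
  obtain ⟨C, hC, hL⟩ := hτ.exists_meanTime_lipschitz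
  refine hτ.timeConstant_congr (B := C * d) fun t => ?_
  have h0 : reflectIso i 0 = (0 : Fin d → ℤ) := by funext j; simp [reflectIso]
  rw [← hτ.meanTime_map (reflectIso i) h0 (floorPt (t • x))]
  refine (hL _ _).trans ?_
  gcongr
  have key : ∀ j, |((floorPt (t • (x - (2 * x i) • EuclideanSpace.single i 1)) j : ℝ) -
      (reflectIso i (floorPt (t • x)) : Fin d → ℤ) j)| ≤ 1 := by
    intro j
    by_cases hj : j = i
    · subst hj
      simp only [reflectIso, floorPt, RelIso.coe_fn_mk, Equiv.coe_fn_mk, if_true,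
        PiLp.smul_apply, PiLp.sub_apply, PiLp.single_apply, smul_eq_mul, Int.cast_neg, mul_one]
      have e : t * (x j - 2 * x j) = -(t * x j) := by ring
      rw [e]
      have h1 := Int.floor_le (t * x j)
      have h2 := Int.lt_floor_add_one (t * x j)
      have h3 := Int.floor_le (-(t * x j))
      have h4 := Int.lt_floor_add_one (-(t * x j))
      have h5 : ((-1 : ℤ) : ℝ) ≤ (⌊-(t * x j)⌋ + ⌊t * x j⌋ : ℤ) := by
        have h6 : (-2 : ℝ) < (⌊-(t * x j)⌋ + ⌊t * x j⌋ : ℤ) := by push_cast; linarith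
        have h7 : (-2 : ℤ) < ⌊-(t * x j)⌋ + ⌊t * x j⌋ := by exact_mod_cast h6
        exact_mod_cast (by omega : (-1 : ℤ) ≤ ⌊-(t * x j)⌋ + ⌊t * x j⌋)
      push_cast at h5
      rw [abs_le]; constructor <;> linarith
    · simp [reflectIso, floorPt, hj]
  have := Finset.sum_le_sum fun j (_ : j ∈ Finset.univ) => key j
  simpa [l1] using this

lemma timeConstant_single_eq (hτ : IsWeights P τ) (i j : Fin d) :
    timeConstant P τ (EuclideanSpace.single i 1) = timeConstant P τ (EuclideanSpace.single j 1) := by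
  refine hτ.timeConstant_congr (B := 0) fun t => ?_
  have h0 : permIso (Equiv.swap i j) 0 = (0 : Fin d → ℤ) := by funext j; simp [permIso]
  rw [← hτ.meanTime_map (permIso (Equiv.swap i j)) h0 (floorPt (t • EuclideanSpace.single i 1))]
  have : permIso (Equiv.swap i j) (floorPt (t • EuclideanSpace.single i 1)) =
      floorPt (t • EuclideanSpace.single j 1) := by
    funext k
    simp only [permIso, floorPt, RelIso.coe_fn_mk, Equiv.arrowCongr_apply, Equiv.coe_refl,
      Function.comp, id, PiLp.smul_apply, PiLp.single_apply]
    have : ((Equiv.swap i j).symm k = i) = (k = j) := by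
      rw [Equiv.symm_swap, Equiv.swap_apply_eq_iff, Equiv.swap_apply_left]
    simp only [this]
  rw [this]
  simp

/-- If the time constant vanishes in one direction, it vanishes identically. -/
lemma timeConstant_eq_zero (hτ : IsWeights P τ) {u : EuclideanSpace ℝ (Fin d)} (hu : u ≠ 0)
    (h : timeConstant P τ u = 0) (x : EuclideanSpace ℝ (Fin d)) : timeConstant P τ x = 0 := by
  obtain ⟨i, hi⟩ : ∃ i, u i ≠ 0 := by
    by_contra! hcon
    exact hu (by ext i; simpa using hcon i)
  -- The vector `u` minus its reflection in the `i`-th coordinate hyperplane is a nonzero multiple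
  -- of the `i`-th basis vector. All basis vectors have the same time constant, so subadditivity
  -- gives the rest.
  have h1 : timeConstant P τ ((2 * u i) • EuclideanSpace.single i 1) ≤ 0 := by
    have h2 := hτ.timeConstant_add_le u (-(u - (2 * u i) • EuclideanSpace.single i 1))
    rw [hτ.timeConstant_neg, hτ.timeConstant_reflect, h] at h2
    have h3 : u + -(u - (2 * u i) • EuclideanSpace.single i 1) =
      (2 * u i) • EuclideanSpace.single i 1 := by abel
    rw [h3] at h2
    linarith
  rw [hτ.timeConstant_smul] at h1
  have h4 : timeConstant P τ (EuclideanSpace.single i 1) ≤ 0 :=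
    nonpos_of_mul_nonpos_right h1 (abs_pos.2 (by simpa using hi))
  refine le_antisymm ?_ (hτ.timeConstant_nonneg x)
  have key : ∀ s : Finset (Fin d),
      timeConstant P τ (∑ j ∈ s, (x j) • EuclideanSpace.single j (1 : ℝ)) ≤ 0 := by
    intro s
    induction s using Finset.cons_induction with
    | empty => simp [hτ.timeConstant_zero]
    | cons j s hj ih =>
      rw [Finset.sum_cons]
      refine (hτ.timeConstant_add_le _ _).trans ?_
      rw [hτ.timeConstant_smul, hτ.timeConstant_single_eq j i]
      have := mul_nonpos_of_nonneg_of_nonpos (abs_nonneg (x j)) h4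
      linarith
  have h5 := key Finset.univ
  have h6 : ∑ j, (x j) • EuclideanSpace.single j (1 : ℝ) = x := by
    ext k
    simp [Pi.single_apply]
  rwa [h6] at h5

end IsWeights

end TimeConstant

/-! ### Positive association of product measures. -/

section Harris

/-- A probability measure is positively associated if bounded measurable monotone functions are
nonnegatively correlated. -/
def PositivelyAssociated {X : Type*} [MeasurableSpace X] [Preorder X] (μ : Measure X) : Prop :=
  ∀ f g : X → ℝ, Measurable f → Measurable g → Monotone f → Monotone g →
    (∀ x, |f x| ≤ 1) → (∀ x, |g x| ≤ 1) →
    (∫ x, f x ∂μ) * (∫ x, g x ∂μ) ≤ ∫ x, f x * g x ∂μ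

lemma integrable_of_abs_le_one {X : Type*} [MeasurableSpace X] {μ : Measure X} [IsFiniteMeasure μ]
    {f : X → ℝ} (hf : Measurable f) (h : ∀ x, |f x| ≤ 1) : Integrable f μ :=
  Integrable.of_bound hf.aestronglyMeasurable 1 (.of_forall h)

lemma abs_mul_le_one {a b : ℝ} (ha : |a| ≤ 1) (hb : |b| ≤ 1) : |a * b| ≤ 1 := by
  rw [abs_mul]
  exact mul_le_one₀ ha (abs_nonneg _) hb

/-- Chebyshev's association inequality. -/
lemma positivelyAssociated_of_linearOrder {X : Type*} [MeasurableSpace X] [LinearOrder X]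
    (μ : Measure X) [IsProbabilityMeasure μ] : PositivelyAssociated μ := by
  intro f g hf hg hfm hgm hf1 hg1
  have hfi := integrable_of_abs_le_one (μ := μ) hf hf1
  have hgi := integrable_of_abs_le_one (μ := μ) hg hg1
  have hfgi : Integrable (fun x => f x * g x) μ :=
    integrable_of_abs_le_one (hf.mul hg) fun x => abs_mul_le_one (hf1 x) (hg1 x)
  -- The product (f x - f y)(g x - g y) is nonnegative for monotone functions on a linear order; it
  -- is averaged first over an independent copy `y` and then over `x`.
  have key : ∀ x, 0 ≤ f x * g x - f x * (∫ y, g y ∂μ) - g x * (∫ y, f y ∂μ) +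
      ∫ y, f y * g y ∂μ := by
    intro x
    have h1 : 0 ≤ ∫ y, (f x - f y) * (g x - g y) ∂μ := by
      refine integral_nonneg fun y => ?_
      rcases le_total x y with h | h
      · exact mul_nonneg_of_nonpos_of_nonpos (sub_nonpos.2 (hfm h)) (sub_nonpos.2 (hgm h))
      · exact mul_nonneg (sub_nonneg.2 (hfm h)) (sub_nonneg.2 (hgm h))
    have h2 : ∫ y, (f x - f y) * (g x - g y) ∂μ =
        f x * g x - f x * (∫ y, g y ∂μ) - g x * (∫ y, f y ∂μ) + ∫ y, f y * g y ∂μ := by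
      have e : ∀ y, (f x - f y) * (g x - g y) =
          f x * g x - f x * g y - g x * f y + f y * g y := fun y => by ring
      simp_rw [e]
      rw [integral_add (by fun_prop) hfgi, integral_sub (by fun_prop) (by fun_prop),
        integral_sub (by fun_prop) (by fun_prop), integral_const_mul, integral_const_mul]
      simp [integral_const_mul]
    rwa [h2] at h1
  have h3 := integral_nonneg_of_ae (μ := μ) (Eventually.of_forall key)
  rw [integral_add (by fun_prop) (by fun_prop), integral_sub (by fun_prop) (by fun_prop),
    integral_sub hfgi (by fun_prop), integral_mul_const, integral_mul_const] at h3
  simp only [integral_const, probReal_univ, one_smul] at h3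
  linarith [mul_comm (∫ x, f x ∂μ) (∫ x, g x ∂μ)]

/-- Integrating out the second coordinate keeps functions monotone, so association of `μ` applies to
the partial integrals and association of `ν` to each slice. -/
lemma PositivelyAssociated.prod {X Y : Type*} [MeasurableSpace X] [Preorder X]
    [MeasurableSpace Y] [Preorder Y] {μ : Measure X} {ν : Measure Y} [IsProbabilityMeasure μ]
    [IsProbabilityMeasure ν] (hμ : PositivelyAssociated μ) (hν : PositivelyAssociated ν) :
    PositivelyAssociated (μ.prod ν) := by
  intro f g hf hg hfm hgm hf1 hg1
  have hfg1 : ∀ x, |f x * g x| ≤ 1 := fun x => abs_mul_le_one (hf1 x) (hg1 x)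
  have hfg : Measurable fun x => f x * g x := hf.mul hg
  have hint : ∀ {f : X × Y → ℝ}, Measurable f → (∀ x, |f x| ≤ 1) →
      Measurable (fun x => ∫ y, f (x, y) ∂ν) ∧ ∀ x, |∫ y, f (x, y) ∂ν| ≤ 1 := by
    intro f hf hf1
    refine ⟨hf.stronglyMeasurable.integral_prod_right'.measurable, fun x => ?_⟩
    have := norm_integral_le_of_norm_le_const (μ := ν) (f := fun y => f (x, y)) (C := 1)
      (.of_forall fun y => hf1 (x, y))
    simpa using this
  have hmono : ∀ {f : X × Y → ℝ}, Measurable f → (∀ x, |f x| ≤ 1) → Monotone f →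
      Monotone fun x => ∫ y, f (x, y) ∂ν := by
    intro f hf hf1 hfm x x' hx
    refine integral_mono (integrable_of_abs_le_one (by fun_prop) fun y => hf1 _)
      (integrable_of_abs_le_one (by fun_prop) fun y => hf1 _) fun y => hfm ⟨hx, le_rfl⟩
  rw [integral_prod _ (integrable_of_abs_le_one hf hf1),
    integral_prod _ (integrable_of_abs_le_one hg hg1),
    integral_prod _ (integrable_of_abs_le_one hfg hfg1)]
  refine (hμ _ _ (hint hf hf1).1 (hint hg hg1).1 (hmono hf hf1 hfm) (hmono hg hg1 hgm)
    (hint hf hf1).2 (hint hg hg1).2).trans ?_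
  refine integral_mono (integrable_of_abs_le_one ((hint hf hf1).1.mul (hint hg hg1).1) fun x =>
    abs_mul_le_one ((hint hf hf1).2 x) ((hint hg hg1).2 x))
    (integrable_of_abs_le_one (hint hfg hfg1).1 (hint hfg hfg1).2) fun x => ?_
  exact hν _ _ (by fun_prop) (by fun_prop) (fun y y' h => hfm ⟨le_rfl, h⟩)
    (fun y y' h => hgm ⟨le_rfl, h⟩) (fun y => hf1 _) (fun y => hg1 _)

lemma PositivelyAssociated.map {X Y : Type*} [MeasurableSpace X] [Preorder X]
    [MeasurableSpace Y] [Preorder Y] {μ : Measure X} {φ : X → Y} (hφ : Measurable φ)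
    (hφm : Monotone φ) (hμ : PositivelyAssociated μ) : PositivelyAssociated (μ.map φ) := by
  intro f g hf hg hfm hgm hf1 hg1
  have hfg : Measurable fun x => f x * g x := hf.mul hg
  rw [integral_map hφ.aemeasurable hf.aestronglyMeasurable,
    integral_map hφ.aemeasurable hg.aestronglyMeasurable,
    integral_map hφ.aemeasurable hfg.aestronglyMeasurable]
  exact hμ _ _ (hf.comp hφ) (hg.comp hφ) (hfm.comp hφm) (hgm.comp hφm) (fun x => hf1 _)
    (fun x => hg1 _)

/-- Induction on the number of coordinates, splitting off the first one; the reassembling map is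
monotone. -/
lemma positivelyAssociated_pi_fin {n : ℕ} (ν : Fin n → Measure ℝ)
    [∀ i, IsProbabilityMeasure (ν i)] : PositivelyAssociated (Measure.pi ν) := by
  induction n with
  | zero =>
    intro f g hf hg hfm hgm hf1 hg1
    have hc : ∀ f : (Fin 0 → ℝ) → ℝ, f = fun _ => f 0 := fun f => by
      funext x; rw [Subsingleton.elim x 0]
    rw [hc f, hc g]
    simp
  | succ n ih =>
    have h1 := (measurePreserving_piFinSuccAbove ν 0).symm
    rw [← h1.map_eq]
    refine PositivelyAssociated.map h1.measurable ?_
      ((positivelyAssociated_of_linearOrder (ν 0)).prod (ih fun j => ν ((0 : Fin (n + 1)).succAbove j)))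
    intro a b hab i
    refine Fin.cases ?_ (fun j => ?_) i
    · simpa [MeasurableEquiv.piFinSuccAbove, Fin.insertNthEquiv] using hab.1
    · simpa [MeasurableEquiv.piFinSuccAbove, Fin.insertNthEquiv] using hab.2 j

lemma positivelyAssociated_pi {ι : Type*} [Fintype ι] (ν : ι → Measure ℝ)
    [∀ i, IsProbabilityMeasure (ν i)] : PositivelyAssociated (Measure.pi ν) := by
  have h1 := measurePreserving_piCongrLeft (α := fun _ => ℝ) ν (Fintype.equivFin ι).symm
  rw [← h1.map_eq]
  refine PositivelyAssociated.map h1.measurable ?_ (positivelyAssociated_pi_fin _)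
  intro a b hab i
  obtain ⟨j, rfl⟩ := (Fintype.equivFin ι).symm.surjective i
  rw [MeasurableEquiv.coe_piCongrLeft]
  erw [Equiv.piCongrLeft_apply_apply, Equiv.piCongrLeft_apply_apply]
  exact hab j

end Harris

/-! ### Increasing events and the Harris inequality for the weights. -/

section IncreasingEvents

variable {d : ℕ} {Ω : Type*} [MeasurableSpace Ω] {P : Measure Ω} {τ : Edge d → Ω → ℝ}

/-- A measurable increasing event depending on finitely many edge weights. -/
structure IsCylinderUpper (S : Set (Edge d → ℝ)) : Prop where
  measurable : MeasurableSet S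
  upper : IsUpperSet S
  finite : ∃ I : Finset (Edge d), ∀ w w' : Edge d → ℝ, (∀ e ∈ I, w e = w' e) → w ∈ S → w' ∈ S

lemma IsCylinderUpper.inter {S S' : Set (Edge d → ℝ)} (h : IsCylinderUpper S)
    (h' : IsCylinderUpper S') : IsCylinderUpper (S ∩ S') := by
  classical
  obtain ⟨I, hI⟩ := h.finite
  obtain ⟨I', hI'⟩ := h'.finite
  refine ⟨h.measurable.inter h'.measurable, h.upper.inter h'.upper, I ∪ I', fun w w' hw hS => ?_⟩
  exact ⟨hI w w' (fun e he => hw e (Finset.mem_union_left _ he)) hS.1,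
    hI' w w' (fun e he => hw e (Finset.mem_union_right _ he)) hS.2⟩

lemma isCylinderUpper_univ : IsCylinderUpper (Set.univ : Set (Edge d → ℝ)) :=
  ⟨.univ, isUpperSet_univ, ∅, fun _ _ _ _ => trivial⟩

lemma IsCylinderUpper.iInter_lt {S : ℕ → Set (Edge d → ℝ)} (h : ∀ n, IsCylinderUpper (S n))
    (n : ℕ) : IsCylinderUpper (⋂ k < n, S k) := by
  induction n with
  | zero => simpa using isCylinderUpper_univ
  | succ n ih => rw [Set.biInter_lt_succ]; exact ih.inter (h n)

/-- An increasing event: a countable intersection of measurable increasing events each depending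
on finitely many edge weights. -/
def IsIncreasing (S : Set (Edge d → ℝ)) : Prop :=
  ∃ F : ℕ → Set (Edge d → ℝ), (∀ n, IsCylinderUpper (F n)) ∧ S = ⋂ n, F n

lemma IsIncreasing.measurableSet {S : Set (Edge d → ℝ)} (h : IsIncreasing S) :
    MeasurableSet S := by
  obtain ⟨F, hF, rfl⟩ := h
  exact MeasurableSet.iInter fun n => (hF n).measurable

lemma IsCylinderUpper.isIncreasing {S : Set (Edge d → ℝ)} (h : IsCylinderUpper S) :
    IsIncreasing S := ⟨fun _ => S, fun _ => h, (Set.iInter_const S).symm⟩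

lemma IsIncreasing.iInter {ι : Type*} [Countable ι] {S : ι → Set (Edge d → ℝ)}
    (h : ∀ i, IsIncreasing (S i)) : IsIncreasing (⋂ i, S i) := by
  rcases isEmpty_or_nonempty ι with hι | hι
  · simpa using isCylinderUpper_univ.isIncreasing
  choose F hF hS using h
  obtain ⟨f, hf⟩ := exists_surjective_nat (ι × ℕ)
  refine ⟨fun n => F (f n).1 (f n).2, fun n => hF _ _, ?_⟩
  ext w
  simp only [hS, Set.mem_iInter]
  refine ⟨fun h n => h _ _, fun h i n => ?_⟩
  obtain ⟨k, hk⟩ := hf (i, n)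
  have := h k
  rwa [hk] at this

lemma IsIncreasing.inter {S S' : Set (Edge d → ℝ)} (h : IsIncreasing S) (h' : IsIncreasing S') :
    IsIncreasing (S ∩ S') := by
  rw [Set.inter_eq_iInter]
  exact IsIncreasing.iInter fun b => by cases b <;> assumption

lemma isIncreasing_le_weight (e : Edge d) (b : ℝ) : IsIncreasing {w : Edge d → ℝ | b ≤ w e} :=
  IsCylinderUpper.isIncreasing ⟨measurableSet_le measurable_const (measurable_pi_apply e),
    fun _ _ hw h => le_trans (Set.mem_ofPred.1 h) (hw e), {e}, fun w w' hw h => by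
      have := hw e (by simp)
      simp only [Set.mem_ofPred_eq] at h ⊢
      rwa [← this]⟩

lemma isIncreasing_le_pathTime {x y : Fin d → ℤ} (γ : (lattice d).Walk x y) (t : ℝ) :
    IsIncreasing {w : Edge d → ℝ | t ≤ pathTime w γ} := by
  classical
  refine IsCylinderUpper.isIncreasing ⟨measurableSet_le measurable_const (measurable_pathTime γ),
    fun w w' hw h => le_trans (Set.mem_ofPred.1 h) ?_,
    (γ.edges.attach.map fun e => (⟨e.1, γ.edges_subset_edgeSet e.2⟩ : Edge d)).toFinset,
    fun w w' hw h => ?_⟩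
  · exact List.sum_le_sum fun e _ => hw _
  · have : pathTime w γ = pathTime w' γ := by
      unfold pathTime
      congr 1
      refine List.map_congr_left fun e he => hw _ ?_
      rw [List.mem_toFinset]
      exact List.mem_map.2 ⟨e, he, rfl⟩
    simpa only [Set.mem_ofPred_eq, this] using h

/-- The event that every path from `x` to `y` takes at least time `t`. -/
def slowSet (x y : Fin d → ℤ) (t : ℝ) : Set (Edge d → ℝ) :=
  {w | ∀ γ : (lattice d).Walk x y, t ≤ pathTime w γ}

lemma isIncreasing_slowSet (x y : Fin d → ℤ) (t : ℝ) : IsIncreasing (slowSet x y t) := by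
  have : slowSet x y t = ⋂ γ : (lattice d).Walk x y, {w | t ≤ pathTime w γ} := by
    ext w; simp [slowSet]
  rw [this]
  exact IsIncreasing.iInter fun γ => isIncreasing_le_pathTime γ t

/-- Slow events quantify over paths because `latticeTime` need not be monotone on all real weights:
path times unbounded below make the real infimum default to 0. On nonnegative weights both
descriptions agree. -/
lemma mem_slowSet_iff {w : Edge d → ℝ} (hw : ∀ e, 0 ≤ w e) {x y : Fin d → ℤ} {t : ℝ} :
    w ∈ slowSet x y t ↔ t ≤ latticeTime w x y := (le_latticeTime_iff hw).symm

variable [IsProbabilityMeasure P]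

/-- Both events depend on the finite edge set `J`, whose weights have a product law, and indicators
of increasing events are bounded monotone functions. -/
lemma IsWeights.harris_cylinder (hτ : IsWeights P τ) {S S' : Set (Edge d → ℝ)}
    (h : IsCylinderUpper S) (h' : IsCylinderUpper S') :
    P.real {ω | (fun e => τ e ω) ∈ S} * P.real {ω | (fun e => τ e ω) ∈ S'} ≤
      P.real {ω | (fun e => τ e ω) ∈ S ∩ S'} := by
  classical
  obtain ⟨I, hI⟩ := h.finite
  obtain ⟨I', hI'⟩ := h'.finite
  set J := I ∪ I' with hJ
  -- Any value off `J` would do; a constant one keeps the extension monotone and measurable.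
  let ext : (J → ℝ) → (Edge d → ℝ) := fun v e => if he : e ∈ J then v ⟨e, he⟩ else 0
  have hext : Measurable ext := by
    refine measurable_pi_iff.2 fun e => ?_
    by_cases he : e ∈ J
    · simp only [ext, he, dite_true]; exact measurable_pi_apply _
    · simp only [ext, he, dite_false]; exact measurable_const
  have hextm : Monotone ext := by
    intro v v' hv e
    by_cases he : e ∈ J
    · simp only [ext, he, dite_true]; exact hv _
    · simp only [ext, he, dite_false]; exact le_rfl
  have hmeas : Measurable fun ω (e : J) => τ e ω := measurable_pi_iff.2 fun e => hτ.measurable _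
  have hind : iIndepFun (fun e : J => τ e) P := hτ.indep.precomp Subtype.val_injective
  have hlaw := (iIndepFun_iff_map_fun_eq_pi_map fun e : J => (hτ.measurable e).aemeasurable).1 hind
  have : ∀ e : J, IsProbabilityMeasure (P.map (τ e)) := fun e =>
    Measure.isProbabilityMeasure_map (hτ.measurable e).aemeasurable
  have hPA : PositivelyAssociated (P.map fun ω (e : J) => τ e ω) := by
    rw [hlaw]; exact positivelyAssociated_pi _
  have hset : ∀ {S : Set (Edge d → ℝ)} {I : Finset (Edge d)}, I ⊆ J →
      (∀ w w' : Edge d → ℝ, (∀ e ∈ I, w e = w' e) → w ∈ S → w' ∈ S) →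
      {ω | (fun e => τ e ω) ∈ S} = (fun ω (e : J) => τ e ω) ⁻¹' (ext ⁻¹' S) := by
    intro S I hIJ hI
    ext ω
    have : ∀ e ∈ I, τ e ω = ext (fun e : J => τ e ω) e := fun e he => by
      simp [ext, hIJ he]
    exact ⟨fun hS => hI _ _ this hS, fun hS => hI _ _ (fun e he => (this e he).symm) hS⟩
  have hprob : ∀ {S : Set (Edge d → ℝ)} {I : Finset (Edge d)}, I ⊆ J → MeasurableSet S →
      (∀ w w' : Edge d → ℝ, (∀ e ∈ I, w e = w' e) → w ∈ S → w' ∈ S) →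
      P.real {ω | (fun e => τ e ω) ∈ S} =
        ∫ v, (ext ⁻¹' S).indicator 1 v ∂(P.map fun ω (e : J) => τ e ω) := by
    intro S I hIJ hS hI
    rw [integral_indicator_one (hext hS), map_measureReal_apply hmeas (hext hS), hset hIJ hI]
  have hSS' := (h.inter h')
  have hJJ : ∀ w w' : Edge d → ℝ, (∀ e ∈ J, w e = w' e) → w ∈ S ∩ S' → w' ∈ S ∩ S' :=
    fun w w' hw hS => ⟨hI w w' (fun e he => hw e (Finset.mem_union_left _ he)) hS.1,
      hI' w w' (fun e he => hw e (Finset.mem_union_right _ he)) hS.2⟩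
  rw [hprob Finset.subset_union_left h.measurable hI,
    hprob Finset.subset_union_right h'.measurable hI',
    hprob (Finset.Subset.refl J) hSS'.measurable hJJ]
  have hind1 : ∀ {S : Set (Edge d → ℝ)}, IsCylinderUpper S →
      Measurable ((ext ⁻¹' S).indicator (1 : (J → ℝ) → ℝ)) ∧
      Monotone ((ext ⁻¹' S).indicator (1 : (J → ℝ) → ℝ)) ∧
      ∀ v, |(ext ⁻¹' S).indicator (1 : (J → ℝ) → ℝ) v| ≤ 1 := by
    intro S hS
    refine ⟨measurable_one.indicator (hext hS.measurable), fun v v' hv => ?_, fun v => ?_⟩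
    · by_cases h : ext v ∈ S
      · have h2 : ext v' ∈ S := hS.upper (hextm hv) h
        simp [Set.indicator, h, h2]
      · simp only [Set.indicator, Set.mem_preimage, h, if_false]
        split_ifs <;> simp
    · by_cases h : ext v ∈ S <;> simp [Set.indicator, h]
  refine (hPA _ _ (hind1 h).1 (hind1 h').1 (hind1 h).2.1 (hind1 h').2.1 (hind1 h).2.2
    (hind1 h').2.2).trans (le_of_eq ?_)
  refine integral_congr_ae (.of_forall fun v => ?_)
  simp only [Set.preimage_inter, Set.inter_indicator_one, Pi.mul_apply]

/-- The Harris inequality for increasing events of i.i.d. edge weights. -/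
lemma IsWeights.harris (hτ : IsWeights P τ) {S S' : Set (Edge d → ℝ)}
    (h : IsIncreasing S) (h' : IsIncreasing S') :
    P.real {ω | (fun e => τ e ω) ∈ S} * P.real {ω | (fun e => τ e ω) ∈ S'} ≤
      P.real {ω | (fun e => τ e ω) ∈ S ∩ S'} := by
  obtain ⟨F, hF, rfl⟩ := h
  obtain ⟨F', hF', rfl⟩ := h'
  -- Finite partial intersections decrease to the full one, so the inequality passes to the limit
  -- from cylinder events.
  have htend : ∀ {F : ℕ → Set (Edge d → ℝ)}, (∀ n, IsCylinderUpper (F n)) →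
      Tendsto (fun n => P.real {ω | (fun e => τ e ω) ∈ ⋂ k < n, F k}) atTop
        (𝓝 (P.real {ω | (fun e => τ e ω) ∈ ⋂ n, F n})) := by
    intro F hF
    have e : {ω | (fun e => τ e ω) ∈ ⋂ n, F n} = ⋂ n, {ω | (fun e => τ e ω) ∈ ⋂ k < n, F k} := by
      ext ω
      simp only [Set.mem_ofPred_eq, Set.mem_iInter]
      exact ⟨fun h n k _ => h k, fun h n => h (n + 1) n (Nat.lt_succ_self n)⟩
    rw [e]
    refine (ENNReal.tendsto_toReal (measure_ne_top P _)).comp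
      (tendsto_measure_iInter_atTop (fun n =>
        (hτ.measurable_pi (IsCylinderUpper.iInter_lt hF n).measurable).nullMeasurableSet)
        (fun m n hmn ω hω => ?_) ⟨0, measure_ne_top P _⟩)
    simp only [Set.mem_ofPred_eq, Set.mem_iInter] at hω ⊢
    exact fun k hk => hω k (hk.trans_le hmn)
  have h3 := htend fun n => (hF n).inter (hF' n)
  rw [Set.iInter_inter_distrib] at h3
  refine le_of_tendsto_of_tendsto' ((htend hF).mul (htend hF')) h3 fun n => ?_
  refine (hτ.harris_cylinder (IsCylinderUpper.iInter_lt hF n)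
    (IsCylinderUpper.iInter_lt hF' n)).trans (measureReal_mono ?_)
  intro ω hω
  simp only [Set.mem_ofPred_eq, Set.mem_inter_iff, Set.mem_iInter] at hω ⊢
  exact fun k hk => ⟨hω.1 k hk, hω.2 k hk⟩

lemma IsWeights.harris_finset (hτ : IsWeights P τ) {ι : Type*} (s : Finset ι)
    {S : ι → Set (Edge d → ℝ)} (h : ∀ i, IsIncreasing (S i)) :
    ∏ i ∈ s, P.real {ω | (fun e => τ e ω) ∈ S i} ≤ P.real {ω | ∀ i ∈ s, (fun e => τ e ω) ∈ S i} ∧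
    IsIncreasing {w | ∀ i ∈ s, w ∈ S i} := by
  classical
  induction s using Finset.induction_on with
  | empty =>
    simp only [Finset.prod_empty, Finset.notMem_empty, IsEmpty.forall_iff, implies_true,
      Set.ofPred_true, probReal_univ, le_refl, true_and]
    exact isCylinderUpper_univ.isIncreasing
  | insert i s hi ih =>
    have e : {w | ∀ j ∈ insert i s, w ∈ S j} = S i ∩ {w | ∀ j ∈ s, w ∈ S j} := by
      ext w; simp
    refine ⟨?_, e ▸ (h i).inter ih.2⟩
    rw [Finset.prod_insert hi]
    have h1 := hτ.harris (h i) ih.2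
    rw [← e] at h1
    exact (mul_le_mul_of_nonneg_left ih.1 measureReal_nonneg).trans h1

lemma IsWeights.pow_le_harris (hτ : IsWeights P τ) {ι : Type*} (s : Finset ι)
    {S : ι → Set (Edge d → ℝ)} (h : ∀ i, IsIncreasing (S i)) {p : ℝ} (hp : 0 ≤ p)
    (hS : ∀ i ∈ s, p ≤ P.real {ω | (fun e => τ e ω) ∈ S i}) :
    p ^ s.card ≤ P.real {ω | ∀ i ∈ s, (fun e => τ e ω) ∈ S i} := by
  refine le_trans ?_ (hτ.harris_finset s h).1
  rw [← Finset.prod_const]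
  exact Finset.prod_le_prod (fun _ _ => hp) hS

end IncreasingEvents

/-! ### Comparison of powers and stretched exponentials. -/

section Asymptotics

lemma eventually_mul_rpow_le (C : ℝ) {a b : ℝ} (hab : a < b) :
    ∀ᶠ n : ℝ in atTop, C * n ^ a ≤ n ^ b := by
  filter_upwards [(tendsto_rpow_atTop (sub_pos.2 hab)).eventually_ge_atTop C,
    eventually_gt_atTop 0] with n hn hn0
  calc C * n ^ a ≤ n ^ (b - a) * n ^ a := by gcongr
    _ = n ^ b := by rw [← Real.rpow_add hn0, sub_add_cancel]

lemma eventually_mul_exp_neg_rpow_le (C a : ℝ) {c θ : ℝ} (hc : 0 < c) (hθ : 0 < θ) :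
    ∀ᶠ n : ℝ in atTop, C * n ^ a * Real.exp (-(c * n ^ θ)) ≤ 1 := by
  have h1 := ((tendsto_rpow_mul_exp_neg_mul_atTop_nhds_zero (a / θ) c hc).comp
    (tendsto_rpow_atTop hθ)).const_mul C
  rw [mul_zero] at h1
  filter_upwards [h1.eventually_le_const one_pos, eventually_gt_atTop 0] with n hn hn0
  simp only [Function.comp] at hn
  rw [← Real.rpow_mul hn0.le, mul_div_cancel₀ _ hθ.ne'] at hn
  rw [mul_assoc]
  simpa only [neg_mul] using hn

end Asymptotics

/-! ### Norms and counting of lattice points. -/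

section LatticePoints

variable {d : ℕ}

lemma toEuclid_sub (x y : Fin d → ℤ) : toEuclid (x - y) = toEuclid x - toEuclid y := by
  ext i; simp [toEuclid]

lemma toEuclid_zero : toEuclid (0 : Fin d → ℤ) = 0 := by
  ext i; simp [toEuclid]

lemma abs_le_norm_toEuclid (z : Fin d → ℤ) (i : Fin d) : |(z i : ℝ)| ≤ ‖toEuclid z‖ :=
  PiLp.norm_apply_le (toEuclid z) i

lemma l1_le_norm (z : Fin d → ℤ) : l1 z ≤ d * ‖toEuclid z‖ := l1E_le (toEuclid z)

lemma norm_toEuclid_floorPt_sub_le (x : EuclideanSpace ℝ (Fin d)) :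
    ‖toEuclid (floorPt x) - x‖ ≤ d := by
  refine (norm_le_l1E _).trans ?_
  have : ∑ i, |(toEuclid (floorPt x) - x) i| ≤ ∑ _i : Fin d, (1 : ℝ) := by
    refine Finset.sum_le_sum fun i _ => ?_
    simp only [PiLp.sub_apply, toEuclid, floorPt]
    rw [abs_le]
    constructor <;> linarith [Int.floor_le (x i), Int.lt_floor_add_one (x i)]
  simpa [l1E] using this

lemma norm_toEuclid_le_of_adj {x y : Fin d → ℤ} (h : (lattice d).Adj x y) :
    ‖toEuclid y - toEuclid x‖ ≤ 1 := by
  rw [← toEuclid_sub]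
  exact (norm_le_l1E _).trans (l1_sub_of_adj h).le

/-- The lattice points of the cube with centre `x` and half-side `R`. -/
def cube (x : Fin d → ℤ) (R : ℝ) : Finset (Fin d → ℤ) :=
  Finset.Icc (fun i => x i - ⌊R⌋) (fun i => x i + ⌊R⌋)

lemma mem_cube {x y : Fin d → ℤ} {R : ℝ} (h : ‖toEuclid y - toEuclid x‖ ≤ R) : y ∈ cube x R := by
  rw [← toEuclid_sub] at h
  have h1 : ∀ i, |y i - x i| ≤ ⌊R⌋ := fun i => by
    refine Int.le_floor.2 ?_
    have := (abs_le_norm_toEuclid (y - x) i).trans h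
    push_cast at this ⊢
    simpa using this
  rw [cube, Finset.mem_Icc, Pi.le_def, Pi.le_def]
  exact ⟨fun i => by have := abs_le.1 (h1 i); omega,
    fun i => by have := abs_le.1 (h1 i); omega⟩

lemma card_cube_le (x : Fin d → ℤ) {R : ℝ} (hR : 0 ≤ R) :
    ((cube x R).card : ℝ) ≤ (2 * R + 1) ^ d := by
  have h0 : 0 ≤ ⌊R⌋ := Int.floor_nonneg.2 hR
  have e : ((cube x R).card : ℝ) = (2 * (⌊R⌋ : ℝ) + 1) ^ d := by
    simp only [cube, Pi.card_Icc, Int.card_Icc]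
    rw [Finset.prod_congr rfl fun i _ => by
      rw [show x i + ⌊R⌋ + 1 - (x i - ⌊R⌋) = 2 * ⌊R⌋ + 1 by ring]]
    rw [Finset.prod_const, Finset.card_univ, Fintype.card_fin]
    push_cast
    congr 1
    have : (((2 * ⌊R⌋ + 1).toNat : ℤ) : ℝ) = ((2 * ⌊R⌋ + 1 : ℤ) : ℝ) := by
      rw [Int.toNat_of_nonneg (by omega)]
    push_cast at this
    exact this
  rw [e]
  gcongr
  exact Int.floor_le R

lemma exists_norm_bound_of_cofinite {Q : (Fin d → ℤ) → Prop} (h : ∀ᶠ z in cofinite, Q z) :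
    ∃ n₀ : ℝ, ∀ z, n₀ ≤ ‖toEuclid z‖ → Q z := by
  obtain ⟨B, hB⟩ := (Set.Finite.image (fun z => ‖toEuclid z‖) h).bddAbove
  refine ⟨B + 1, fun z hz => ?_⟩
  by_contra hcon
  have : ‖toEuclid z‖ ≤ B := hB (Set.mem_image_of_mem _ hcon)
  linarith

end LatticePoints

/-! ### One-point estimates: concentration around the time constant and the chance of a slow
passage. -/

section Concentration

variable {d : ℕ} {Ω : Type*} [MeasurableSpace Ω] {P : Measure Ω} {τ : Edge d → Ω → ℝ} {χ : ℝ}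

lemma FullConcentration.concentration' (hχ : FullConcentration P τ χ) {ε : ℝ} (hε : 0 < ε) :
    ∃ θ : ℝ, 0 < θ ∧ ∀ z : Fin d → ℤ, z ≠ 0 →
      P.real {ω | ‖toEuclid z‖ ^ (χ + ε) <
        |latticeTime (fun e => τ e ω) 0 z - meanTime P τ z|} ≤ Real.exp (-(‖toEuclid z‖ ^ θ)) := by
  obtain ⟨θ, hθ, h⟩ := hχ.concentration ε hε
  refine ⟨θ, hθ, fun z hz => ?_⟩
  have := h z hz
  simpa only [T_toEuclid, meanTime] using this

lemma FullConcentration.exists_meanTime_le (hχ : FullConcentration P τ χ)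
    {ε : ℝ} (hε : 0 < ε) : ∃ n₀ : ℝ, ∀ z : Fin d → ℤ, n₀ ≤ ‖toEuclid z‖ →
      meanTime P τ z ≤ timeConstant P τ (toEuclid z) + ‖toEuclid z‖ ^ (χ + ε) := by
  have h1 : limsup (fun x : Fin d → ℤ =>
      ((Real.log ((∫ ω, T τ 0 (toEuclid x) ω ∂P) - timeConstant P τ (toEuclid x)) /
        Real.log ‖toEuclid x‖ : ℝ) : EReal)) cofinite < ((χ + ε : ℝ) : EReal) :=
    hχ.nonrandom_exponent.trans_lt (by exact_mod_cast lt_add_of_pos_right χ hε)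
  obtain ⟨n₀, hn⟩ := exists_norm_bound_of_cofinite (eventually_lt_of_limsup_lt h1)
  refine ⟨max n₀ 2, fun z hz => ?_⟩
  have h2 := hn z ((le_max_left _ _).trans hz)
  have h3 : 2 ≤ ‖toEuclid z‖ := (le_max_right _ _).trans hz
  have h4 := EReal.coe_lt_coe_iff.1 h2
  rw [T_toEuclid, div_lt_iff₀ (Real.log_pos (by linarith))] at h4
  -- The logarithm says nothing useful about a nonpositive difference, but the bound is then
  -- trivial.
  rcases le_or_gt (meanTime P τ z - timeConstant P τ (toEuclid z)) 0 with h5 | h5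
  · have : 0 ≤ ‖toEuclid z‖ ^ (χ + ε) := by positivity
    linarith
  · have h6 : Real.log (meanTime P τ z - timeConstant P τ (toEuclid z)) <
        Real.log (‖toEuclid z‖ ^ (χ + ε)) := by
      rw [Real.log_rpow (by linarith)]; exact h4
    have := (Real.log_lt_log_iff h5 (by positivity)).1 h6
    linarith

variable [IsProbabilityMeasure P]

lemma IsWeights.prob_eq_translate (hτ : IsWeights P τ) (x y : Fin d → ℤ) {S : Set ℝ}
    (hS : MeasurableSet S) : P.real {ω | latticeTime (fun e => τ e ω) x y ∈ S} =
      P.real {ω | latticeTime (fun e => τ e ω) 0 (y - x) ∈ S} := by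
  have := (hτ.identDistrib_translate x y).measure_mem_eq hS
  rw [measureReal_def, measureReal_def]
  congr 1
  exact this.symm

/-- With high probability, no passage time is much smaller than the time constant predicts. -/
lemma FullConcentration.lower (hτ : IsWeights P τ) (hχ : FullConcentration P τ χ) {ε : ℝ}
    (hε : 0 < ε) : ∃ θ : ℝ, 0 < θ ∧ ∀ x y : Fin d → ℤ, x ≠ y →
      P.real {ω | (fun e => τ e ω) ∉ slowSet x y (timeConstant P τ (toEuclid y - toEuclid x) -
        ‖toEuclid y - toEuclid x‖ ^ (χ + ε))} ≤ Real.exp (-(‖toEuclid y - toEuclid x‖ ^ θ)) := by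
  obtain ⟨θ, hθ, h⟩ := hχ.concentration' hε
  refine ⟨θ, hθ, fun x y hxy => ?_⟩
  have h1 := h (y - x) (sub_ne_zero.2 hxy.symm)
  rw [← toEuclid_sub]
  refine le_trans ?_ h1
  set t := timeConstant P τ (toEuclid (y - x)) - ‖toEuclid (y - x)‖ ^ (χ + ε)
  have h2 : P.real {ω | (fun e => τ e ω) ∉ slowSet x y t} =
      P.real {ω | latticeTime (fun e => τ e ω) x y ∈ Set.Iio t} := by
    refine measureReal_congr ?_
    filter_upwards [hτ.ae_nonneg] with ω hω
    refine propext ?_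
    change ¬ ((fun e => τ e ω) ∈ slowSet x y t) ↔ latticeTime (fun e => τ e ω) x y < t
    rw [mem_slowSet_iff hω, not_le]
  rw [h2, hτ.prob_eq_translate x y measurableSet_Iio]
  refine measureReal_mono fun ω hω => ?_
  have h3 : latticeTime (fun e => τ e ω) 0 (y - x) < t := hω
  have h4 := hτ.timeConstant_toEuclid_le (y - x)
  change _ < |latticeTime (fun e => τ e ω) 0 (y - x) - meanTime P τ (y - x)|
  refine lt_abs.2 (Or.inr ?_)
  simp only [t] at h3
  linarith

/-- With high probability, no passage time is much larger than the time constant predicts. -/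
lemma FullConcentration.upper (hτ : IsWeights P τ) (hχ : FullConcentration P τ χ) {ε : ℝ}
    (hε : 0 < ε) : ∃ θ : ℝ, 0 < θ ∧ ∃ n₀ : ℝ, 0 < n₀ ∧ ∀ x y : Fin d → ℤ,
      n₀ ≤ ‖toEuclid y - toEuclid x‖ →
      P.real {ω | timeConstant P τ (toEuclid y - toEuclid x) +
        2 * ‖toEuclid y - toEuclid x‖ ^ (χ + ε) < latticeTime (fun e => τ e ω) x y} ≤
        Real.exp (-(‖toEuclid y - toEuclid x‖ ^ θ)) := by
  obtain ⟨θ, hθ, h⟩ := hχ.concentration' hε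
  obtain ⟨n₀, hn⟩ := hχ.exists_meanTime_le hε
  refine ⟨θ, hθ, max n₀ 1, by positivity, fun x y hxy => ?_⟩
  rw [← toEuclid_sub] at hxy ⊢
  have h0 : y - x ≠ 0 := by
    intro h0
    rw [h0, toEuclid_zero, norm_zero] at hxy
    linarith [le_max_right n₀ 1]
  have h2 := hn (y - x) ((le_max_left _ _).trans hxy)
  refine le_trans ?_ (h (y - x) h0)
  refine (hτ.prob_eq_translate x y measurableSet_Ioi).trans_le ?_
  refine measureReal_mono fun ω hω => ?_
  have h3 : timeConstant P τ (toEuclid (y - x)) + 2 * ‖toEuclid (y - x)‖ ^ (χ + ε) <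
    latticeTime (fun e => τ e ω) 0 (y - x) := hω
  change _ < |latticeTime (fun e => τ e ω) 0 (y - x) - meanTime P τ (y - x)|
  refine lt_abs.2 (Or.inl ?_)
  linarith

/-- A centred random variable bounded by `B`, with second moment `V` and with a tail bound at
level `b`, exceeds `s` with a probability that is not too small. -/
lemma second_moment_le {X : Ω → ℝ} (hX : Measurable X) {B b s δ : ℝ} (hB : 0 ≤ B) (hb : 0 ≤ b)
    (hs : 0 ≤ s) (hXB : ∀ᵐ ω ∂P, |X ω| ≤ B) (hmean : ∫ ω, X ω ∂P = 0)
    (htail : P.real {ω | b < |X ω|} ≤ δ) :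
    ∫ ω, (X ω) ^ 2 ∂P ≤ 2 * b * (s + B * P.real {ω | s ≤ X ω}) + B ^ 2 * δ := by
  have hXi : Integrable X P := Integrable.of_bound hX.aestronglyMeasurable B hXB
  have hm1 : MeasurableSet {ω | b < |X ω|} := measurableSet_lt measurable_const hX.abs
  have hm2 : MeasurableSet {ω | s ≤ X ω} := measurableSet_le measurable_const hX
  have hi1 : Integrable ({ω | b < |X ω|}.indicator (1 : Ω → ℝ)) P :=
    (integrable_const 1).indicator hm1
  have hi2 : Integrable ({ω | s ≤ X ω}.indicator (1 : Ω → ℝ)) P :=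
    (integrable_const 1).indicator hm2
  have h1 : ∫ ω, |X ω| ∂P ≤ 2 * (s + B * P.real {ω | s ≤ X ω}) := by
    -- Pointwise |X| = 2X⁺ - X, and the last term has mean zero; so the first absolute moment is
    -- controlled by the upper tail alone.
    have : ∫ ω, |X ω| ∂P ≤
        ∫ ω, (2 * (s + B * {ω | s ≤ X ω}.indicator (1 : Ω → ℝ) ω) - X ω) ∂P := by
      refine integral_mono_ae hXi.abs (by fun_prop) ?_
      filter_upwards [hXB] with ω hω
      have h2 := abs_le.1 hω
      by_cases h : s ≤ X ω
      · simp only [Set.indicator, Set.mem_ofPred_eq, h, if_true, Pi.one_apply]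
        rw [abs_of_nonneg (hs.trans h)]; linarith
      · simp only [Set.indicator, Set.mem_ofPred_eq, h, if_false]
        rcases le_total 0 (X ω) with h0 | h0
        · rw [abs_of_nonneg h0]; linarith
        · rw [abs_of_nonpos h0]; linarith
    rw [integral_sub (by fun_prop) hXi, integral_const_mul, integral_add (by fun_prop) (by fun_prop),
      integral_const_mul, integral_indicator_one hm2, hmean] at this
    simpa using this
  -- Below level `b` use X² ≤ b|X|, above it X² ≤ B².
  have h2 : ∫ ω, (X ω) ^ 2 ∂P ≤
      ∫ ω, (b * |X ω| + B ^ 2 * {ω | b < |X ω|}.indicator (1 : Ω → ℝ) ω) ∂P := by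
    refine integral_mono_ae ?_ (by fun_prop) ?_
    · refine Integrable.of_bound (hX.pow_const 2).aestronglyMeasurable (B ^ 2) ?_
      filter_upwards [hXB] with ω hω
      rw [Real.norm_of_nonneg (sq_nonneg _), ← sq_abs]
      gcongr
    · filter_upwards [hXB] with ω hω
      rw [← sq_abs]
      by_cases h : b < |X ω|
      · simp only [Set.indicator, Set.mem_ofPred_eq, h, if_true, Pi.one_apply]
        nlinarith [abs_nonneg (X ω)]
      · simp only [Set.indicator, Set.mem_ofPred_eq, h, if_false]
        nlinarith [abs_nonneg (X ω), not_lt.1 h]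
  rw [integral_add (by fun_prop) (by fun_prop), integral_const_mul, integral_const_mul,
    integral_indicator_one hm1] at h2
  have h3 : b * ∫ ω, |X ω| ∂P ≤ b * (2 * (s + B * P.real {ω | s ≤ X ω})) := by gcongr
  have h4 : B ^ 2 * P.real {ω | b < |X ω|} ≤ B ^ 2 * δ := by gcongr
  linarith

/-- A passage time exceeds the prediction of the time constant by almost its typical fluctuation
with at least polynomially small probability. -/
lemma FullConcentration.exceed (hτ : IsWeights P τ) (hχ : FullConcentration P τ χ) {κ : ℝ}
    (hκ : 0 < κ) (hκχ : κ < χ) : ∃ n₀ : ℝ, 0 < n₀ ∧ ∀ x y : Fin d → ℤ,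
      n₀ ≤ ‖toEuclid y - toEuclid x‖ →
      ‖toEuclid y - toEuclid x‖ ^ (-2 : ℝ) ≤
        P.real {ω | timeConstant P τ (toEuclid y - toEuclid x) +
          ‖toEuclid y - toEuclid x‖ ^ (χ - κ) ≤ latticeTime (fun e => τ e ω) x y} := by
  -- With this choice the product of the levels `χ + η` and `χ - κ` has exponent 2χ - 3η, below the
  -- exponent 2χ - 2η of the variance, so the variance must come from the event {X ≥ n^(χ-κ)}.
  set η : ℝ := κ / 4 with hη
  have hη0 : 0 < η := by positivity
  obtain ⟨θ, hθ, hconc⟩ := hχ.concentration' hη0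
  obtain ⟨C, hC, hbound⟩ := hτ.exists_time_bound
  obtain ⟨n₁, hn₁⟩ := exists_norm_bound_of_cofinite
    (hχ.variance_exponent.eventually_const_lt (sub_lt_self χ hη0))
  set B₀ : ℝ := C * d + 1 with hB₀
  have hB₀pos : 0 < B₀ := by positivity
  obtain ⟨n₂, hn₂⟩ := eventually_atTop.1 (((eventually_mul_rpow_le 8
    (show 2 * χ - 3 * η < 2 * χ - 2 * η by linarith)).and
    (eventually_mul_exp_neg_rpow_le (4 * B₀ ^ 2) 2 one_pos hθ)).and
    (eventually_ge_atTop (4 * B₀)))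
  refine ⟨max (max n₁ n₂) 2, by positivity, fun x y hxy => ?_⟩
  rw [← toEuclid_sub] at hxy ⊢
  set z := y - x with hz
  set n := ‖toEuclid z‖ with hn
  have hn2 : 2 ≤ n := (le_max_right _ _).trans hxy
  have hn0 : 0 < n := by linarith
  have hz0 : z ≠ 0 := by
    intro h0
    rw [hn, h0, toEuclid_zero, norm_zero] at hn2
    linarith
  obtain ⟨⟨ha1, ha2⟩, ha3⟩ := hn₂ n (((le_max_right _ _).trans (le_max_left _ _)).trans hxy)
  have hvar := hn₁ z (((le_max_left _ _).trans (le_max_left _ _)).trans hxy)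
  set X : Ω → ℝ := fun ω => latticeTime (fun e => τ e ω) 0 z - meanTime P τ z with hX
  have hXm : Measurable X := (hτ.measurable_time 0 z).sub_const _
  have hmean : ∫ ω, X ω ∂P = 0 := by
    rw [hX, integral_sub (hτ.integrable_time 0 z) (integrable_const _)]
    simp [meanTime]
  have hVar : variance (T τ 0 (toEuclid z)) P = ∫ ω, (X ω) ^ 2 ∂P := by
    rw [T_toEuclid, variance_eq_integral (hτ.measurable_time 0 z).aemeasurable]
    rfl
  have hmean_le : meanTime P τ z ≤ B₀ * n := by
    have h1 : meanTime P τ z ≤ C * l1 z := by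
      have := integral_mono_ae (hτ.integrable_time 0 z) (integrable_const (C * l1 z)) (by
        filter_upwards [hbound] with ω h using by simpa using h 0 z)
      simpa [meanTime] using this
    refine h1.trans ?_
    have h2 := mul_le_mul_of_nonneg_left (l1_le_norm z) hC.le
    rw [hB₀]; nlinarith
  have hXB : ∀ᵐ ω ∂P, |X ω| ≤ B₀ * n := by
    filter_upwards [hbound, hτ.ae_time_nonneg] with ω h1 h2
    have h3 := h1 0 z
    have h4 := h2 0 z
    rw [sub_zero] at h3
    have h5 := hτ.meanTime_nonneg z
    have h6 := mul_le_mul_of_nonneg_left (l1_le_norm z) hC.le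
    simp only [hX]
    rw [abs_le]
    constructor
    · linarith
    · rw [hB₀]; nlinarith
  have hlower : n ^ (2 * χ - 2 * η) ≤ ∫ ω, (X ω) ^ 2 ∂P := by
    rw [hVar, lt_div_iff₀ (by have := Real.log_pos (show 1 < n by linarith); positivity)] at hvar
    have hlogn : 0 < Real.log n := Real.log_pos (by linarith)
    have h1 : Real.log (n ^ (2 * χ - 2 * η)) < Real.log (∫ ω, (X ω) ^ 2 ∂P) := by
      rw [Real.log_rpow hn0]
      linarith
    have h2 : 0 ≤ ∫ ω, (X ω) ^ 2 ∂P := integral_nonneg fun ω => sq_nonneg _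
    -- A zero variance is excluded because `Real.log 0 = 0` would contradict the positive lower
    -- bound on the logarithm.
    have h3 : 0 < ∫ ω, (X ω) ^ 2 ∂P := by
      refine lt_of_le_of_ne h2 fun h3 => ?_
      rw [← h3, Real.log_zero, Real.log_rpow hn0] at h1
      have : 0 < 2 * χ - 2 * η := by linarith
      have := mul_pos this hlogn
      linarith
    exact ((Real.log_lt_log_iff (by positivity) h3).1 h1).le
  set q := P.real {ω | n ^ (χ - κ) ≤ X ω} with hq
  have hmain := second_moment_le hXm (B := B₀ * n) (b := n ^ (χ + η)) (s := n ^ (χ - κ))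
    (by positivity) (by positivity) (by positivity) hXB hmean (hconc z hz0)
  rw [← hq] at hmain
  have e1 : n ^ (χ + η) * n ^ (χ - κ) = n ^ (2 * χ - 3 * η) := by
    rw [← Real.rpow_add hn0]; congr 1; rw [hη]; ring
  have h1 : (B₀ * n) ^ 2 * Real.exp (-(n ^ θ)) ≤ 1 / 4 := by
    rw [one_mul, Real.rpow_two] at ha2
    linarith
  have h2 : 1 ≤ n ^ (2 * χ - 2 * η) := Real.one_le_rpow (by linarith) (by linarith)
  have h3 : n ^ (2 * χ - 2 * η) / 2 ≤ 2 * n ^ (χ + η) * (B₀ * n * q) := by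
    have e2 : 2 * n ^ (χ + η) * (n ^ (χ - κ) + B₀ * n * q) =
      2 * (n ^ (χ + η) * n ^ (χ - κ)) + 2 * n ^ (χ + η) * (B₀ * n * q) := by ring
    rw [e2, e1] at hmain
    linarith
  have e3 : n ^ (2 * χ - 2 * η) = n ^ (χ + η) * n ^ (χ - 3 * η) := by
    rw [← Real.rpow_add hn0]; congr 1; ring
  have h4 : 1 ≤ n ^ (χ - 3 * η) := Real.one_le_rpow (by linarith) (by linarith)
  have h5 : 0 < n ^ (χ + η) := by positivity
  have hq0 : 0 ≤ q := measureReal_nonneg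
  have h6 : 1 ≤ 4 * B₀ * n * q := by
    rw [e3] at h3
    have : n ^ (χ + η) * n ^ (χ - 3 * η) ≤ n ^ (χ + η) * (4 * B₀ * n * q) := by linarith
    exact h4.trans (le_of_mul_le_mul_left this h5)
  have h7 : 1 ≤ n ^ 2 * q := by
    refine h6.trans ?_
    rw [sq]
    gcongr
  have h8 : n ^ (-2 : ℝ) ≤ q := by
    rw [Real.rpow_neg hn0.le, Real.rpow_two, inv_le_iff_one_le_mul₀' (by positivity)]
    exact h7
  refine h8.trans ?_
  refine le_trans ?_ (hτ.prob_eq_translate x y measurableSet_Ici).symm.le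
  refine measureReal_mono fun ω hω => ?_
  have h9 : n ^ (χ - κ) ≤ latticeTime (fun e => τ e ω) 0 z - meanTime P τ z := hω
  have h10 := hτ.timeConstant_toEuclid_le z
  change _ ≤ latticeTime (fun e => τ e ω) 0 z
  linarith

end Concentration

/-! ### Curvature: global bounds on the time constant in adapted coordinates. -/

section Geometry

variable {d : ℕ} {Ω : Type*} [MeasurableSpace Ω]

/-- Linear coordinates `(s, v)` adapted to the direction `u` and to a tangent hyperplane, with
two-sided bounds on the time constant in terms of them. -/
structure CurvedFrame (P : Measure Ω) (τ : Edge d → Ω → ℝ) (u : EuclideanSpace ℝ (Fin d))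
    (m : ℕ) where
  /-- The coordinate along `u`. -/
  s : EuclideanSpace ℝ (Fin d) →ₗ[ℝ] ℝ
  /-- The transversal coordinates. -/
  v : EuclideanSpace ℝ (Fin d) →ₗ[ℝ] (Fin m → ℝ)
  /-- The point with given coordinates. -/
  pt : ℝ → (Fin m → ℝ) → EuclideanSpace ℝ (Fin d)
  /-- The constant in all bounds. -/
  K : ℝ
  one_le_K : 1 ≤ K
  s_u : s u = 1
  v_u : v u = 0
  s_pt : ∀ a b, s (pt a b) = a
  v_pt : ∀ a b, v (pt a b) = b
  abs_s_le : ∀ x, |s x| ≤ K * ‖x‖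
  norm_v_le : ∀ x, ‖v x‖ ≤ K * ‖x‖
  norm_le : ∀ x, ‖x‖ ≤ K * (|s x| + ‖v x‖)
  pos : 0 < timeConstant P τ u
  linear_le : ∀ x, s x * timeConstant P τ u ≤ timeConstant P τ x
  le_of_pos : ∀ x, 0 < s x →
    timeConstant P τ x ≤ s x * timeConstant P τ u + K * (‖v x‖ ^ 2 / s x)
  ge_of_pos : ∀ x, 0 < s x →
    s x * timeConstant P τ u + min (‖v x‖ ^ 2 / s x) ‖v x‖ / K ≤ timeConstant P τ x

variable {P : Measure Ω} [IsProbabilityMeasure P] {τ : Edge d → Ω → ℝ}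
  {u : EuclideanSpace ℝ (Fin d)} {W : Submodule ℝ (EuclideanSpace ℝ (Fin d))}

/-- If the time constant vanished at `u`, it would vanish identically, and no point of `W` at
distance `r` could satisfy the curvature bound. The dimension of `W` is positive because `d ≥ 2`. -/
lemma PositiveCurvature.timeConstant_pos (hτ : IsWeights P τ) (hd : 2 ≤ d) (hu : u ≠ 0)
    (hW : IsTangentHyperplane P τ u W) (hpos : PositiveCurvature P τ u W) :
    0 < timeConstant P τ u := by
  refine lt_of_le_of_ne (hτ.timeConstant_nonneg u) fun h0 => ?_
  have hz := hτ.timeConstant_eq_zero hu h0.symm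
  obtain ⟨C, hC, r, hr, h⟩ := hpos
  have hW1 : 0 < Module.finrank ℝ W := by have := hW.1; omega
  have := Module.finrank_pos_iff.1 hW1
  obtain ⟨⟨w, hw⟩, hw0⟩ := exists_ne (0 : W)
  have hw0' : w ≠ 0 := fun h => hw0 (Subtype.ext h)
  have hn : 0 < ‖w‖ := norm_pos_iff.2 hw0'
  have hn' : ‖(r / ‖w‖) • w‖ = r := by
    rw [norm_smul, Real.norm_of_nonneg (by positivity), div_mul_cancel₀ _ hn.ne']
  have := h ((r / ‖w‖) • w) (W.smul_mem _ hw) hn'.le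
  rw [hz, hz, hn', sub_zero] at this
  have : 0 < r ^ 2 / C := by positivity
  linarith

/-- Beyond radius `r` convexity takes over: the point of norm `r` on the segment from `u` to `u + w`
already has excess `r ^ 2 / C`, so the excess grows at least linearly from there. Hence the minimum
of a quadratic and a linear term. -/
lemma PositiveCurvature.global (hτ : IsWeights P τ) (hpos : PositiveCurvature P τ u W) :
    ∃ c : ℝ, 0 < c ∧ ∀ w ∈ W,
      timeConstant P τ u + c * min (‖w‖ ^ 2) ‖w‖ ≤ timeConstant P τ (u + w) := by
  obtain ⟨C, hC, r, hr, h⟩ := hpos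
  refine ⟨min 1 r / C, by positivity, fun w hw => ?_⟩
  rcases le_or_gt ‖w‖ r with hwr | hwr
  · have h1 := h w hw hwr
    have h2 : min 1 r / C * min (‖w‖ ^ 2) ‖w‖ ≤ 1 / C * ‖w‖ ^ 2 := by
      gcongr
      · exact min_le_left _ _
      · exact min_le_left _ _
    rw [one_div_mul_eq_div] at h2
    linarith
  · have hn : 0 < ‖w‖ := hr.trans hwr
    set t := r / ‖w‖ with ht
    have ht0 : 0 < t := by positivity
    have ht1 : t < 1 := (div_lt_one hn).2 hwr
    have hn' : ‖t • w‖ = r := by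
      rw [norm_smul, Real.norm_of_nonneg ht0.le, ht, div_mul_cancel₀ _ hn.ne']
    have h1 := h (t • w) (W.smul_mem _ hw) hn'.le
    rw [hn'] at h1
    have e : u + t • w = (1 - t) • u + t • (u + w) := by
      rw [sub_smul, one_smul, smul_add]; abel
    have h2 := hτ.timeConstant_add_le ((1 - t) • u) (t • (u + w))
    rw [← e, hτ.timeConstant_smul, hτ.timeConstant_smul, abs_of_pos ht0,
      abs_of_pos (sub_pos.2 ht1)] at h2
    have h3 : r ^ 2 / C ≤ t * (timeConstant P τ (u + w) - timeConstant P τ u) := by linarith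
    have h4 : r ^ 2 / C = t * (r / C * ‖w‖) := by rw [ht]; field_simp
    rw [h4] at h3
    have h5 := le_of_mul_le_mul_left h3 ht0
    have h6 : min 1 r / C * min (‖w‖ ^ 2) ‖w‖ ≤ r / C * ‖w‖ := by
      gcongr
      · exact min_le_right _ _
      · exact min_le_right _ _
    linarith

/-- A direct sum decomposition along `u` and `W`, where `u ∉ W` because the time constant at `u` is
positive. With `x = s u + w` and `s > 0`, homogeneity gives μ(x) = s μ(u + w/s), which turns the
quadratic bounds at `u` into |w|²/s at every scale. -/
lemma exists_curvedFrame (hτ : IsWeights P τ) (hd : 2 ≤ d) (hu : u ≠ 0)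
    (hW : IsTangentHyperplane P τ u W) (hfin : FiniteCurvature P τ u W)
    (hpos : PositiveCurvature P τ u W) {m : ℕ} (hm : m + 1 = d) :
    Nonempty (CurvedFrame P τ u m) := by
  have hμ := hpos.timeConstant_pos hτ hd hu hW
  have huW : u ∉ W := fun huW => by
    have := hW.2 (-u) (W.neg_mem huW)
    rw [add_neg_cancel, hτ.timeConstant_zero] at this
    linarith
  have hfr : Module.finrank ℝ W = m := by have := hW.1; omega
  let b := Module.finBasisOfFinrankEq ℝ W hfr
  let ψ : (ℝ × (Fin m → ℝ)) →ₗ[ℝ] EuclideanSpace ℝ (Fin d) :=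
    (LinearMap.toSpanSingleton ℝ _ u).coprod (W.subtype.comp b.equivFun.symm.toLinearMap)
  have hψ : ∀ p, ψ p = p.1 • u + (b.equivFun.symm p.2 : EuclideanSpace ℝ (Fin d)) := fun p => by
    simp [ψ, LinearMap.coprod_apply]
  have hinj : Function.Injective ψ := by
    rw [injective_iff_map_eq_zero]
    rintro ⟨a, y⟩ h
    rw [hψ] at h
    simp only at h
    have ha : a = 0 := by
      by_contra ha
      refine huW ?_
      have : a • u = -(b.equivFun.symm y : EuclideanSpace ℝ (Fin d)) := eq_neg_of_add_eq_zero_left h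
      have h2 : a • u ∈ W := this ▸ W.neg_mem (b.equivFun.symm y).2
      exact (W.smul_mem_iff ha).1 h2
    subst ha
    rw [zero_smul, zero_add] at h
    have h3 : b.equivFun.symm y = 0 := Subtype.ext h
    have h4 : y = 0 := (LinearEquiv.map_eq_zero_iff _).1 h3
    rw [h4]; rfl
  have hdim : Module.finrank ℝ (ℝ × (Fin m → ℝ)) =
      Module.finrank ℝ (EuclideanSpace ℝ (Fin d)) := by
    simp; omega
  let e := (LinearMap.linearEquivOfInjective ψ hinj hdim).toContinuousLinearEquiv
  have he : ∀ p, e p = p.1 • u + (b.equivFun.symm p.2 : EuclideanSpace ℝ (Fin d)) := hψ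
  obtain ⟨C₁, hC₁, hfin⟩ := hfin
  obtain ⟨c₂, hc₂, hpos⟩ := hpos.global hτ
  obtain ⟨A, hA1, hA, hA'⟩ : ∃ A : ℝ, 1 ≤ A ∧ (∀ p, ‖e p‖ ≤ A * ‖p‖) ∧
      ∀ x, ‖e.symm x‖ ≤ A * ‖x‖ := by
    refine ⟨max 1 (max ‖(e : (ℝ × (Fin m → ℝ)) →L[ℝ] EuclideanSpace ℝ (Fin d))‖
      ‖(e.symm : EuclideanSpace ℝ (Fin d) →L[ℝ] (ℝ × (Fin m → ℝ)))‖), le_max_left _ _,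
      fun p => ?_, fun x => ?_⟩
    · refine ((e : (ℝ × (Fin m → ℝ)) →L[ℝ] EuclideanSpace ℝ (Fin d)).le_opNorm p).trans ?_
      gcongr
      exact (le_max_left _ _).trans (le_max_right _ _)
    · refine ((e.symm : EuclideanSpace ℝ (Fin d) →L[ℝ] (ℝ × (Fin m → ℝ))).le_opNorm x).trans ?_
      gcongr
      exact (le_max_right _ _).trans (le_max_right _ _)
  have hA0 : 0 < A := by linarith
  let S : EuclideanSpace ℝ (Fin d) →ₗ[ℝ] ℝ :=
    (LinearMap.fst ℝ ℝ (Fin m → ℝ)).comp (e.symm.toLinearEquiv : _ →ₗ[ℝ] _)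
  let V : EuclideanSpace ℝ (Fin d) →ₗ[ℝ] (Fin m → ℝ) :=
    (LinearMap.snd ℝ ℝ (Fin m → ℝ)).comp (e.symm.toLinearEquiv : _ →ₗ[ℝ] _)
  have hS : ∀ x, S x = (e.symm x).1 := fun x => rfl
  have hV : ∀ x, V x = (e.symm x).2 := fun x => rfl
  let w : EuclideanSpace ℝ (Fin d) → EuclideanSpace ℝ (Fin d) := fun x =>
    (b.equivFun.symm (V x) : EuclideanSpace ℝ (Fin d))
  have hwW : ∀ x, w x ∈ W := fun x => (b.equivFun.symm (V x)).2
  have hdecomp : ∀ x, x = S x • u + w x := fun x => by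
    conv_lhs => rw [← e.apply_symm_apply x, he]
    rfl
  have hwle : ∀ x, ‖w x‖ ≤ A * ‖V x‖ := fun x => by
    have := hA (0, V x)
    rw [he] at this
    simpa [Prod.norm_def, w] using this
  have hvle : ∀ x, ‖V x‖ ≤ A * ‖w x‖ := fun x => by
    have h1 : e (0, V x) = w x := by rw [he]; simp [w]
    have := hA' (w x)
    rw [← h1, e.symm_apply_apply] at this
    simpa [Prod.norm_def, h1] using this
  have hscale : ∀ x, 0 < S x → timeConstant P τ x =
      S x * timeConstant P τ (u + (S x)⁻¹ • w x) := fun x hx => by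
    rw [← abs_of_pos hx, ← hτ.timeConstant_smul, abs_of_pos hx, smul_add, smul_smul,
      mul_inv_cancel₀ hx.ne', one_smul, ← hdecomp]
  have hnorm : ∀ x, 0 < S x → ‖(S x)⁻¹ • w x‖ = ‖w x‖ / S x := fun x hx => by
    rw [norm_smul, Real.norm_of_nonneg (by positivity), inv_mul_eq_div]
  set K : ℝ := max (A + C₁ * A ^ 2) (A ^ 2 / c₂) with hK
  have hKA : A ≤ K := le_trans (by have : 0 ≤ C₁ * A ^ 2 := by positivity
                                   linarith) (le_max_left _ _)
  have hKC : C₁ * A ^ 2 ≤ K := le_trans (by linarith) (le_max_left _ _)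
  have hK0 : 0 < K := by linarith
  have hKc : A ^ 2 / c₂ ≤ K := le_max_right _ _
  refine ⟨⟨S, V, fun a y => e (a, y), K, by linarith, ?_, ?_, ?_, ?_, ?_, ?_, ?_, hμ, ?_, ?_, ?_⟩⟩
  · have : e (1, 0) = u := by rw [he]; simp
    rw [hS, ← this, e.symm_apply_apply]
  · have : e (1, 0) = u := by rw [he]; simp
    rw [hV, ← this, e.symm_apply_apply]
  · intro a y; rw [hS, e.symm_apply_apply]
  · intro a y; rw [hV, e.symm_apply_apply]
  · intro x
    refine le_trans ?_ ((hA' x).trans (by gcongr))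
    exact norm_fst_le (e.symm x)
  · intro x
    refine le_trans ?_ ((hA' x).trans (by gcongr))
    exact norm_snd_le (e.symm x)
  · intro x
    have h1 := hA (e.symm x)
    rw [e.apply_symm_apply] at h1
    refine h1.trans ?_
    gcongr
    rw [Prod.norm_def]
    refine max_le ?_ ?_
    · exact le_add_of_nonneg_right (norm_nonneg _)
    · exact le_add_of_nonneg_left (abs_nonneg _)
  · intro x
    rcases le_or_gt (S x) 0 with hx | hx
    · exact (mul_nonpos_of_nonpos_of_nonneg hx hμ.le).trans (hτ.timeConstant_nonneg x)
    · rw [hscale x hx]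
      gcongr
      exact hW.2 _ (W.smul_mem _ (hwW x))
  · intro x hx
    rw [hscale x hx]
    have h1 := hfin _ (W.smul_mem (S x)⁻¹ (hwW x))
    rw [hnorm x hx] at h1
    have h2 : S x * (C₁ * (‖w x‖ / S x) ^ 2) ≤ K * (‖V x‖ ^ 2 / S x) := by
      have e1 : S x * (C₁ * (‖w x‖ / S x) ^ 2) = C₁ * ‖w x‖ ^ 2 / S x := by field_simp
      rw [e1, ← mul_div_assoc]
      refine div_le_div_of_nonneg_right ?_ hx.le
      calc C₁ * ‖w x‖ ^ 2 ≤ C₁ * (A * ‖V x‖) ^ 2 := by gcongr; exact hwle x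
        _ = (C₁ * A ^ 2) * ‖V x‖ ^ 2 := by ring
        _ ≤ K * ‖V x‖ ^ 2 := by gcongr
    nlinarith
  · intro x hx
    rw [hscale x hx]
    have h1 := hpos _ (W.smul_mem (S x)⁻¹ (hwW x))
    rw [hnorm x hx] at h1
    have h2 : min (‖V x‖ ^ 2 / S x) ‖V x‖ / K ≤
        S x * (c₂ * min ((‖w x‖ / S x) ^ 2) (‖w x‖ / S x)) := by
      have e1 : S x * (c₂ * min ((‖w x‖ / S x) ^ 2) (‖w x‖ / S x)) =
          c₂ * min (‖w x‖ ^ 2 / S x) ‖w x‖ := by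
        rw [mul_left_comm, mul_min_of_nonneg _ _ hx.le]
        congr 2 <;> field_simp
      rw [e1, div_le_iff₀ hK0]
      have h3 : min (‖V x‖ ^ 2 / S x) ‖V x‖ ≤ A ^ 2 * min (‖w x‖ ^ 2 / S x) ‖w x‖ := by
        rw [mul_min_of_nonneg _ _ (by positivity)]
        refine min_le_min ?_ ?_
        · rw [← mul_div_assoc, ← mul_pow]
          gcongr
          exact hvle x
        · refine (hvle x).trans ?_
          gcongr
          nlinarith
      have h4 : A ^ 2 ≤ K * c₂ := (div_le_iff₀ hc₂).1 hKc
      have h5 : 0 ≤ min (‖w x‖ ^ 2 / S x) ‖w x‖ := by positivity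
      nlinarith
    nlinarith

end Geometry

/-! ### Tail sums over the lattice, for union bounds with infinitely many endpoints. -/

section Tail

variable {d : ℕ}

lemma summable_norm_toEuclid_rpow {r : ℝ} (hr : r < -d) :
    Summable fun z : Fin d → ℤ => ‖toEuclid z‖ ^ r := by
  obtain ⟨b, hb⟩ : ∃ b : Module.Basis (Fin d) ℝ (EuclideanSpace ℝ (Fin d)),
      ∀ i, b i = EuclideanSpace.single i 1 :=
    ⟨(EuclideanSpace.basisFun (Fin d) ℝ).toBasis, fun i => by simp⟩
  have hrank : Module.finrank ℤ (Submodule.span ℤ (Set.range b)) = d := by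
    rw [ZLattice.rank ℝ, finrank_euclideanSpace_fin]
  have h1 := ZLattice.summable_norm_rpow (Submodule.span ℤ (Set.range b)) r (by
    rw [hrank]; exact hr)
  have hmem : ∀ z : Fin d → ℤ, toEuclid z ∈ Submodule.span ℤ (Set.range b) := fun z => by
    have : toEuclid z = ∑ i, z i • b i := by
      ext j
      simp [hb, toEuclid, Pi.single_apply]
    rw [this]
    exact Submodule.sum_mem _ fun i _ =>
      Submodule.smul_mem _ _ (Submodule.subset_span (Set.mem_range_self i))
  have hinj : Function.Injective fun z : Fin d → ℤ =>
      (⟨toEuclid z, hmem z⟩ : Submodule.span ℤ (Set.range b)) := fun z z' h => by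
    have h2 : toEuclid z = toEuclid z' := Subtype.mk.inj h
    rw [← floorPt_toEuclid z, h2, floorPt_toEuclid]
  refine (h1.comp_injective hinj).congr fun z => ?_
  simp only [Function.comp, Submodule.coe_norm]

/-- The tail of the sum of `exp (-|z|^θ)` over the lattice. -/
lemma exists_tail_sum_le (d : ℕ) {θ : ℝ} (hθ : 0 < θ) : ∃ r₀ : ℝ, 0 < r₀ ∧ ∀ r : ℝ, r₀ ≤ r →
    ∃ g : (Fin d → ℤ) → ℝ, (∀ z, 0 ≤ g z) ∧ Summable g ∧ ∑' z, g z ≤ (r ^ (d + 1))⁻¹ ∧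
      ∀ z, r ≤ ‖toEuclid z‖ → Real.exp (-(‖toEuclid z‖ ^ θ)) ≤ g z := by
  have hsum := summable_norm_toEuclid_rpow (d := d) (r := -(d + 1 : ℝ)) (by linarith)
  set Z := ∑' z : Fin d → ℤ, ‖toEuclid z‖ ^ (-(d + 1 : ℝ)) with hZ
  have hZ0 : 0 ≤ Z := tsum_nonneg fun z => by positivity
  obtain ⟨r₁, hr₁⟩ := eventually_atTop.1
    (eventually_mul_exp_neg_rpow_le 1 (2 * d + 3) one_pos hθ)
  refine ⟨max (max r₁ Z) 1, by positivity, fun r hr => ?_⟩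
  have hr1 : 1 ≤ r := (le_max_right _ _).trans hr
  have hr0 : 0 < r := by linarith
  -- A summable power is factored off the stretched exponential. One of the `d + 2` powers of `r`
  -- absorbs the total sum `Z`; the remaining `d + 1` later beat the number of starting points in a
  -- cell.
  refine ⟨fun z => (r ^ (d + 2))⁻¹ * ‖toEuclid z‖ ^ (-(d + 1 : ℝ)), fun z => by positivity,
    hsum.mul_left _, ?_, fun z hz => ?_⟩
  · rw [tsum_mul_left, ← hZ, inv_mul_le_iff₀ (by positivity), pow_succ r (d + 1), mul_comm,
      ← mul_assoc, inv_mul_cancel₀ (by positivity), one_mul]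
    exact ((le_max_right _ _).trans (le_max_left _ _)).trans hr
  · have hn0 : 0 < ‖toEuclid z‖ := by linarith
    have h1 := hr₁ _ ((((le_max_left _ _).trans (le_max_left _ _)).trans hr).trans hz)
    rw [one_mul, one_mul] at h1
    have h2 : ‖toEuclid z‖ ^ (2 * d + 3 : ℝ) =
        ‖toEuclid z‖ ^ (d + 2) * ‖toEuclid z‖ ^ (d + 1 : ℝ) := by
      rw [← Real.rpow_natCast, ← Real.rpow_add hn0]
      congr 1; push_cast; ring
    rw [h2] at h1
    change _ ≤ (r ^ (d + 2))⁻¹ * ‖toEuclid z‖ ^ (-(d + 1 : ℝ))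
    rw [Real.rpow_neg hn0.le, ← mul_inv, ← one_div, le_div_iff₀ (by positivity), mul_comm]
    refine le_trans ?_ h1
    gcongr

end Tail

/-! ### Slabs, cells and uniform passage time bounds. -/

section Blocks

variable {d : ℕ} {Ω : Type*} [MeasurableSpace Ω] {P : Measure Ω} {τ : Edge d → Ω → ℝ}
  {u : EuclideanSpace ℝ (Fin d)} {m : ℕ} {χ : ℝ}

lemma slowSet_mono {x y : Fin d → ℤ} {t t' : ℝ} (h : t ≤ t') : slowSet x y t' ⊆ slowSet x y t :=
  fun _ hw γ => h.trans (hw γ)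

lemma slowSet_comm (x y : Fin d → ℤ) (t : ℝ) : slowSet x y t = slowSet y x t := by
  have key : ∀ x y : Fin d → ℤ, slowSet x y t ⊆ slowSet y x t := fun x y w hw γ => by
    rw [← pathTime_reverse]; exact hw γ.reverse
  exact (key x y).antisymm (key y x)

/-- The probability of a countable intersection of events of small complement. -/
lemma one_sub_tsum_le [IsProbabilityMeasure P] {ι : Type*} [Countable ι] {B : ι → Set Ω}
    {g : ι → ℝ} (hg : ∀ i, 0 ≤ g i) (hs : Summable g)
    (hB : ∀ i, MeasurableSet (B i)) (h : ∀ i, P.real (B i)ᶜ ≤ g i) :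
    1 - ∑' i, g i ≤ P.real (⋂ i, B i) := by
  have h1 : P.real (⋂ i, B i)ᶜ ≤ ∑' i, g i := by
    rw [Set.compl_iInter, measureReal_def]
    refine ENNReal.toReal_le_of_le_ofReal (tsum_nonneg hg) ?_
    rw [ENNReal.ofReal_tsum_of_nonneg hg hs]
    refine (measure_iUnion_le _).trans (ENNReal.tsum_le_tsum fun i => ?_)
    rw [← ofReal_measureReal]
    exact ENNReal.ofReal_le_ofReal (h i)
  rw [probReal_compl_eq_one_sub (MeasurableSet.iInter hB)] at h1
  linarith

lemma measureReal_exists_finset_le {ι : Type*} (s : Finset ι) [IsFiniteMeasure P] {B : ι → Set Ω}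
    {p : ℝ} (h : ∀ i ∈ s, P.real (B i) ≤ p) : P.real {ω | ∃ i ∈ s, ω ∈ B i} ≤ s.card * p := by
  have e : {ω | ∃ i ∈ s, ω ∈ B i} = ⋃ i ∈ s, B i := by ext ω; simp
  rw [e]
  refine (measureReal_biUnion_finset_le s B).trans ?_
  rw [← nsmul_eq_mul]
  exact Finset.sum_le_card_nsmul s _ p h

namespace CurvedFrame

lemma abs_s_sub_le_of_adj (F : CurvedFrame P τ u m) {x y : Fin d → ℤ} (h : (lattice d).Adj x y) :
    |F.s (toEuclid y) - F.s (toEuclid x)| ≤ F.K := by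
  rw [← map_sub]
  refine (F.abs_s_le _).trans (mul_le_of_le_one_right ?_ (norm_toEuclid_le_of_adj h))
  linarith [F.one_le_K]

lemma norm_v_sub_le_of_adj (F : CurvedFrame P τ u m) {x y : Fin d → ℤ}
    (h : (lattice d).Adj x y) : ‖F.v (toEuclid y) - F.v (toEuclid x)‖ ≤ F.K := by
  rw [← map_sub]
  refine (F.norm_v_le _).trans (mul_le_of_le_one_right ?_ (norm_toEuclid_le_of_adj h))
  linarith [F.one_le_K]

lemma abs_s_floorPt_sub_le (F : CurvedFrame P τ u m) (x : EuclideanSpace ℝ (Fin d)) :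
    |F.s (toEuclid (floorPt x)) - F.s x| ≤ F.K * d := by
  rw [← map_sub]
  have := F.one_le_K
  exact (F.abs_s_le _).trans (by gcongr; exact norm_toEuclid_floorPt_sub_le x)

lemma norm_v_floorPt_sub_le (F : CurvedFrame P τ u m) (x : EuclideanSpace ℝ (Fin d)) :
    ‖F.v (toEuclid (floorPt x)) - F.v x‖ ≤ F.K * d := by
  rw [← map_sub]
  have := F.one_le_K
  exact (F.norm_v_le _).trans (by gcongr; exact norm_toEuclid_floorPt_sub_le x)

/-- The lattice points of the slab at height `t` whose transversal coordinates lie in the cell of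
side `w` with index `z`. -/
def cell (F : CurvedFrame P τ u m) (w t : ℝ) (z : Fin m → ℤ) : Set (Fin d → ℤ) :=
  {x | t ≤ F.s (toEuclid x) ∧ F.s (toEuclid x) ≤ t + F.K ∧
    ∀ i, ⌊F.v (toEuclid x) i / w⌋ = z i}

lemma norm_v_sub_le_of_mem_cell (F : CurvedFrame P τ u m) {w t : ℝ} (hw : 0 < w) {z : Fin m → ℤ}
    {x : Fin d → ℤ} (hx : x ∈ F.cell w t z) :
    ‖F.v (toEuclid x) - fun i => w * (z i : ℝ)‖ ≤ w := by
  rw [pi_norm_le_iff_of_nonneg hw.le]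
  intro i
  have h1 := Int.floor_le (F.v (toEuclid x) i / w)
  have h2 := Int.lt_floor_add_one (F.v (toEuclid x) i / w)
  rw [hx.2.2 i] at h1 h2
  rw [le_div_iff₀ hw] at h1
  rw [div_lt_iff₀ hw] at h2
  rw [Pi.sub_apply, Real.norm_eq_abs, abs_le]
  constructor <;> linarith

end CurvedFrame

variable [IsProbabilityMeasure P]

/-- Uniform lower bounds for passage times from one point to all points of a large cube. -/
lemma FullConcentration.uniform_lower (hτ : IsWeights P τ) (hχ : FullConcentration P τ χ)
    {ε B : ℝ} (hε : 0 < ε) (hB : 1 ≤ B) : ∃ N₀ : ℝ, 0 < N₀ ∧ ∀ N : ℝ, N₀ ≤ N →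
      ∀ x : Fin d → ℤ, 3 / 4 ≤ P.real {ω | ∀ z ∈ cube x (B * N), ‖toEuclid z - toEuclid x‖ ≤ B * N →
        (fun e => τ e ω) ∈ slowSet x z (timeConstant P τ (toEuclid z - toEuclid x) -
          N ^ (χ + ε))} := by
  obtain ⟨θ, hθ, h⟩ := hχ.lower hτ (half_pos hε)
  obtain ⟨C, hC, hCμ⟩ := hτ.exists_timeConstant_le
  have hχ0 := hχ.nonneg
  have hθ' : 0 < (χ + ε) * θ := by positivity
  obtain ⟨N₁, hN₁⟩ := eventually_atTop.1 (((eventually_mul_rpow_le (B ^ (χ + ε / 2))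
    (show χ + ε / 2 < χ + ε by linarith)).and
    (eventually_mul_exp_neg_rpow_le (4 * (3 * B) ^ d) d (c := (C⁻¹) ^ θ) (by positivity) hθ')))
  refine ⟨max N₁ 1, by positivity, fun N hN x => ?_⟩
  obtain ⟨h1, h2⟩ := hN₁ N ((le_max_left _ _).trans hN)
  have hN1 : 1 ≤ N := (le_max_right _ _).trans hN
  have hN0 : 0 < N := by linarith
  have hBN : 0 ≤ B * N := by positivity
  -- Nonnegativity of the weights is built into the bad events so that they are empty, not merely
  -- null, for trivial endpoints.
  set A : (Fin d → ℤ) → Set Ω := fun z => {ω | (∀ e, 0 ≤ τ e ω) ∧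
    ‖toEuclid z - toEuclid x‖ ≤ B * N ∧
    (fun e => τ e ω) ∉ slowSet x z (timeConstant P τ (toEuclid z - toEuclid x) - N ^ (χ + ε))}
    with hA
  have hAz : ∀ z ∈ cube x (B * N), P.real (A z) ≤ Real.exp (-((C⁻¹) ^ θ * N ^ ((χ + ε) * θ))) := by
    intro z _
    by_cases hz1 : ‖toEuclid z - toEuclid x‖ ≤ B * N
    swap
    · have : A z = ∅ := by ext ω; simp [hA, hz1]
      rw [this, measureReal_empty]; positivity
    -- For nearby endpoints the required lower bound is at most zero. All others are at distance at
    -- least a power of `N`, so the concentration bound is uniform and beats the size of the cube.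
    by_cases hz2 : C * ‖toEuclid z - toEuclid x‖ ≤ N ^ (χ + ε)
    · have : A z = ∅ := by
        ext ω
        simp only [hA, Set.mem_ofPred_eq, Set.mem_empty_iff_false, iff_false, not_and, not_not]
        intro h0 _ γ
        have := hCμ (toEuclid z - toEuclid x)
        exact le_trans (by linarith) (pathTime_nonneg h0 γ)
      rw [this, measureReal_empty]; positivity
    rw [not_le] at hz2
    set n := ‖toEuclid z - toEuclid x‖ with hn
    have hn0 : 0 ≤ n := norm_nonneg _
    have hxz : x ≠ z := by
      rintro rfl
      rw [hn, sub_self, norm_zero, mul_zero] at hz2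
      have : 0 ≤ N ^ (χ + ε) := by positivity
      linarith
    have h3 := h x z hxz
    have h4 : n ^ (χ + ε / 2) ≤ N ^ (χ + ε) := by
      refine le_trans ?_ h1
      rw [← Real.mul_rpow (by linarith) hN0.le]
      gcongr
    have h5 : (C⁻¹) ^ θ * N ^ ((χ + ε) * θ) ≤ n ^ θ := by
      rw [Real.rpow_mul hN0.le, ← Real.mul_rpow (by positivity) (by positivity)]
      gcongr
      rw [inv_mul_le_iff₀ hC]
      exact hz2.le
    refine le_trans (measureReal_mono fun ω hω => ?_) (h3.trans (by gcongr))
    exact fun hcon => hω.2.2 (slowSet_mono (by linarith) hcon)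
  have h6 := measureReal_exists_finset_le (P := P) (cube x (B * N)) hAz
  have h7 : ((cube x (B * N)).card : ℝ) ≤ (3 * B) ^ d * N ^ (d : ℝ) := by
    refine (card_cube_le x hBN).trans ?_
    rw [Real.rpow_natCast, ← mul_pow]
    gcongr
    nlinarith
  have h8 : P.real {ω | ∃ i ∈ cube x (B * N), ω ∈ A i} ≤ 1 / 4 := by
    refine h6.trans ?_
    have := mul_le_mul_of_nonneg_right h7
      (Real.exp_nonneg (-((C⁻¹) ^ θ * N ^ ((χ + ε) * θ))))
    linarith
  have hinc : ∀ z : Fin d → ℤ, IsIncreasing {w : Edge d → ℝ | ‖toEuclid z - toEuclid x‖ ≤ B * N →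
      w ∈ slowSet x z (timeConstant P τ (toEuclid z - toEuclid x) - N ^ (χ + ε))} := fun z => by
    by_cases hz : ‖toEuclid z - toEuclid x‖ ≤ B * N
    · simpa [hz] using isIncreasing_slowSet x z _
    · simpa [hz] using isCylinderUpper_univ.isIncreasing
  have hmeas := (hτ.harris_finset (cube x (B * N)) hinc).2.measurableSet
  have hmeas' := hτ.measurable_pi hmeas
  have h9 := probReal_compl_eq_one_sub (μ := P) hmeas'
  have h10 : P.real ((fun ω e => τ e ω) ⁻¹' {w : Edge d → ℝ | ∀ z ∈ cube x (B * N),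
      w ∈ {w | ‖toEuclid z - toEuclid x‖ ≤ B * N →
      w ∈ slowSet x z (timeConstant P τ (toEuclid z - toEuclid x) - N ^ (χ + ε))}})ᶜ ≤
      P.real {ω | ∃ i ∈ cube x (B * N), ω ∈ A i} := by
    rw [measureReal_def, measureReal_def]
    refine ENNReal.toReal_mono (measure_ne_top P _) (measure_mono_ae ?_)
    filter_upwards [hτ.ae_nonneg] with ω h0 hω
    by_contra hcon
    refine hω fun z hz hz1 => ?_
    by_contra hz2
    exact hcon ⟨z, hz, h0, hz1, hz2⟩
  have h11 : 3 / 4 ≤ P.real ((fun ω e => τ e ω) ⁻¹' {w : Edge d → ℝ | ∀ z ∈ cube x (B * N),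
      w ∈ {w | ‖toEuclid z - toEuclid x‖ ≤ B * N →
      w ∈ slowSet x z (timeConstant P τ (toEuclid z - toEuclid x) - N ^ (χ + ε))}}) := by linarith
  exact h11

namespace CurvedFrame

/-- Passage times over a distance `ℓ` to points with transversal deviation at most
`2 ℓ ^ ((1 + χ) / 2)` are of the right order with high probability. -/
lemma short_upper (F : CurvedFrame P τ u m) (hτ : IsWeights P τ) (hχ : FullConcentration P τ χ)
    {ε c₀ : ℝ} (hε : 0 < ε) (hc₀ : 0 ≤ c₀) : ∃ C θ ℓ₀ : ℝ, 0 < C ∧ 0 < θ ∧ 1 ≤ ℓ₀ ∧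
      ∀ ℓ : ℝ, ℓ₀ ≤ ℓ → ∀ x y : Fin d → ℤ, |F.s (toEuclid y - toEuclid x) - ℓ| ≤ c₀ →
      ‖F.v (toEuclid y - toEuclid x)‖ ≤ 2 * ℓ ^ ((1 + χ) / 2) →
      P.real {ω | ℓ * timeConstant P τ u + C * ℓ ^ (χ + ε) <
        latticeTime (fun e => τ e ω) x y} ≤ Real.exp (-((ℓ / (2 * F.K)) ^ θ)) ∧
      ‖toEuclid y - toEuclid x‖ ≤ 4 * F.K * ℓ := by
  obtain ⟨θ, hθ, n₀, hn₀, h⟩ := hχ.upper hτ hε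
  have hK := F.one_le_K
  have hχ0 := hχ.nonneg
  have hχ1 := hχ.lt_one
  have hμ := F.pos
  refine ⟨c₀ * timeConstant P τ u + 8 * F.K + 2 * (4 * F.K) ^ (χ + ε), θ,
    max (max (2 * c₀) (2 * F.K * n₀)) 1, by positivity, hθ, le_max_right _ _, ?_⟩
  intro ℓ hℓ x y hs hv
  have hℓ1 : 1 ≤ ℓ := (le_max_right _ _).trans hℓ
  have hℓ2 : 2 * c₀ ≤ ℓ := ((le_max_left _ _).trans (le_max_left _ _)).trans hℓ
  have hℓ3 : 2 * F.K * n₀ ≤ ℓ := ((le_max_right _ _).trans (le_max_left _ _)).trans hℓ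
  have hℓ0 : 0 < ℓ := by linarith
  have hK0 : 0 < F.K := by linarith
  set X := toEuclid y - toEuclid x with hX
  obtain ⟨hs1, hs2⟩ := abs_le.1 hs
  have ha1 : ℓ / 2 ≤ F.s X := by linarith
  have ha2 : F.s X ≤ 2 * ℓ := by linarith
  have ha0 : 0 < F.s X := by linarith
  have hξ : ℓ ^ ((1 + χ) / 2) ≤ ℓ := by
    conv_rhs => rw [← Real.rpow_one ℓ]
    exact Real.rpow_le_rpow_of_exponent_le hℓ1 (by linarith)
  have hnl : ℓ / (2 * F.K) ≤ ‖X‖ := by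
    rw [div_le_iff₀ (by positivity)]
    have := (le_abs_self _).trans (F.abs_s_le X)
    linarith
  have hnu : ‖X‖ ≤ 4 * F.K * ℓ := by
    refine (F.norm_le X).trans ?_
    rw [abs_of_pos ha0]
    nlinarith
  refine ⟨?_, hnu⟩
  have h1 := h x y (le_trans (by rw [le_div_iff₀ (by positivity)]; linarith) hnl)
  refine le_trans (measureReal_mono fun ω hω => ?_) (h1.trans (by gcongr))
  have hω' : ℓ * timeConstant P τ u + (c₀ * timeConstant P τ u + 8 * F.K +
    2 * (4 * F.K) ^ (χ + ε)) * ℓ ^ (χ + ε) < latticeTime (fun e => τ e ω) x y := hω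
  refine lt_of_le_of_lt ?_ hω'
  have h2 := F.le_of_pos X ha0
  -- The exponent (1 + χ)/2 is the one for which the curvature cost of the deviation, its square
  -- divided by `ℓ`, is of the order ℓ^χ of the fluctuations.
  have h3 : ‖F.v X‖ ^ 2 / F.s X ≤ 8 * ℓ ^ χ := by
    rw [div_le_iff₀ ha0]
    have e1 : (2 * ℓ ^ ((1 + χ) / 2)) ^ 2 = 4 * (ℓ ^ χ * ℓ) := by
      rw [mul_pow, ← Real.rpow_natCast (ℓ ^ ((1 + χ) / 2)), ← Real.rpow_mul hℓ0.le]
      nth_rewrite 3 [← Real.rpow_one ℓ]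
      rw [← Real.rpow_add hℓ0]
      congr 1
      · norm_num
      · congr 1; push_cast; ring
    calc ‖F.v X‖ ^ 2 ≤ (2 * ℓ ^ ((1 + χ) / 2)) ^ 2 := by gcongr
      _ = 4 * (ℓ ^ χ * ℓ) := e1
      _ = 8 * ℓ ^ χ * (ℓ / 2) := by ring
      _ ≤ 8 * ℓ ^ χ * F.s X := by gcongr
  have h4 : ℓ ^ χ ≤ ℓ ^ (χ + ε) := Real.rpow_le_rpow_of_exponent_le hℓ1 (by linarith)
  have h5 : ‖X‖ ^ (χ + ε) ≤ (4 * F.K) ^ (χ + ε) * ℓ ^ (χ + ε) := by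
    rw [← Real.mul_rpow (by positivity) hℓ0.le]
    gcongr
  have h6 : 1 ≤ ℓ ^ (χ + ε) := Real.one_le_rpow hℓ1 (by linarith)
  have h7 : F.K * (‖F.v X‖ ^ 2 / F.s X) ≤ F.K * (8 * ℓ ^ (χ + ε)) := by
    gcongr; linarith
  have h8 : F.s X * timeConstant P τ u ≤ (ℓ + c₀) * timeConstant P τ u := by
    gcongr; linarith
  have h9 : c₀ * timeConstant P τ u * 1 ≤ c₀ * timeConstant P τ u * ℓ ^ (χ + ε) := by gcongr
  linarith

end CurvedFrame

end Blocks

/-! ### Slow passages from a cell to near and to far cells of the next slab. -/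

section CellEstimates

variable {d : ℕ} {Ω : Type*} [MeasurableSpace Ω] {P : Measure Ω} {τ : Edge d → Ω → ℝ}
  {u : EuclideanSpace ℝ (Fin d)} {m : ℕ} {χ : ℝ}

lemma IsIncreasing.forall_imp {ι : Type*} [Countable ι] {p : ι → Prop}
    {S : ι → Set (Edge d → ℝ)} (h : ∀ i, IsIncreasing (S i)) :
    IsIncreasing {w | ∀ i, p i → w ∈ S i} := by
  have e : {w | ∀ i, p i → w ∈ S i} = ⋂ i, {w | p i → w ∈ S i} := by
    ext w; simp
  rw [e]
  refine IsIncreasing.iInter fun i => ?_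
  by_cases hp : p i
  · simpa [hp] using h i
  · simpa [hp] using isCylinderUpper_univ.isIncreasing

/-- The side of the cells of a slab of thickness `L`. -/
def cellSide (χ δ L : ℝ) : ℝ := (L ^ (1 - δ)) ^ ((1 + χ) / 2)

lemma cellSide_eq {χ δ L : ℝ} (hL : 0 < L) :
    cellSide χ δ L = L ^ ((1 - δ) * ((1 + χ) / 2)) := by
  rw [cellSide, ← Real.rpow_mul hL.le]

namespace CurvedFrame

/-- The event that all passages between two cells of consecutive slabs take time at least `g`. -/
def nearSet (F : CurvedFrame P τ u m) (w t L g : ℝ) (z z' : Fin m → ℤ) : Set (Edge d → ℝ) :=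
  {η | ∀ x y, x ∈ F.cell w t z ∧ y ∈ F.cell w (t + L) z' → η ∈ slowSet x y g}

/-- The event that all passages from a cell to remote points of the next slab take time at
least `g`. -/
def farSet (F : CurvedFrame P τ u m) (w t L g R : ℝ) (z : Fin m → ℤ) : Set (Edge d → ℝ) :=
  {η | ∀ x, x ∈ F.cell w t z → η ∈ {η | ∀ y, (t + L ≤ F.s (toEuclid y) ∧
    F.s (toEuclid y) ≤ t + L + F.K ∧
    ∃ i, R < |(⌊F.v (toEuclid y) i / w⌋ : ℝ) - z i|) → η ∈ slowSet x y g}}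

lemma isIncreasing_nearSet (F : CurvedFrame P τ u m) (w t L g : ℝ) (z z' : Fin m → ℤ) :
    IsIncreasing (F.nearSet w t L g z z') := by
  have e : F.nearSet w t L g z z' = {η | ∀ p : (Fin d → ℤ) × (Fin d → ℤ),
      (p.1 ∈ F.cell w t z ∧ p.2 ∈ F.cell w (t + L) z') → η ∈ slowSet p.1 p.2 g} := by
    ext η
    exact ⟨fun h p => h p.1 p.2, fun h x y => h (x, y)⟩
  rw [e]
  exact IsIncreasing.forall_imp fun p => isIncreasing_slowSet _ _ _

lemma isIncreasing_farSet (F : CurvedFrame P τ u m) (w t L g R : ℝ) (z : Fin m → ℤ) :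
    IsIncreasing (F.farSet w t L g R z) :=
  IsIncreasing.forall_imp fun _ => IsIncreasing.forall_imp fun _ => isIncreasing_slowSet _ _ _

/-- Large transversal deviations are penalized by the curvature. -/
lemma exists_far_penalty (F : CurvedFrame P τ u m) (hχ : FullConcentration P τ χ)
    {δ : ℝ} (hδ : 0 < δ) (hδχ : δ < (1 - χ) / 4) : ∃ L₀ : ℝ, 1 ≤ L₀ ∧
      ∀ L : ℝ, L₀ ≤ L → ∀ D : ℝ, L ^ ((1 + χ) / 2 + δ) ≤ D →
      F.K * timeConstant P τ u + (F.K * (2 * L + D)) ^ (χ + δ) + L ^ (χ - δ) ≤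
        min (D ^ 2 / (2 * L)) D / F.K := by
  have hK := F.one_le_K
  have hχ0 := hχ.nonneg
  have hχ1 := hχ.lt_one
  have hμ := F.pos
  set c := F.K * timeConstant P τ u + (3 * F.K) ^ (χ + δ) + 1 with hc
  have hc0 : 0 < c := by positivity
  obtain ⟨L₁, hL₁⟩ := eventually_atTop.1
    (eventually_mul_rpow_le (2 * F.K * c) (show χ + δ < χ + 2 * δ by linarith))
  refine ⟨max L₁ 1, le_max_right _ _, fun L hL D hD => ?_⟩
  have hL1 : 1 ≤ L := (le_max_right _ _).trans hL
  have hL0 : 0 < L := by linarith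
  have hD0 : 0 < D := lt_of_lt_of_le (by positivity) hD
  -- Applied with `M` the larger of `L` and `D`. The left side is of order M^(χ+δ); the curvature
  -- term is at least of order M^(χ+2δ), from D²/L if `D ≤ L` and from `D` itself otherwise, as χ +
  -- 2δ < 1.
  have key : ∀ M : ℝ, L ≤ M → D ≤ M →
      F.K * timeConstant P τ u + (F.K * (2 * L + D)) ^ (χ + δ) + L ^ (χ - δ) ≤
        M ^ (χ + 2 * δ) / (2 * F.K) := by
    intro M hLM hDM
    have hM1 : 1 ≤ M := hL1.trans hLM
    have h1 := hL₁ M (((le_max_left _ _).trans hL).trans hLM)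
    have h2 : (F.K * (2 * L + D)) ^ (χ + δ) ≤ (3 * F.K) ^ (χ + δ) * M ^ (χ + δ) := by
      rw [← Real.mul_rpow (by positivity) (by positivity)]
      refine Real.rpow_le_rpow (by positivity) ?_ (by linarith)
      rw [mul_comm 3, mul_assoc]
      gcongr
      linarith
    have h3 : L ^ (χ - δ) ≤ M ^ (χ + δ) :=
      (Real.rpow_le_rpow_of_exponent_le hL1 (by linarith : χ - δ ≤ χ + δ)).trans (by gcongr)
    have h4 : 1 ≤ M ^ (χ + δ) := Real.one_le_rpow hM1 (by linarith)
    rw [le_div_iff₀ (by positivity)]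
    have h5 : F.K * timeConstant P τ u ≤ F.K * timeConstant P τ u * M ^ (χ + δ) :=
      le_mul_of_one_le_right (by positivity) h4
    have h6 : F.K * timeConstant P τ u + (F.K * (2 * L + D)) ^ (χ + δ) + L ^ (χ - δ) ≤
        c * M ^ (χ + δ) := by rw [hc]; linarith
    nlinarith
  have hstep : ∀ b : ℝ, b ≤ 2 * min (D ^ 2 / (2 * L)) D →
      b / (2 * F.K) ≤ min (D ^ 2 / (2 * L)) D / F.K := by
    intro b hb
    rw [div_le_div_iff₀ (by positivity) (by positivity)]
    nlinarith
  rcases le_total D L with hDL | hDL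
  · refine (key L le_rfl hDL).trans (hstep _ ?_)
    have h1 : L ^ (χ + 2 * δ) * L ≤ D ^ 2 := by
      calc L ^ (χ + 2 * δ) * L = (L ^ ((1 + χ) / 2 + δ)) ^ 2 := by
            rw [← Real.rpow_natCast (L ^ ((1 + χ) / 2 + δ)), ← Real.rpow_mul hL0.le]
            nth_rewrite 2 [← Real.rpow_one L]
            rw [← Real.rpow_add hL0]
            congr 1; push_cast; ring
        _ ≤ D ^ 2 := by gcongr
    rw [mul_min_of_nonneg _ _ two_pos.le]
    refine le_min ?_ ?_
    · rw [← mul_div_assoc, le_div_iff₀ (by positivity)]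
      linarith
    · have : L ^ (χ + 2 * δ) * L ≤ (2 * D) * L := by nlinarith
      exact le_of_mul_le_mul_right this hL0
  · refine (key D hDL le_rfl).trans (hstep _ ?_)
    have h1 : D ^ (χ + 2 * δ) ≤ D := by
      conv_rhs => rw [← Real.rpow_one D]
      exact Real.rpow_le_rpow_of_exponent_le (hL1.trans hDL) (by linarith)
    refine h1.trans ?_
    rw [mul_min_of_nonneg _ _ two_pos.le]
    refine le_min ?_ (by linarith)
    rw [← mul_div_assoc, le_div_iff₀ (by positivity)]
    nlinarith

variable [IsProbabilityMeasure P]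

set_option maxHeartbeats 1000000 in
/-- Passages between neighbouring cells are slow with at least polynomially small probability. -/
lemma near (F : CurvedFrame P τ u m) (hτ : IsWeights P τ) (hχ : FullConcentration P τ χ)
    (hχ0 : 0 < χ) {δ : ℝ} (hδ : 0 < δ) (hδχ : δ < (1 - χ) / 4) : ∃ L₀ : ℝ, 1 ≤ L₀ ∧
      ∀ L : ℝ, L₀ ≤ L → ∀ (t : ℝ) (z z' : Fin m → ℤ),
      (∀ i, |(z' i : ℝ) - z i| ≤ L ^ (2 * δ)) →
      L ^ (-3 : ℝ) ≤ P.real {ω | (fun e => τ e ω) ∈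
        F.nearSet (cellSide χ δ L) t L (L * timeConstant P τ u + L ^ (χ - δ)) z z'} := by
  have hK := F.one_le_K
  have hχ1 := hχ.lt_one
  have hμ := F.pos
  -- So small that the gain L^(χ-κ) dominates both the target L^(χ-δ) and the error L^((1-δ)(χ+κ))
  -- of the short end passages.
  set κ := δ * χ / 4 with hκ
  have hκ0 : 0 < κ := by positivity
  have hκχ : κ < χ := by nlinarith
  set c₀ : ℝ := F.K + F.K * d with hc₀
  obtain ⟨C₂, θ, ℓ₀, hC₂, hθ, hℓ₀, hshort⟩ := F.short_upper hτ hχ hκ0 (c₀ := c₀) (by positivity)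
  obtain ⟨n₀, hn₀, hex⟩ := hχ.exceed hτ hκ0 hκχ
  have h1δ : 0 < 1 - δ := by linarith
  have hξ0 : 0 < (1 + χ) / 2 := by linarith
  obtain ⟨L₁, hL₁⟩ := eventually_atTop.1 ((((((tendsto_rpow_atTop h1δ).eventually_ge_atTop
    (max ℓ₀ (2 * F.K * d))).and
    (((tendsto_rpow_atTop hξ0).comp (tendsto_rpow_atTop h1δ)).eventually_ge_atTop
      (F.K * d))).and
    (eventually_ge_atTop (max (F.K * n₀) (max (2 * F.K * d) (max (72 * F.K ^ 2) 1))))).and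
    (eventually_mul_exp_neg_rpow_le (2 * (9 * F.K) ^ d) (d + 3) (c := (1 / (2 * F.K)) ^ θ)
      (by positivity) (mul_pos h1δ hθ))).and
    (((eventually_mul_rpow_le (6 * F.K * F.K * d * timeConstant P τ u)
      (show (0 : ℝ) < χ - κ by linarith)).and
    (eventually_mul_rpow_le (6 * F.K * C₂)
      (show (1 - δ) * (χ + κ) < χ - κ by rw [hκ]; nlinarith [mul_pos hδ hχ0]))).and
    (eventually_mul_rpow_le (3 * F.K)
      (show χ - δ < χ - κ by rw [hκ]; nlinarith))))
  refine ⟨max L₁ 1, le_max_right _ _, fun L hL t z z' hzz' => ?_⟩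
  obtain ⟨⟨⟨⟨ha, hb⟩, hc⟩, he⟩, ⟨hf1, hf2⟩, hf3⟩ := hL₁ L ((le_max_left _ _).trans hL)
  have hL1 : 1 ≤ L := (le_max_right _ _).trans hL
  have hL0 : 0 < L := by linarith
  set μ₁ := timeConstant P τ u with hμ₁
  set ℓ := L ^ (1 - δ) with hℓ
  set w := cellSide χ δ L with hw
  have hwℓ : w = ℓ ^ ((1 + χ) / 2) := rfl
  have hℓ1 : ℓ₀ ≤ ℓ := (le_max_left _ _).trans ha
  have hℓ2 : 2 * F.K * d ≤ ℓ := (le_max_right _ _).trans ha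
  have hℓ01 : 1 ≤ ℓ := hℓ₀.trans hℓ1
  have hℓ0 : 0 < ℓ := by linarith
  have hℓL : ℓ ≤ L := by
    conv_rhs => rw [← Real.rpow_one L]
    exact Real.rpow_le_rpow_of_exponent_le hL1 (by linarith)
  have hw0 : 0 < w := by rw [hwℓ]; positivity
  have hwK : F.K * d ≤ w := hb
  have hLn : F.K * n₀ ≤ L := (le_max_left _ _).trans hc
  have hLd : 2 * F.K * d ≤ L := ((le_max_left _ _).trans (le_max_right _ _)).trans hc
  have hL72 : 72 * F.K ^ 2 ≤ L :=
    ((le_max_left _ _).trans ((le_max_right _ _).trans (le_max_right _ _))).trans hc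
  have hwL : w * L ^ (2 * δ) ≤ L := by
    rw [hw, cellSide_eq hL0, ← Real.rpow_add hL0]
    conv_rhs => rw [← Real.rpow_one L]
    exact Real.rpow_le_rpow_of_exponent_le hL1 (by nlinarith)
  -- Auxiliary endpoints at distance about `ℓ` behind the first cell and beyond the second. If the
  -- passage between them is slow and the short passages into and out of the cells are normal, the
  -- triangle inequality makes every passage between the cells slow at once.
  set x₀ := floorPt (F.pt (t - ℓ) fun i => w * (z i : ℝ)) with hx₀
  set y₀ := floorPt (F.pt (t + L + ℓ) fun i => w * (z' i : ℝ)) with hy₀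
  have hsx := abs_le.1 (F.abs_s_floorPt_sub_le (F.pt (t - ℓ) fun i => w * (z i : ℝ)))
  have hsy := abs_le.1 (F.abs_s_floorPt_sub_le (F.pt (t + L + ℓ) fun i => w * (z' i : ℝ)))
  have hvx := F.norm_v_floorPt_sub_le (F.pt (t - ℓ) fun i => w * (z i : ℝ))
  have hvy := F.norm_v_floorPt_sub_le (F.pt (t + L + ℓ) fun i => w * (z' i : ℝ))
  rw [F.s_pt, ← hx₀] at hsx
  rw [F.s_pt, ← hy₀] at hsy
  rw [F.v_pt, ← hx₀] at hvx
  rw [F.v_pt, ← hy₀] at hvy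
  -- the short passages at both ends
  have hup : ∀ x ∈ F.cell w t z, P.real {ω | ℓ * μ₁ + C₂ * ℓ ^ (χ + κ) <
      latticeTime (fun e => τ e ω) x₀ x} ≤ Real.exp (-((ℓ / (2 * F.K)) ^ θ)) ∧
      ‖toEuclid x - toEuclid x₀‖ ≤ 4 * F.K * ℓ := by
    intro x hx
    refine hshort ℓ hℓ1 x₀ x ?_ ?_
    · rw [map_sub, abs_le]
      have h1 := hx.1
      have h2 := hx.2.1
      constructor <;> rw [hc₀] <;> linarith
    · rw [map_sub]
      have h1 := F.norm_v_sub_le_of_mem_cell hw0 hx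
      have h2 := norm_sub_le_norm_sub_add_norm_sub (F.v (toEuclid x)) (fun i => w * (z i : ℝ))
        (F.v (toEuclid x₀))
      rw [norm_sub_rev (fun i => w * (z i : ℝ))] at h2
      rw [← hwℓ]
      linarith
  have hup' : ∀ y ∈ F.cell w (t + L) z', P.real {ω | ℓ * μ₁ + C₂ * ℓ ^ (χ + κ) <
      latticeTime (fun e => τ e ω) y y₀} ≤ Real.exp (-((ℓ / (2 * F.K)) ^ θ)) ∧
      ‖toEuclid y₀ - toEuclid y‖ ≤ 4 * F.K * ℓ := by
    intro y hy
    refine hshort ℓ hℓ1 y y₀ ?_ ?_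
    · rw [map_sub, abs_le]
      have h1 := hy.1
      have h2 := hy.2.1
      constructor <;> rw [hc₀] <;> linarith
    · rw [map_sub]
      have h1 := F.norm_v_sub_le_of_mem_cell hw0 hy
      have h2 := norm_sub_le_norm_sub_add_norm_sub (F.v (toEuclid y₀)) (fun i => w * (z' i : ℝ))
        (F.v (toEuclid y))
      rw [norm_sub_rev (fun i => w * (z' i : ℝ))] at h2
      rw [← hwℓ]
      linarith
  -- the long passage
  set X := toEuclid y₀ - toEuclid x₀ with hX
  have hs1 : L + 2 * ℓ - 2 * (F.K * d) ≤ F.s X := by rw [hX, map_sub]; linarith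
  have hs2 : F.s X ≤ 4 * L := by rw [hX, map_sub]; linarith
  have hsL : L ≤ F.s X := by linarith
  have hv : ‖F.v X‖ ≤ 2 * L := by
    rw [hX, map_sub]
    have h1 : ‖(fun i => w * (z' i : ℝ)) - fun i => w * (z i : ℝ)‖ ≤ L := by
      rw [pi_norm_le_iff_of_nonneg hL0.le]
      intro i
      rw [Pi.sub_apply, ← mul_sub, norm_mul, Real.norm_of_nonneg hw0.le, Real.norm_eq_abs]
      exact (mul_le_mul_of_nonneg_left (hzz' i) hw0.le).trans hwL
    have h2 := norm_sub_le_norm_sub_add_norm_sub (F.v (toEuclid y₀)) (fun i => w * (z' i : ℝ))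
      (F.v (toEuclid x₀))
    have h3 := norm_sub_le_norm_sub_add_norm_sub (fun i => w * (z' i : ℝ))
      (fun i => w * (z i : ℝ)) (F.v (toEuclid x₀))
    rw [norm_sub_rev (fun i => w * (z i : ℝ)) (F.v (toEuclid x₀))] at h3
    linarith
  have hn1 : L / F.K ≤ ‖X‖ := by
    rw [div_le_iff₀ (by linarith)]
    have := (le_abs_self _).trans (F.abs_s_le X)
    linarith
  have hn2 : ‖X‖ ≤ 6 * F.K * L := by
    refine (F.norm_le X).trans ?_
    rw [abs_of_pos (by linarith), show 6 * F.K * L = F.K * (4 * L + 2 * L) by ring]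
    gcongr
  have hn0 : 0 < ‖X‖ := lt_of_lt_of_le (by positivity) hn1
  have hprob := hex x₀ y₀ (le_trans (by rw [le_div_iff₀ (by linarith)]; linarith) hn1)
  -- The third power of `L` leaves room for the constant and for the two bad events, each of
  -- probability at most half of `L ^ (-3)`.
  have hprob' : 2 * L ^ (-3 : ℝ) ≤ ‖X‖ ^ (-2 : ℝ) := by
    rw [Real.rpow_neg hn0.le, Real.rpow_neg hL0.le, Real.rpow_two,
      show (3 : ℝ) = ((3 : ℕ) : ℝ) by norm_num, Real.rpow_natCast, ← div_eq_mul_inv, ← one_div,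
      div_le_div_iff₀ (by positivity) (by positivity)]
    calc 2 * ‖X‖ ^ 2 ≤ 2 * (6 * F.K * L) ^ 2 := by gcongr
      _ = 72 * F.K ^ 2 * L ^ 2 := by ring
      _ ≤ L * L ^ 2 := by gcongr
      _ = 1 * L ^ 3 := by ring
  -- union bounds
  set p := Real.exp (-((ℓ / (2 * F.K)) ^ θ)) with hp
  set B₁ : (Fin d → ℤ) → Set Ω := fun x => {ω | x ∈ F.cell w t z ∧
    ℓ * μ₁ + C₂ * ℓ ^ (χ + κ) < latticeTime (fun e => τ e ω) x₀ x} with hB₁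
  set B₂ : (Fin d → ℤ) → Set Ω := fun y => {ω | y ∈ F.cell w (t + L) z' ∧
    ℓ * μ₁ + C₂ * ℓ ^ (χ + κ) < latticeTime (fun e => τ e ω) y y₀} with hB₂
  have hp0 : 0 ≤ p := Real.exp_nonneg _
  have hPB₁ := measureReal_exists_finset_le (P := P) (B := B₁) (p := p) (cube x₀ (4 * F.K * ℓ))
    fun x _ => by
      by_cases hx : x ∈ F.cell w t z
      · simpa [hB₁, hx] using (hup x hx).1
      · simpa [hB₁, hx] using hp0
  have hPB₂ := measureReal_exists_finset_le (P := P) (B := B₂) (p := p) (cube y₀ (4 * F.K * ℓ))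
    fun y _ => by
      by_cases hy : y ∈ F.cell w (t + L) z'
      · simpa [hB₂, hy] using (hup' y hy).1
      · simpa [hB₂, hy] using hp0
  have hcard : ∀ x : Fin d → ℤ, ((cube x (4 * F.K * ℓ)).card : ℝ) * p ≤ L ^ (-3 : ℝ) / 2 := by
    intro x
    have h1 : ((cube x (4 * F.K * ℓ)).card : ℝ) ≤ (9 * F.K) ^ d * L ^ (d : ℝ) := by
      refine (card_cube_le x (by positivity)).trans ?_
      rw [Real.rpow_natCast, ← mul_pow]
      gcongr
      have h2 := mul_le_mul_of_nonneg_left hℓL (zero_le_one.trans hK)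
      have h3 := one_le_mul_of_one_le_of_one_le hK hL1
      linarith
    have h2 : p = Real.exp (-((1 / (2 * F.K)) ^ θ * L ^ ((1 - δ) * θ))) := by
      rw [hp, Real.rpow_mul hL0.le, ← Real.mul_rpow (by positivity) (by positivity), one_div,
        inv_mul_eq_div]
    have h3 : (9 * F.K) ^ d * L ^ (d : ℝ) * p * L ^ (3 : ℝ) ≤ 1 / 2 := by
      rw [Real.rpow_add hL0, ← h2] at he
      linarith
    rw [Real.rpow_neg hL0.le, inv_eq_one_div, div_div, le_div_iff₀ (by positivity)]
    have h4 : (0 : ℝ) ≤ p * L ^ (3 : ℝ) := by positivity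
    have h5 := mul_le_mul_of_nonneg_right h1 h4
    linarith
  set G := {ω | (fun e => τ e ω) ∈ F.nearSet w t L (L * μ₁ + L ^ (χ - δ)) z z'} with hG
  set A := {ω | timeConstant P τ X + ‖X‖ ^ (χ - κ) ≤ latticeTime (fun e => τ e ω) x₀ y₀} with hA
  have hcover : P.real A ≤ P.real (G ∪ ({ω | ∃ x ∈ cube x₀ (4 * F.K * ℓ), ω ∈ B₁ x} ∪
      {ω | ∃ y ∈ cube y₀ (4 * F.K * ℓ), ω ∈ B₂ y})) := by
    rw [measureReal_def, measureReal_def]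
    refine ENNReal.toReal_mono (measure_ne_top P _) (measure_mono_ae ?_)
    filter_upwards [hτ.ae_nonneg] with ω h0 hω
    by_cases hω1 : ∃ x ∈ cube x₀ (4 * F.K * ℓ), ω ∈ B₁ x
    · exact Or.inr (Or.inl hω1)
    by_cases hω2 : ∃ y ∈ cube y₀ (4 * F.K * ℓ), ω ∈ B₂ y
    · exact Or.inr (Or.inr hω2)
    refine Or.inl fun x y hxy => ?_
    rw [mem_slowSet_iff h0]
    have h1 : latticeTime (fun e => τ e ω) x₀ x ≤ ℓ * μ₁ + C₂ * ℓ ^ (χ + κ) := by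
      by_contra hcon
      exact hω1 ⟨x, mem_cube (hup x hxy.1).2, hxy.1, not_le.1 hcon⟩
    have h2 : latticeTime (fun e => τ e ω) y y₀ ≤ ℓ * μ₁ + C₂ * ℓ ^ (χ + κ) := by
      by_contra hcon
      refine hω2 ⟨y, mem_cube ?_, hxy.2, not_le.1 hcon⟩
      rw [norm_sub_rev]
      exact (hup' y hxy.2).2
    have h3 : timeConstant P τ X + ‖X‖ ^ (χ - κ) ≤ latticeTime (fun e => τ e ω) x₀ y₀ := hω
    have h4 := latticeTime_triangle h0 x₀ x y₀
    have h5 := latticeTime_triangle h0 x y y₀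
    -- The tangent bound suffices, since transversal displacement only increases the time constant.
    -- Its part 2ℓμ(u) cancels against the two short passages.
    have h6 := F.linear_le X
    have h7 : (L + 2 * ℓ - 2 * (F.K * d)) * μ₁ ≤ F.s X * μ₁ := by gcongr
    have h8 : L ^ (χ - κ) / F.K ≤ ‖X‖ ^ (χ - κ) := by
      calc L ^ (χ - κ) / F.K ≤ L ^ (χ - κ) / F.K ^ (χ - κ) := by
            gcongr
            conv_rhs => rw [← Real.rpow_one F.K]
            exact Real.rpow_le_rpow_of_exponent_le hK (by linarith)
        _ = (L / F.K) ^ (χ - κ) := (Real.div_rpow hL0.le (by linarith) _).symm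
        _ ≤ ‖X‖ ^ (χ - κ) := by gcongr
    have h9 : ℓ ^ (χ + κ) = L ^ ((1 - δ) * (χ + κ)) := by rw [hℓ, ← Real.rpow_mul hL0.le]
    rw [Real.rpow_zero, mul_one] at hf1
    rw [← h9] at hf2
    have h10 : 2 * (F.K * d) * μ₁ + 2 * (C₂ * ℓ ^ (χ + κ)) + L ^ (χ - δ) ≤ L ^ (χ - κ) / F.K := by
      rw [le_div_iff₀ (by linarith)]
      linarith
    linarith
  have h1 := measureReal_union_le (μ := P) G ({ω | ∃ x ∈ cube x₀ (4 * F.K * ℓ), ω ∈ B₁ x} ∪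
      {ω | ∃ y ∈ cube y₀ (4 * F.K * ℓ), ω ∈ B₂ y})
  have h2 := measureReal_union_le (μ := P) {ω | ∃ x ∈ cube x₀ (4 * F.K * ℓ), ω ∈ B₁ x}
      {ω | ∃ y ∈ cube y₀ (4 * F.K * ℓ), ω ∈ B₂ y}
  have h3 := hcard x₀
  have h4 := hcard y₀
  linarith

set_option maxHeartbeats 1000000 in
/-- Passages from a cell to remote points of the next slab are slow with probability at least
one half. -/
lemma far (F : CurvedFrame P τ u m) (hτ : IsWeights P τ) (hχ : FullConcentration P τ χ)
    {δ : ℝ} (hδ : 0 < δ) (hδχ : δ < (1 - χ) / 4) : ∃ L₀ : ℝ, 1 ≤ L₀ ∧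
      ∀ L : ℝ, L₀ ≤ L → ∀ (t : ℝ) (z : Fin m → ℤ),
      1 / 2 ≤ P.real {ω | (fun e => τ e ω) ∈
        F.farSet (cellSide χ δ L) t L (L * timeConstant P τ u + L ^ (χ - δ)) (L ^ (2 * δ)) z} := by
  have hK := F.one_le_K
  have hχ0 := hχ.nonneg
  have hχ1 := hχ.lt_one
  have hμ := F.pos
  obtain ⟨θ, hθ, hlow⟩ := hχ.lower hτ hδ
  obtain ⟨r₀, hr₀, htail⟩ := exists_tail_sum_le d hθ
  obtain ⟨L₂, hL₂, hpen⟩ := F.exists_far_penalty hχ hδ hδχ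
  have h1δ : 0 < 1 - δ := by linarith
  obtain ⟨L₁, hL₁⟩ := eventually_atTop.1 (((eventually_ge_atTop
    (max (2 * F.K * r₀) (max (2 * F.K) (max (F.K + 2 * F.K * d)
      (2 * (7 * F.K) ^ d * (2 * F.K) ^ (d + 1)))))).and
    (eventually_mul_rpow_le 2 (show (1 + χ) / 2 + δ < (1 - δ) * ((1 + χ) / 2) + 2 * δ by
      nlinarith))).and
    ((tendsto_rpow_atTop (show 0 < 2 * δ by linarith)).eventually_ge_atTop 2))
  refine ⟨max (max L₁ L₂) 1, le_max_right _ _, fun L hL t z => ?_⟩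
  have hL1 : 1 ≤ L := (le_max_right _ _).trans hL
  have hL0 : 0 < L := by linarith
  obtain ⟨⟨ha, hb⟩, hc⟩ := hL₁ L (((le_max_left _ _).trans (le_max_left _ _)).trans hL)
  have hLpen := hpen L (((le_max_right _ _).trans (le_max_left _ _)).trans hL)
  have hLr : 2 * F.K * r₀ ≤ L := (le_max_left _ _).trans ha
  have hL2K : 2 * F.K ≤ L := ((le_max_left _ _).trans (le_max_right _ _)).trans ha
  have hLd : F.K + 2 * F.K * d ≤ L :=
    ((le_max_left _ _).trans ((le_max_right _ _).trans (le_max_right _ _))).trans ha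
  have hLcard : 2 * (7 * F.K) ^ d * (2 * F.K) ^ (d + 1) ≤ L :=
    ((le_max_right _ _).trans ((le_max_right _ _).trans (le_max_right _ _))).trans ha
  set μ₁ := timeConstant P τ u with hμ₁
  set w := cellSide χ δ L with hw
  have hw0 : 0 < w := by rw [hw, cellSide_eq hL0]; positivity
  have hwL : w ≤ L := by
    rw [hw, cellSide_eq hL0]
    conv_rhs => rw [← Real.rpow_one L]
    exact Real.rpow_le_rpow_of_exponent_le hL1 (by nlinarith)
  have hwδ : 2 * L ^ ((1 + χ) / 2 + δ) ≤ w * L ^ (2 * δ) := by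
    rw [hw, cellSide_eq hL0, ← Real.rpow_add hL0]; exact hb
  set r := L / (2 * F.K) with hr
  have hr0 : 0 < r := by positivity
  obtain ⟨g, hg0, hgs, hgsum, hg⟩ := htail r (by rw [hr, le_div_iff₀ (by positivity)]; linarith)
  set x₀ := floorPt (F.pt t fun i => w * (z i : ℝ)) with hx₀
  have hsx := abs_le.1 (F.abs_s_floorPt_sub_le (F.pt t fun i => w * (z i : ℝ)))
  have hvx := F.norm_v_floorPt_sub_le (F.pt t fun i => w * (z i : ℝ))
  rw [F.s_pt, ← hx₀] at hsx
  rw [F.v_pt, ← hx₀] at hvx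
  have hcell : ∀ x ∈ F.cell w t z, x ∈ cube x₀ (3 * F.K * L) := by
    intro x hx
    refine mem_cube ((F.norm_le _).trans ?_)
    rw [map_sub, map_sub]
    have h1 : |F.s (toEuclid x) - F.s (toEuclid x₀)| ≤ F.K + F.K * d := by
      have h1 := hx.1
      have h2 := hx.2.1
      rw [abs_le]; constructor <;> linarith
    have h2 : ‖F.v (toEuclid x) - F.v (toEuclid x₀)‖ ≤ w + F.K * d := by
      have h1 := F.norm_v_sub_le_of_mem_cell hw0 hx
      have h2 := norm_sub_le_norm_sub_add_norm_sub (F.v (toEuclid x)) (fun i => w * (z i : ℝ))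
        (F.v (toEuclid x₀))
      rw [norm_sub_rev (fun i => w * (z i : ℝ))] at h2
      linarith
    rw [show 3 * F.K * L = F.K * (L + 2 * L) by ring]
    gcongr <;> linarith
  set G : (Fin d → ℤ) → Set (Edge d → ℝ) := fun x => {η | ∀ y, (t + L ≤ F.s (toEuclid y) ∧
    F.s (toEuclid y) ≤ t + L + F.K ∧
    ∃ i, L ^ (2 * δ) < |(⌊F.v (toEuclid y) i / w⌋ : ℝ) - z i|) →
      η ∈ slowSet x y (L * μ₁ + L ^ (χ - δ))} with hG
  have hGinc : ∀ x, IsIncreasing (G x) := fun x =>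
    IsIncreasing.forall_imp fun y => isIncreasing_slowSet x y _
  have hGx : ∀ x ∈ F.cell w t z,
      P.real {ω | (fun e => τ e ω) ∉ G x} ≤ (r ^ (d + 1))⁻¹ := by
    intro x hx
    set B : (Fin d → ℤ) → Set Ω := fun y => {ω | (t + L ≤ F.s (toEuclid y) ∧
      F.s (toEuclid y) ≤ t + L + F.K ∧
      ∃ i, L ^ (2 * δ) < |(⌊F.v (toEuclid y) i / w⌋ : ℝ) - z i|) →
        (fun e => τ e ω) ∈ slowSet x y (L * μ₁ + L ^ (χ - δ))} with hB
    have hBm : ∀ y, MeasurableSet (B y) := fun y => by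
      refine MeasurableSet.imp (MeasurableSet.const _) ?_
      exact hτ.measurable_pi (isIncreasing_slowSet x y _).measurableSet
    have hBy : ∀ y, P.real (B y)ᶜ ≤ g (y - x) := by
      intro y
      by_cases hy : t + L ≤ F.s (toEuclid y) ∧ F.s (toEuclid y) ≤ t + L + F.K ∧
        ∃ i, L ^ (2 * δ) < |(⌊F.v (toEuclid y) i / w⌋ : ℝ) - z i|
      swap
      · have : (B y)ᶜ = ∅ := by
          rw [Set.compl_empty_iff, Set.eq_univ_iff_forall]
          exact fun ω h => absurd h hy
        rw [this, measureReal_empty]; exact hg0 _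
      obtain ⟨hy1, hy2, i, hi⟩ := id hy
      set X := toEuclid y - toEuclid x with hX
      have hs1 : L - F.K ≤ F.s X := by rw [hX, map_sub]; linarith [hx.2.1]
      have hs2 : F.s X ≤ 2 * L := by rw [hX, map_sub]; linarith [hx.1]
      have hs0 : 0 < F.s X := by linarith
      have hn : r ≤ ‖X‖ := by
        rw [hr, div_le_iff₀ (by positivity)]
        have := (le_abs_self _).trans (F.abs_s_le X)
        linarith
      have hxy : x ≠ y := by
        rintro rfl
        rw [hX, sub_self, norm_zero] at hn
        linarith
      -- Passing from indices to coordinates loses one cell, that is at most half of L^(2δ); the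
      -- factor 2 in `hwδ` pays for it.
      have hD : L ^ ((1 + χ) / 2 + δ) ≤ ‖F.v X‖ := by
        have h1 : w * (L ^ (2 * δ) - 1) ≤ |F.v (toEuclid y) i - F.v (toEuclid x) i| := by
          have h2 := Int.floor_le (F.v (toEuclid y) i / w)
          have h3 := Int.lt_floor_add_one (F.v (toEuclid y) i / w)
          have h4 := Int.floor_le (F.v (toEuclid x) i / w)
          have h5 := Int.lt_floor_add_one (F.v (toEuclid x) i / w)
          rw [hx.2.2 i] at h4 h5
          have h6 : L ^ (2 * δ) - 1 ≤
              |F.v (toEuclid y) i / w - F.v (toEuclid x) i / w| := by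
            rcases lt_abs.1 hi with h | h
            · exact le_trans (by linarith) (le_abs_self _)
            · exact le_trans (by linarith) (neg_le_abs _)
          rw [← sub_div, abs_div, abs_of_pos hw0, le_div_iff₀ hw0] at h6
          linarith
        have h2 : |F.v (toEuclid y) i - F.v (toEuclid x) i| ≤ ‖F.v X‖ := by
          rw [hX, map_sub]
          exact norm_le_pi_norm (F.v (toEuclid y) - F.v (toEuclid x)) i
        have h3 := mul_le_mul_of_nonneg_left hc hw0.le
        linarith
      refine le_trans (measureReal_mono fun ω hω => ?_) ((hlow x y hxy).trans ?_)
      · intro hcon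
        refine hω fun _ => slowSet_mono ?_ hcon
        have h1 := F.ge_of_pos X hs0
        have h2 := hLpen _ hD
        have h3 : ‖X‖ ^ (χ + δ) ≤ (F.K * (2 * L + ‖F.v X‖)) ^ (χ + δ) := by
          gcongr
          refine (F.norm_le X).trans ?_
          rw [abs_of_pos hs0]
          gcongr
        have h4 : min (‖F.v X‖ ^ 2 / (2 * L)) ‖F.v X‖ / F.K ≤
            min (‖F.v X‖ ^ 2 / F.s X) ‖F.v X‖ / F.K := by gcongr
        have h5 : (L - F.K) * μ₁ ≤ F.s X * μ₁ := by gcongr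
        linarith
      · have h1 := hg (y - x)
        rw [toEuclid_sub] at h1
        exact h1 hn
    have hgsx : Summable fun y => g (y - x) := (Equiv.subRight x).summable_iff.2 hgs
    have h1 := one_sub_tsum_le (P := P) (fun y => hg0 (y - x)) hgsx hBm hBy
    have h2 : ∑' y, g (y - x) = ∑' y, g y := (Equiv.subRight x).tsum_eq g
    rw [h2] at h1
    have h3 : {ω | (fun e => τ e ω) ∉ G x} = (⋂ y, B y)ᶜ := by
      ext ω
      simp only [hG, hB, Set.mem_ofPred_eq, Set.mem_compl_iff, Set.mem_iInter]
    rw [h3, probReal_compl_eq_one_sub (MeasurableSet.iInter hBm)]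
    linarith
  have h1 := measureReal_exists_finset_le (P := P)
    (B := fun x => {ω | x ∈ F.cell w t z ∧ (fun e => τ e ω) ∉ G x}) (p := (r ^ (d + 1))⁻¹)
    (cube x₀ (3 * F.K * L)) fun x _ => by
      by_cases hx : x ∈ F.cell w t z
      · simpa [hx] using hGx x hx
      · simpa [hx] using pow_nonneg hr0.le _
  -- At most order L^d starting points, each failing with probability of order L^(-(d+1)).
  have h2 : ((cube x₀ (3 * F.K * L)).card : ℝ) * (r ^ (d + 1))⁻¹ ≤ 1 / 2 := by
    have h3 : ((cube x₀ (3 * F.K * L)).card : ℝ) ≤ (7 * F.K) ^ d * L ^ d := by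
      refine (card_cube_le x₀ (by positivity)).trans ?_
      rw [← mul_pow]
      gcongr
      have h3 := one_le_mul_of_one_le_of_one_le hK hL1
      linarith
    rw [← div_eq_mul_inv, div_le_iff₀ (by positivity), hr, div_pow]
    refine h3.trans ?_
    rw [← mul_div_assoc, le_div_iff₀ (by positivity), pow_succ L]
    have h4 := mul_le_mul_of_nonneg_left hLcard (pow_nonneg hL0.le d)
    linarith
  have hinc := F.isIncreasing_farSet w t L (L * μ₁ + L ^ (χ - δ)) (L ^ (2 * δ)) z
  have h3 := probReal_compl_eq_one_sub (μ := P) (hτ.measurable_pi hinc.measurableSet)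
  have h4 : P.real ((fun ω e => τ e ω) ⁻¹'
      F.farSet w t L (L * μ₁ + L ^ (χ - δ)) (L ^ (2 * δ)) z)ᶜ ≤ 1 / 2 := by
    refine le_trans (measureReal_mono fun ω hω => ?_) (h1.trans h2)
    by_contra hcon
    refine hω fun x hx => ?_
    by_contra hx2
    exact hcon ⟨x, hcell x hx, hx, hx2⟩
  have h5 : 1 / 2 ≤ P.real ((fun ω e => τ e ω) ⁻¹'
      F.farSet w t L (L * μ₁ + L ^ (χ - δ)) (L ^ (2 * δ)) z) := by linarith
  exact h5

end CurvedFrame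

end CellEstimates

/-! ### Paths through consecutive slabs, exits from the tube, and the probability that all crossings
are slow. -/

section Chain

variable {d : ℕ} {Ω : Type*} [MeasurableSpace Ω] {P : Measure Ω} {τ : Edge d → Ω → ℝ}
  {u : EuclideanSpace ℝ (Fin d)} {m : ℕ} {χ : ℝ}

/-- A path that leaves a set splits at its first exit point. -/
lemma exists_exit (D : Set (Fin d → ℤ)) (η : Edge d → ℝ) {x y v : Fin d → ℤ}
    (γ : (lattice d).Walk x y) (hx : x ∈ D) (hv : v ∈ γ.support) (hvD : v ∉ D) :
    ∃ (p z : Fin d → ℤ) (γ₁ : (lattice d).Walk x z) (γ₂ : (lattice d).Walk z y),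
      (lattice d).Adj p z ∧ p ∈ D ∧ z ∉ D ∧ pathTime η γ₁ + pathTime η γ₂ = pathTime η γ ∧
      ∀ a ∈ γ₁.support, a = z ∨ a ∈ D := by
  classical
  obtain ⟨p, z, γ₁, γ₂, h1, h2, h3, h4, h5⟩ :=
    exists_first_vertex (fun a => a ∉ D) (γ.takeUntil v hv) (not_not.2 hx) hvD
  refine ⟨p, z, γ₁, γ₂.append (γ.dropUntil v hv), h2, not_not.1 h3, h4, ?_, fun a ha =>
    (h5 a ha).imp_right not_not.1⟩
  conv_rhs => rw [← γ.take_spec hv, ← h1]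
  simp only [pathTime_append, add_assoc]

namespace CurvedFrame

/-- The event that all passages from the part `‖v‖ ≤ A` of one slab to the next take time at
least `g`, for the first `k` slabs. -/
def chainSet (F : CurvedFrame P τ u m) (A L g : ℝ) (k : ℕ) : Set (Edge d → ℝ) :=
  {η | ∀ j < k, ∀ x y, ‖F.v (toEuclid x)‖ ≤ A → j * L ≤ F.s (toEuclid x) →
    F.s (toEuclid x) ≤ j * L + F.K → j * L + L ≤ F.s (toEuclid y) →
    F.s (toEuclid y) ≤ j * L + L + F.K → η ∈ slowSet x y g}

/-- Induction on the number of slabs left: cut the path at its first vertex of height at least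
(j+1)L. One step changes the height by at most `F.K`, so this vertex lies in the next layer of
thickness `F.K`; `F.K < L` keeps the layers disjoint. Later returns below the cut are harmless. -/
lemma chain_le_pathTime (F : CurvedFrame P τ u m) {η : Edge d → ℝ} (hη : ∀ e, 0 ≤ η e)
    {A L g : ℝ} {k : ℕ} (hL : F.K < L) (hchain : η ∈ F.chainSet A L g k) (i : ℕ) :
    ∀ j : ℕ, i + j = k → ∀ {x y : Fin d → ℤ} (γ : (lattice d).Walk x y),
      (∀ a ∈ γ.support, ‖F.v (toEuclid a)‖ ≤ A) → j * L ≤ F.s (toEuclid x) →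
      F.s (toEuclid x) ≤ j * L + F.K → k * L ≤ F.s (toEuclid y) → i * g ≤ pathTime η γ := by
  induction i with
  | zero => intro j _ x y γ _ _ _ _; simpa using pathTime_nonneg hη γ
  | succ i ih =>
    intro j hj x y γ hγ hx1 hx2 hy
    have hK := F.one_le_K
    have hjk : (i : ℝ) + 1 + j = k := by exact_mod_cast hj
    obtain ⟨p, z, γ₁, γ₂, h1, h2, h3, h4, -⟩ :=
      exists_first_vertex (fun a => j * L + L ≤ F.s (toEuclid a)) γ (by linarith) (by
        have : (0 : ℝ) ≤ i * L := by
          have : 0 < L := by linarith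
          positivity
        rw [← hjk] at hy
        linarith)
    have h5 := (abs_le.1 (F.abs_s_sub_le_of_adj h2)).2
    have hz : F.s (toEuclid z) ≤ j * L + L + F.K := by linarith
    have h6 := hchain j (by omega) x z (hγ x γ.start_mem_support) hx1 hx2 h4 hz γ₁
    have h7 := ih (j + 1) (by omega) γ₂ (fun a ha => hγ a (by
      rw [← h1, SimpleGraph.Walk.mem_support_append_iff]; exact Or.inr ha))
      (by push_cast; linarith) (by push_cast; linarith) hy
    rw [← h1, pathTime_append]
    push_cast
    linarith

/-- At an exit point of the tube around the direction `u`, the time constant has a large excess. -/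
lemma exit_excess (F : CurvedFrame P τ u m) (hpos : ∀ x, 0 ≤ timeConstant P τ x) {N A : ℝ}
    (hN : 4 * F.K * (d + 1) ≤ N) (hA1 : 2 * (F.K * d) ≤ A) (hA2 : A ≤ N)
    {Y : EuclideanSpace ℝ (Fin d)} (hY1 : |F.s Y - N| ≤ F.K * d) (hY2 : ‖F.v Y‖ ≤ F.K * d)
    {p z : Fin d → ℤ} (hpz : (lattice d).Adj p z) (hp1 : ‖F.v (toEuclid p)‖ ≤ A)
    (hp2 : -N ≤ F.s (toEuclid p)) (hp3 : F.s (toEuclid p) ≤ 2 * N)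
    (hz : ¬ (‖F.v (toEuclid z)‖ ≤ A ∧ -N ≤ F.s (toEuclid z) ∧ F.s (toEuclid z) ≤ 2 * N)) :
    ‖toEuclid z‖ ≤ 8 * F.K * N ∧ ‖toEuclid z - Y‖ ≤ 8 * F.K * N ∧
    N * timeConstant P τ u - F.K * d * timeConstant P τ u +
      min (A ^ 2 / (12 * N * F.K)) (N * timeConstant P τ u) ≤
      timeConstant P τ (toEuclid z) + timeConstant P τ (Y - toEuclid z) := by
  have hK := F.one_le_K
  have hμ := F.pos
  set μ₁ := timeConstant P τ u with hμ₁
  set X := toEuclid z with hX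
  have hKd : 0 ≤ F.K * d := by positivity
  have hNK : 4 * (F.K * d) ≤ N := by nlinarith
  have hNK' : 4 * F.K ≤ N := by nlinarith
  have hN0 : 0 < N := by linarith
  have h1 := abs_le.1 (F.abs_s_sub_le_of_adj hpz)
  have h2 := F.norm_v_sub_le_of_adj hpz
  have h3 := norm_le_insert' (F.v X) (F.v (toEuclid p))
  obtain ⟨hY3, hY4⟩ := abs_le.1 hY1
  have hs : |F.s X| ≤ 3 * N := by rw [abs_le]; constructor <;> linarith
  have hv : ‖F.v X‖ ≤ 2 * N := by linarith
  have hX1 : ‖X‖ ≤ 5 * F.K * N := by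
    refine (F.norm_le X).trans ?_
    rw [show 5 * F.K * N = F.K * (3 * N + 2 * N) by ring]
    gcongr
  have hY5 : ‖Y‖ ≤ 3 * F.K * N := by
    refine (F.norm_le Y).trans ?_
    rw [show 3 * F.K * N = F.K * (2 * N + N) by ring]
    gcongr
    · rw [abs_le]; constructor <;> linarith
    · linarith
  refine ⟨by nlinarith, (norm_sub_le _ _).trans (by linarith), ?_⟩
  have hmin1 := min_le_left (A ^ 2 / (12 * N * F.K)) (N * μ₁)
  have hmin2 := min_le_right (A ^ 2 / (12 * N * F.K)) (N * μ₁)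
  have hlin1 := F.linear_le X
  have hlin2 := F.linear_le (Y - X)
  rw [map_sub] at hlin2
  have hA0 : 0 ≤ A := by linarith
  have hYμ : (N - F.K * d) * μ₁ ≤ F.s Y * μ₁ := by gcongr; linarith
  -- Leaving through either end of the tube already costs an extra multiple of N by the tangent
  -- bound, without curvature.
  rcases lt_or_ge (2 * N) (F.s X) with hcase | hcase
  · have h4 : 2 * N * μ₁ ≤ F.s X * μ₁ := by gcongr
    have h5 := hpos (Y - X)
    have h6 : 0 ≤ F.K * d * μ₁ := by positivity
    linarith
  rcases lt_or_ge (F.s X) (-N) with hcase' | hcase'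
  · have h4 : (2 * N - F.K * d) * μ₁ ≤ (F.s Y - F.s X) * μ₁ :=
      mul_le_mul_of_nonneg_right (by linarith) hμ.le
    have h5 := hpos X
    linarith
  have hvA : A < ‖F.v X‖ := by
    by_contra hcon
    exact hz ⟨not_lt.1 hcon, hcase', hcase⟩
  -- The worst case is deviation `A / 2` over length 3N, which explains the 12 = 3 · 4 in the
  -- statement.
  have key : ∀ V a : ℝ, A / 2 ≤ V → 0 < a → a ≤ 3 * N →
      A ^ 2 / (12 * N * F.K) ≤ min (V ^ 2 / a) V / F.K := by
    intro V a hV ha ha'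
    rw [← div_div]
    gcongr
    refine le_min ?_ ?_
    · rw [div_le_div_iff₀ (by positivity) ha]
      have h4 : (A / 2) ^ 2 ≤ V ^ 2 := by gcongr
      calc A ^ 2 * a ≤ A ^ 2 * (3 * N) := by gcongr
        _ = (A / 2) ^ 2 * (12 * N) := by ring
        _ ≤ V ^ 2 * (12 * N) := by gcongr
    · rw [div_le_iff₀ (by positivity)]
      calc A ^ 2 = A * A := sq A
        _ ≤ (2 * V) * N := mul_le_mul (by linarith) hA2 hA0 (by linarith)
        _ ≤ V * (12 * N) := by nlinarith
  -- Curvature is applied to whichever of the two pieces surely has positive length along `u`; the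
  -- other piece gets the tangent bound.
  rcases le_or_gt (N / 2) (F.s X) with hhalf | hhalf
  · have h4 := F.ge_of_pos X (by linarith)
    have h5 := key ‖F.v X‖ (F.s X) (by linarith) (by linarith) (by linarith)
    linarith
  · have hs0 : 0 < F.s (Y - X) := by rw [map_sub]; linarith
    have h4 := F.ge_of_pos (Y - X) hs0
    have h6 : A / 2 ≤ ‖F.v (Y - X)‖ := by
      rw [map_sub]
      have := norm_le_insert' (F.v X) (F.v Y)
      rw [norm_sub_rev] at this
      linarith
    have h5 := key ‖F.v (Y - X)‖ (F.s (Y - X)) h6 hs0 (by rw [map_sub]; linarith)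
    rw [map_sub F.s] at h4 h5
    linarith

lemma isIncreasing_chainSet (F : CurvedFrame P τ u m) (A L g : ℝ) (k : ℕ) :
    IsIncreasing (F.chainSet A L g k) := by
  have e : F.chainSet A L g k = {η | ∀ q : ℕ × (Fin d → ℤ) × (Fin d → ℤ), (q.1 < k ∧
      ‖F.v (toEuclid q.2.1)‖ ≤ A ∧ q.1 * L ≤ F.s (toEuclid q.2.1) ∧
      F.s (toEuclid q.2.1) ≤ q.1 * L + F.K ∧ q.1 * L + L ≤ F.s (toEuclid q.2.2) ∧
      F.s (toEuclid q.2.2) ≤ q.1 * L + L + F.K) → η ∈ slowSet q.2.1 q.2.2 g} := by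
    ext η
    exact ⟨fun h q hq => h q.1 hq.1 _ _ hq.2.1 hq.2.2.1 hq.2.2.2.1 hq.2.2.2.2.1 hq.2.2.2.2.2,
      fun h j hj x y h1 h2 h3 h4 h5 => h (j, x, y) ⟨hj, h1, h2, h3, h4, h5⟩⟩
  rw [e]
  exact IsIncreasing.forall_imp fun q => isIncreasing_slowSet _ _ _

/-- The box of integer vectors with entries of modulus at most `M`. -/
def intBox (m M : ℕ) : Finset (Fin m → ℤ) := Finset.Icc (fun _ => -(M : ℤ)) fun _ => M

lemma mem_intBox {M : ℕ} {z : Fin m → ℤ} : z ∈ intBox m M ↔ ∀ i, |z i| ≤ M := by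
  rw [intBox, Finset.mem_Icc, Pi.le_def, Pi.le_def, ← forall_and]
  exact forall_congr' fun i => abs_le.symm

lemma card_intBox (m M : ℕ) : (intBox m M).card = (2 * M + 1) ^ m := by
  simp only [intBox, Pi.card_Icc, Int.card_Icc, Finset.prod_const, Finset.card_univ,
    Fintype.card_fin]
  congr 1
  omega

variable [IsProbabilityMeasure P]

/-- A lower bound for the probability that all passages between consecutive slabs are slow. -/
lemma chain_prob (F : CurvedFrame P τ u m) (hτ : IsWeights P τ) (hχ : FullConcentration P τ χ)
    (hχ0 : 0 < χ) {δ : ℝ} (hδ : 0 < δ) (hδχ : δ < (1 - χ) / 4) : ∃ L₀ : ℝ, 1 ≤ L₀ ∧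
      ∀ L : ℝ, L₀ ≤ L → ∀ (A : ℝ) (k : ℕ),
      Real.exp (-((k * (2 * ⌈A / cellSide χ δ L⌉₊ + 1) ^ m * (2 * ⌊L ^ (2 * δ)⌋₊ + 1) ^ m : ℕ) *
        (1 + 3 * Real.log L))) ≤
      P.real {ω | (fun e => τ e ω) ∈ F.chainSet A L (L * timeConstant P τ u + L ^ (χ - δ)) k} := by
  obtain ⟨L₁, hL₁, hnear⟩ := F.near hτ hχ hχ0 hδ hδχ
  obtain ⟨L₂, hL₂, hfar⟩ := F.far hτ hχ hδ hδχ
  refine ⟨max L₁ L₂, hL₁.trans (le_max_left _ _), fun L hL A k => ?_⟩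
  have hnear := hnear L ((le_max_left _ _).trans hL)
  have hfar := hfar L ((le_max_right _ _).trans hL)
  have hL1 : 1 ≤ L := hL₁.trans ((le_max_left _ _).trans hL)
  have hL0 : 0 < L := by linarith
  set w := cellSide χ δ L with hw
  have hw0 : 0 < w := by rw [hw, cellSide_eq hL0]; positivity
  set g := L * timeConstant P τ u + L ^ (χ - δ) with hg
  set M := ⌈A / w⌉₊ with hM
  set R := ⌊L ^ (2 * δ)⌋₊ with hR
  set I := Finset.range k ×ˢ intBox m M with hI
  set J := I ×ˢ intBox m R with hJ
  have h1 := hτ.pow_le_harris I (S := fun q => F.farSet w (q.1 * L) L g (L ^ (2 * δ)) q.2)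
    (fun q => F.isIncreasing_farSet _ _ _ _ _ _) (p := 1 / 2) (by norm_num)
    (fun q _ => hfar _ _)
  have h2 := hτ.pow_le_harris J (S := fun q => F.nearSet w (q.1.1 * L) L g q.1.2 (q.1.2 + q.2))
    (fun q => F.isIncreasing_nearSet _ _ _ _ _ _) (p := L ^ (-3 : ℝ)) (by positivity)
    (fun q hq => hnear _ _ _ fun i => by
      have h3 := mem_intBox.1 (Finset.mem_product.1 hq).2 i
      have h4 : |(q.2 i : ℝ)| ≤ R := by exact_mod_cast h3
      simp only [Pi.add_apply, Int.cast_add, add_sub_cancel_left]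
      exact h4.trans (Nat.floor_le (by positivity)))
  have h3 := hτ.harris (hτ.harris_finset I
    (S := fun q => F.farSet w (q.1 * L) L g (L ^ (2 * δ)) q.2)
    (fun q => F.isIncreasing_farSet _ _ _ _ _ _)).2 (hτ.harris_finset J
    (S := fun q => F.nearSet w (q.1.1 * L) L g q.1.2 (q.1.2 + q.2))
    (fun q => F.isIncreasing_nearSet _ _ _ _ _ _)).2
  have hcardI : I.card = k * (2 * M + 1) ^ m := by
    rw [hI, Finset.card_product, Finset.card_range, card_intBox]
  have hcardJ : J.card = k * (2 * M + 1) ^ m * (2 * R + 1) ^ m := by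
    rw [hJ, Finset.card_product, hcardI, card_intBox]
  have hIJ : I.card ≤ J.card := by
    rw [hcardI, hcardJ]
    exact Nat.le_mul_of_pos_right _ (by positivity)
  -- Each near event costs 3 log L. The additional 1 per near event covers the factors 1/2 of the
  -- far events, which are no more numerous.
  have hexp : Real.exp (-((J.card : ℕ) * (1 + 3 * Real.log L))) ≤
      (1 / 2) ^ I.card * (L ^ (-3 : ℝ)) ^ J.card := by
    have e1 : Real.exp (-((J.card : ℕ) * (1 + 3 * Real.log L))) =
        Real.exp (-1) ^ J.card * (L ^ (-3 : ℝ)) ^ J.card := by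
      rw [← mul_pow, Real.rpow_def_of_pos hL0, ← Real.exp_add, ← Real.exp_nat_mul]
      congr 1; ring
    rw [e1]
    gcongr
    have h4 : Real.exp (-1) ≤ 1 / 2 := by
      rw [Real.exp_neg, ← one_div]
      have := Real.add_one_le_exp (1 : ℝ)
      gcongr
      linarith
    calc Real.exp (-1) ^ J.card ≤ (1 / 2) ^ J.card := by gcongr
      _ ≤ (1 / 2) ^ I.card := pow_le_pow_of_le_one (by norm_num) (by norm_num) hIJ
  rw [hcardJ] at hexp
  refine hexp.trans (le_trans ?_ (le_trans h3 (measureReal_mono fun ω hω => ?_)))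
  · rw [← hcardJ]
    exact mul_le_mul h1 h2 (by positivity) measureReal_nonneg
  · intro j hj x y hx1 hx2 hx3 hy1 hy2
    set z : Fin m → ℤ := fun i => ⌊F.v (toEuclid x) i / w⌋ with hz
    set z' : Fin m → ℤ := fun i => ⌊F.v (toEuclid y) i / w⌋ with hz'
    have hxc : x ∈ F.cell w (j * L) z := ⟨hx2, hx3, fun i => rfl⟩
    have hyc : y ∈ F.cell w (j * L + L) z' := ⟨hy1, hy2, fun i => rfl⟩
    have hzM : z ∈ intBox m M := mem_intBox.2 fun i => by
      have h4 : |F.v (toEuclid x) i| ≤ A := (norm_le_pi_norm (F.v (toEuclid x)) i).trans hx1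
      have h5 : |F.v (toEuclid x) i / w| ≤ M := by
        rw [abs_div, abs_of_pos hw0]
        exact (div_le_div_of_nonneg_right h4 hw0.le).trans (Nat.le_ceil _)
      obtain ⟨h6, h7⟩ := abs_le.1 h5
      rw [abs_le]
      constructor
      · exact Int.le_floor.2 (by push_cast; exact h6)
      · have : (⌊F.v (toEuclid x) i / w⌋ : ℝ) ≤ M := (Int.floor_le _).trans h7
        exact_mod_cast this
    have hzI : (j, z) ∈ I := Finset.mem_product.2 ⟨Finset.mem_range.2 hj, hzM⟩
    by_cases hclose : z' - z ∈ intBox m R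
    · have h4 := hω.2 ((j, z), z' - z) (Finset.mem_product.2 ⟨hzI, hclose⟩)
      simp only [add_sub_cancel] at h4
      exact h4 x y ⟨hxc, hyc⟩
    · rw [mem_intBox] at hclose
      push Not at hclose
      obtain ⟨i, hi⟩ := hclose
      rw [Pi.sub_apply] at hi
      refine hω.1 (j, z) hzI x hxc y ⟨hy1, hy2, i, ?_⟩
      -- An index difference above the integer part of L^(2δ) is above L^(2δ) itself, so near and
      -- far events together cover every endpoint.
      have h4 : L ^ (2 * δ) < R + 1 := Nat.lt_floor_add_one _
      have h5 : ((R + 1 : ℤ) : ℝ) ≤ (|z' i - z i| : ℤ) := by exact_mod_cast hi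
      push_cast at h5
      exact h4.trans_le h5

end CurvedFrame

end Chain

/-! ### Assembling the slow event when the fluctuation exponent is positive. -/

section Core

variable {d : ℕ} {Ω : Type*} [MeasurableSpace Ω] {P : Measure Ω} {τ : Edge d → Ω → ℝ}
  {u : EuclideanSpace ℝ (Fin d)} {m : ℕ} {χ : ℝ}

lemma two_mul_rpow_le {n a : ℝ} (hn : 0 ≤ n) (ha1 : a ≤ 1) : (2 * n) ^ a ≤ 2 * n ^ a := by
  rw [Real.mul_rpow (by norm_num) hn]
  gcongr
  conv_rhs => rw [← Real.rpow_one 2]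
  exact Real.rpow_le_rpow_of_exponent_le (by norm_num) ha1

/-- The number of cells needed to cover the tube, times the cost of each. -/
lemma cell_count_le (m : ℕ) {K δ : ℝ} (hK : 1 ≤ K) (hχ0 : 0 ≤ χ) (hχ1 : χ < 1) (hδ : 0 < δ)
    (hδ2 : δ ≤ 1 / 2) : ∃ n₀ : ℝ, 1 ≤ n₀ ∧ ∀ n : ℝ, n₀ ≤ n → ∀ N L A : ℝ, n ≤ N → n / 2 ≤ L →
      L ≤ 2 * n → 1 ≤ L → A = 7 * √K * n ^ (-((1 - χ) / 2 + δ)) * N → cellSide χ δ L ≤ A →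
      ∀ k : ℕ, (k : ℝ) ≤ N / n →
      ((k * (2 * ⌈A / cellSide χ δ L⌉₊ + 1) ^ m * (2 * ⌊L ^ (2 * δ)⌋₊ + 1) ^ m : ℕ) : ℝ) *
        (1 + 3 * Real.log L) + 1 ≤ N ^ (m + 1) * n ^ (-((m + 1) * (1 - 2 * δ))) := by
  set C := (70 * √K) ^ m * 6 ^ m * (2 * (1 + 3 / δ)) with hC
  obtain ⟨n₁, hn₁⟩ := eventually_atTop.1 ((tendsto_rpow_atTop hδ).eventually_ge_atTop (C + 1))
  refine ⟨max n₁ 1, le_max_right _ _, fun n hn N L A hnN hL1 hL2 hL hA hwA k hk => ?_⟩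
  have hn1 : 1 ≤ n := (le_max_right _ _).trans hn
  have hn0 : 0 < n := by linarith
  have hN0 : 0 < N := by linarith
  have hL0 : 0 < L := by linarith
  have hCn := hn₁ n ((le_max_left _ _).trans hn)
  set w := cellSide χ δ L with hw
  have hw0 : 0 < w := by rw [hw, cellSide_eq hL0]; positivity
  have hwn : n ^ ((1 + χ) / 2 - δ) / 2 ≤ w := by
    rw [hw, cellSide_eq hL0]
    have hle1 : (1 - δ) * ((1 + χ) / 2) ≤ 1 := by nlinarith
    calc n ^ ((1 + χ) / 2 - δ) / 2 ≤ n ^ ((1 - δ) * ((1 + χ) / 2)) / 2 := by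
          refine div_le_div_of_nonneg_right (Real.rpow_le_rpow_of_exponent_le hn1 ?_) (by norm_num)
          nlinarith
      _ ≤ (2 * L) ^ ((1 - δ) * ((1 + χ) / 2)) / 2 := by
          refine div_le_div_of_nonneg_right (Real.rpow_le_rpow hn0.le (by linarith) ?_)
            (by norm_num)
          exact mul_nonneg (by linarith) (by linarith)
      _ ≤ L ^ ((1 - δ) * ((1 + χ) / 2)) := by
          have := two_mul_rpow_le hL0.le hle1
          linarith
  have hAw : A / w ≤ 14 * √K * (N / n) := by
    rw [div_le_iff₀ hw0]
    refine le_trans ?_ (mul_le_mul_of_nonneg_left hwn (by positivity))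
    have e1 : n ^ ((1 + χ) / 2 - δ) = n * n ^ (-((1 - χ) / 2 + δ)) := by
      nth_rewrite 2 [← Real.rpow_one n]
      rw [← Real.rpow_add hn0]; congr 1; ring
    rw [hA, e1]
    refine le_of_eq ?_
    field_simp
    ring
  have h1 : ((2 * ⌈A / w⌉₊ + 1 : ℕ) : ℝ) ≤ 70 * √K * (N / n) := by
    have h2 : 1 ≤ A / w := (one_le_div hw0).2 hwA
    have h3 := Nat.ceil_lt_add_one (show 0 ≤ A / w by linarith)
    push_cast
    linarith
  have h2 : ((2 * ⌊L ^ (2 * δ)⌋₊ + 1 : ℕ) : ℝ) ≤ 6 * n ^ (2 * δ) := by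
    have h3 := Nat.floor_le (show 0 ≤ L ^ (2 * δ) by positivity)
    have h4 : L ^ (2 * δ) ≤ 2 * n ^ (2 * δ) :=
      le_trans (by gcongr) (two_mul_rpow_le hn0.le (by linarith))
    have h5 : 1 ≤ L ^ (2 * δ) := Real.one_le_rpow hL (by linarith)
    push_cast
    linarith
  have h3 : 1 + 3 * Real.log L ≤ 2 * (1 + 3 / δ) * n ^ δ := by
    have h4 := Real.log_le_rpow_div hL0.le hδ
    have h5 : L ^ δ ≤ 2 * n ^ δ :=
      le_trans (by gcongr) (two_mul_rpow_le hn0.le (by linarith))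
    have h6 : 1 ≤ n ^ δ := Real.one_le_rpow hn1 hδ.le
    have h7 : L ^ δ / δ ≤ 2 * n ^ δ / δ := by gcongr
    have e : 2 * (1 + 3 / δ) * n ^ δ = 2 * n ^ δ + 3 * (2 * n ^ δ / δ) := by field_simp
    rw [e]
    linarith
  have hlog : 0 ≤ Real.log L := Real.log_nonneg hL
  have h4 : ((k * (2 * ⌈A / w⌉₊ + 1) ^ m * (2 * ⌊L ^ (2 * δ)⌋₊ + 1) ^ m : ℕ) : ℝ) *
      (1 + 3 * Real.log L) ≤
      (N / n) * (70 * √K * (N / n)) ^ m * (6 * n ^ (2 * δ)) ^ m * (2 * (1 + 3 / δ) * n ^ δ) := by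
    rw [Nat.cast_mul, Nat.cast_mul, Nat.cast_pow, Nat.cast_pow]
    gcongr
  have h5 : (N / n) * (70 * √K * (N / n)) ^ m * (6 * n ^ (2 * δ)) ^ m *
      (2 * (1 + 3 / δ) * n ^ δ) = C * ((N / n) ^ (m + 1) * n ^ ((2 * m + 1) * δ)) := by
    have e : n ^ ((2 * m + 1) * δ) = (n ^ (2 * δ)) ^ m * n ^ δ := by
      rw [← Real.rpow_natCast (n ^ (2 * δ)), ← Real.rpow_mul hn0.le, ← Real.rpow_add hn0]
      congr 1; ring
    rw [e, hC]
    ring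
  have h6 : 1 ≤ (N / n) ^ (m + 1) * n ^ ((2 * m + 1) * δ) := by
    refine one_le_mul_of_one_le_of_one_le (one_le_pow₀ ((one_le_div hn0).2 hnN)) ?_
    exact Real.one_le_rpow hn1 (by positivity)
  -- Of the slack n^(2(m+1)δ), the near neighbours of the cells use 2mδ and the logarithm uses δ.
  -- The last n^δ absorbs the constant and the additive 1, which is the price of the typical
  -- endpoint events.
  have h7 : N ^ (m + 1) * n ^ (-((m + 1) * (1 - 2 * δ))) =
      n ^ δ * ((N / n) ^ (m + 1) * n ^ ((2 * m + 1) * δ)) := by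
    have e : n ^ (-((m + 1) * (1 - 2 * δ))) =
        n ^ (-((m + 1 : ℕ) : ℝ)) * n ^ ((2 * m + 1) * δ) * n ^ δ := by
      rw [← Real.rpow_add hn0, ← Real.rpow_add hn0]
      congr 1; push_cast; ring
    rw [e, Real.rpow_neg hn0.le, Real.rpow_natCast, div_pow]
    field_simp
  rw [h7]
  rw [h5] at h4
  have h8 := mul_le_mul_of_nonneg_right hCn (zero_le_one.trans h6)
  linarith

/-- The event that all passages from `x` to points at distance at most `r` are not much faster
than the time constant predicts. -/
def lowerSet (P : Measure Ω) (τ : Edge d → Ω → ℝ) (x : Fin d → ℤ) (r e : ℝ) :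
    Set (Edge d → ℝ) :=
  {η | ∀ z, ‖toEuclid z - toEuclid x‖ ≤ r →
    η ∈ slowSet x z (timeConstant P τ (toEuclid z - toEuclid x) - e)}

lemma isIncreasing_lowerSet (x : Fin d → ℤ) (r e : ℝ) : IsIncreasing (lowerSet P τ x r e) :=
  IsIncreasing.forall_imp fun _ => isIncreasing_slowSet _ _ _

variable [IsProbabilityMeasure P]

lemma FullConcentration.lowerSet_prob (hτ : IsWeights P τ) (hχ : FullConcentration P τ χ)
    {ε B : ℝ} (hε : 0 < ε) (hB : 1 ≤ B) : ∃ N₀ : ℝ, 0 < N₀ ∧ ∀ N : ℝ, N₀ ≤ N →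
      ∀ x : Fin d → ℤ, 3 / 4 ≤ P.real {ω | (fun e => τ e ω) ∈
        lowerSet P τ x (B * N) (N ^ (χ + ε))} := by
  obtain ⟨N₀, hN₀, h⟩ := hχ.uniform_lower hτ hε hB
  refine ⟨N₀, hN₀, fun N hN x => (h N hN x).trans (measureReal_mono fun ω hω z hz => ?_)⟩
  exact hω z (mem_cube hz) hz

set_option maxHeartbeats 1000000 in
/-- The lower bound for the upper tail when the fluctuation exponent is positive, in terms of the
length scale `n`. -/
lemma CurvedFrame.upper_tail (F : CurvedFrame P τ u m) (hτ : IsWeights P τ)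
    (hχ : FullConcentration P τ χ) (hχ0 : 0 < χ) (hm : m + 1 = d) {ε δ : ℝ} (hε : 0 < ε)
    (hεχ : ε < 1 - χ) (hδ : 0 < δ) (hδχ : δ < (1 - χ) / 4) : ∃ n₀ : ℝ, 1 ≤ n₀ ∧
      ∀ n : ℝ, n₀ ≤ n → ∀ N : ℕ, 1 ≤ N → (N : ℝ) ^ (χ - 1 + ε) ≤ n ^ (-(1 - χ + 2 * δ)) →
      Real.exp (-((N : ℝ) ^ d * n ^ (-(d * (1 - 2 * δ))))) ≤
        P.real {ω | N * timeConstant P τ u + n ^ (-(1 - χ + 2 * δ)) * N <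
          T τ 0 ((N : ℝ) • u) ω} := by
  have hK := F.one_le_K
  have hχ1 := hχ.lt_one
  have hμ := F.pos
  set μ₁ := timeConstant P τ u with hμ₁
  obtain ⟨L₀, hL₀, hchain⟩ := F.chain_prob hτ hχ hχ0 hδ hδχ
  obtain ⟨n₁, hn₁, hcount⟩ := cell_count_le (χ := χ) m hK hχ0.le hχ1 hδ (by linarith)
  obtain ⟨N₀, hN₀, hlower⟩ := hχ.lowerSet_prob hτ (half_pos hε) (B := 8 * F.K) (by linarith)
  have hKd : 0 ≤ F.K * d := by positivity
  obtain ⟨n₂, hn₂⟩ := eventually_atTop.1 (((((tendsto_rpow_atTop hδ).eventually_ge_atTop 24).and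
    (eventually_ge_atTop (max (2 * L₀) (max N₀ (max (4 * F.K * (d + 1)) n₁))))).and
    ((tendsto_rpow_neg_atTop (show 0 < 1 - χ + 2 * δ by linarith)).eventually_le_const
      (show 0 < min (μ₁ / 4) 1 by positivity))).and
    (((tendsto_rpow_neg_atTop (show 0 < (1 - χ) / 2 + δ by linarith)).eventually_le_const
      (show 0 < 1 / (7 * √F.K) by positivity)).and
    (((tendsto_rpow_atTop (show 0 < χ + ε by linarith)).eventually_ge_atTop
      (max (F.K * d * μ₁) (2 * (F.K * d)))).and
    (eventually_mul_rpow_le 4 (show χ + ε / 2 < χ + ε by linarith)))))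
  have hn₂' := fun n hn => (hn₂ n hn).2.2
  refine ⟨max n₂ 1, le_max_right _ _, fun n hn N hN1 hNn => ?_⟩
  obtain ⟨⟨⟨hnδ, hn3⟩, hζ1⟩, hζ2, -, -⟩ := hn₂ n ((le_max_left _ _).trans hn)
  have hn1 : 1 ≤ n := (le_max_right _ _).trans hn
  have hn0 : 0 < n := by linarith
  have hnL₀ : 2 * L₀ ≤ n := (le_max_left _ _).trans hn3
  have hnN₀ : N₀ ≤ n := ((le_max_left _ _).trans (le_max_right _ _)).trans hn3
  have hnK : 4 * F.K * (d + 1) ≤ n :=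
    ((le_max_left _ _).trans ((le_max_right _ _).trans (le_max_right _ _))).trans hn3
  have hnn₁ : n₁ ≤ n :=
    ((le_max_right _ _).trans ((le_max_right _ _).trans (le_max_right _ _))).trans hn3
  have hN1' : (1 : ℝ) ≤ N := by exact_mod_cast hN1
  set N' : ℝ := (N : ℝ) with hN'
  have hN0 : 0 < N' := by linarith
  set ζ := n ^ (-(1 - χ + 2 * δ)) with hζ
  have hζ0 : 0 < ζ := by positivity
  have hζμ : ζ ≤ μ₁ / 4 := hζ1.trans (min_le_left _ _)
  -- The lower bound on ζ in terms of `N` is what makes `N` much longer than a slab.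
  have hnN : n ^ (1 + δ) ≤ N' := by
    by_contra hcon
    rw [not_le] at hcon
    have h1 : n ^ (1 - χ + 2 * δ) ≤ N' ^ (1 - χ - ε) := by
      rw [hζ, show χ - 1 + ε = -(1 - χ - ε) by ring, Real.rpow_neg hN0.le, Real.rpow_neg hn0.le]
        at hNn
      exact (inv_le_inv₀ (by positivity) (by positivity)).1 hNn
    have h2 : N' ^ (1 - χ - ε) ≤ n ^ ((1 + δ) * (1 - χ - ε)) := by
      rw [Real.rpow_mul hn0.le]
      exact Real.rpow_le_rpow hN0.le hcon.le (by linarith)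
    have hn24 : 1 < n := by
      by_contra hcon2
      have : n = 1 := le_antisymm (not_lt.1 hcon2) hn1
      rw [this, Real.one_rpow] at hnδ
      linarith
    have h3 : n ^ ((1 + δ) * (1 - χ - ε)) < n ^ (1 - χ + 2 * δ) :=
      Real.rpow_lt_rpow_of_exponent_lt hn24 (by nlinarith)
    linarith
  have hnN2 : 24 * n ≤ N' := by
    rw [add_comm, Real.rpow_add hn0, Real.rpow_one] at hnN
    exact le_trans (by gcongr) hnN
  have hnN' : n ≤ N' := by linarith
  obtain ⟨hNKd, hNε⟩ := hn₂' N' (((le_max_left _ _).trans hn).trans hnN')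
  have hζN : N' ^ (χ + ε) ≤ ζ * N' := by
    have h1 := mul_le_mul_of_nonneg_right hNn hN0.le
    nth_rewrite 2 [← Real.rpow_one N'] at h1
    rw [← Real.rpow_add hN0] at h1
    rwa [show χ - 1 + ε + 1 = χ + ε by ring] at h1
  have hKdμ : F.K * d * μ₁ ≤ ζ * N' := ((le_max_left _ _).trans hNKd).trans hζN
  have hKdζ : 2 * (F.K * d) ≤ ζ * N' := ((le_max_right _ _).trans hNKd).trans hζN
  have herr : 4 * N' ^ (χ + ε / 2) ≤ ζ * N' := hNε.trans hζN
  -- geometry of the tube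
  set A := 7 * √F.K * n ^ (-((1 - χ) / 2 + δ)) * N' with hA
  have hsK : 1 ≤ √F.K := Real.one_le_sqrt.2 hK
  have hAN : A ≤ N' := by
    rw [hA]
    refine mul_le_of_le_one_left hN0.le ?_
    rw [le_div_iff₀ (by positivity)] at hζ2
    linarith
  have hζle : ζ ≤ n ^ (-((1 - χ) / 2 + δ)) :=
    Real.rpow_le_rpow_of_exponent_le hn1 (by linarith)
  have hAK : 2 * (F.K * d) ≤ A := by
    refine hKdζ.trans ?_
    rw [hA]
    gcongr
    refine hζle.trans (le_mul_of_one_le_left (by positivity) (by linarith))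
  have hA2 : A ^ 2 = 49 * F.K * ζ * N' ^ 2 := by
    have e : ζ = (n ^ (-((1 - χ) / 2 + δ))) ^ 2 := by
      rw [hζ, ← Real.rpow_natCast, ← Real.rpow_mul hn0.le]
      congr 1; push_cast; ring
    rw [hA, e, mul_pow, mul_pow, mul_pow, Real.sq_sqrt (by linarith)]
    ring
  -- the slabs
  set k := ⌊N' / n⌋₊ with hk
  have hk1 : (k : ℝ) ≤ N' / n := Nat.floor_le (by positivity)
  have hk2 : N' / n < k + 1 := Nat.lt_floor_add_one _
  have hNn2 : 24 ≤ N' / n := (le_div_iff₀ hn0).2 hnN2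
  have hk0 : (0 : ℝ) < k := by linarith
  have hk3 : N' / n ≤ 2 * k := by linarith
  -- Not exactly `n`: the `k` slabs end just below the height of the endpoint, with the rounding
  -- error `F.K * d` already subtracted.
  set L := (N' - F.K * d) / k with hL
  have hkL : k * L = N' - F.K * d := by rw [hL]; field_simp
  have hdK : F.K * d ≤ n / 4 := by linarith
  have hL1 : n / 2 ≤ L := by
    rw [hL, le_div_iff₀ hk0]
    rw [le_div_iff₀ hn0] at hk1
    linarith
  have hL2 : L ≤ 2 * n := by
    rw [hL, div_le_iff₀ hk0]
    rw [div_le_iff₀ hn0] at hk3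
    linarith
  have hLL₀ : L₀ ≤ L := by linarith
  have hL01 : 1 ≤ L := hL₀.trans hLL₀
  have hL0 : 0 < L := by linarith
  have hKL : F.K < L := by
    have : 0 ≤ F.K * d := hKd
    linarith
  have hwA : cellSide χ δ L ≤ A := by
    rw [cellSide_eq hL0]
    calc L ^ ((1 - δ) * ((1 + χ) / 2)) ≤ L ^ ((1 + χ) / 2) :=
          Real.rpow_le_rpow_of_exponent_le hL01 (by nlinarith)
      _ ≤ (2 * n) ^ ((1 + χ) / 2) := by gcongr
      _ ≤ 2 * n ^ ((1 + χ) / 2) := two_mul_rpow_le hn0.le (by linarith)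
      _ = 2 * (n ^ (-((1 - χ) / 2 + δ)) * n ^ (1 + δ)) := by
          rw [← Real.rpow_add hn0]; congr 2; ring
      _ ≤ 7 * √F.K * (n ^ (-((1 - χ) / 2 + δ)) * N') := by
          gcongr
          linarith
      _ = A := by rw [hA]; ring
  set g := L * μ₁ + L ^ (χ - δ) with hg
  have hkg : N' * μ₁ + 2 * (ζ * N') ≤ k * g := by
    have e1 : k * g = (N' - F.K * d) * μ₁ + (N' - F.K * d) * L ^ (χ - δ - 1) := by
      rw [hg, mul_add, ← mul_assoc, hkL, Real.rpow_sub_one hL0.ne', ← hkL]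
      field_simp
    have h1 : (2 * n) ^ (-(1 - χ + δ)) ≤ L ^ (χ - δ - 1) := by
      rw [show χ - δ - 1 = -(1 - χ + δ) by ring]
      exact Real.rpow_le_rpow_of_nonpos hL0 hL2 (by linarith)
    -- Here n^δ ≥ 24 is used: the factor 1/4 lost in replacing `L` by 2n leaves 6ζ. Over a length of
    -- at least N/2 this is 3ζN, of which one ζN pays for rounding.
    have h2 : 6 * ζ ≤ (2 * n) ^ (-(1 - χ + δ)) := by
      rw [Real.mul_rpow (by norm_num) hn0.le]
      have h3 : (1 / 4 : ℝ) ≤ 2 ^ (-(1 - χ + δ)) := by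
        have : (2 : ℝ) ^ (-2 : ℝ) ≤ 2 ^ (-(1 - χ + δ)) :=
          Real.rpow_le_rpow_of_exponent_le (by norm_num) (by linarith)
        refine le_trans (le_of_eq ?_) this
        rw [Real.rpow_neg (by norm_num), Real.rpow_two]; norm_num
      have e2 : n ^ (-(1 - χ + δ)) = ζ * n ^ δ := by
        rw [hζ, ← Real.rpow_add hn0]; congr 1; ring
      rw [e2]
      calc 6 * ζ = 1 / 4 * (ζ * 24) := by ring
        _ ≤ 2 ^ (-(1 - χ + δ)) * (ζ * n ^ δ) := by gcongr
    have h3 : N' / 2 * (6 * ζ) ≤ (N' - F.K * d) * L ^ (χ - δ - 1) := by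
      refine mul_le_mul (by linarith) (h2.trans h1) (by positivity) (by linarith)
    rw [e1]
    linarith
  -- the event
  set y₀ := floorPt (N' • u) with hy₀
  have hY1 : |F.s (toEuclid y₀) - N'| ≤ F.K * d := by
    have := F.abs_s_floorPt_sub_le (N' • u)
    rwa [map_smul, F.s_u, smul_eq_mul, mul_one] at this
  have hY2 : ‖F.v (toEuclid y₀)‖ ≤ F.K * d := by
    have := F.norm_v_floorPt_sub_le (N' • u)
    rwa [map_smul, F.v_u, smul_zero, sub_zero] at this
  set S := F.chainSet A L g k ∩ (lowerSet P τ 0 (8 * F.K * N') (N' ^ (χ + ε / 2)) ∩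
    lowerSet P τ y₀ (8 * F.K * N') (N' ^ (χ + ε / 2))) with hS
  have hprob : Real.exp (-(N' ^ d * n ^ (-(d * (1 - 2 * δ))))) ≤
      P.real {ω | (fun e => τ e ω) ∈ S} := by
    have hl1 := hlower N' (by linarith) 0
    have hl2 := hlower N' (by linarith) y₀
    have h1 := hτ.harris (isIncreasing_lowerSet (P := P) (τ := τ) 0 (8 * F.K * N') (N' ^ (χ + ε / 2)))
      (isIncreasing_lowerSet (P := P) (τ := τ) y₀ (8 * F.K * N') (N' ^ (χ + ε / 2)))
    have h2 := hτ.harris (F.isIncreasing_chainSet A L g k)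
      ((isIncreasing_lowerSet (P := P) (τ := τ) 0 (8 * F.K * N') (N' ^ (χ + ε / 2))).inter
      (isIncreasing_lowerSet (P := P) (τ := τ) y₀ (8 * F.K * N') (N' ^ (χ + ε / 2))))
    refine le_trans ?_ h2
    have h3 := hchain L hLL₀ A k
    have h4 := hcount n hnn₁ N' L A hnN' hL1 hL2 hL01 hA hwA k hk1
    have h5 : Real.exp (-1) ≤ P.real {ω | (fun e => τ e ω) ∈
        lowerSet P τ 0 (8 * F.K * N') (N' ^ (χ + ε / 2)) ∩
        lowerSet P τ y₀ (8 * F.K * N') (N' ^ (χ + ε / 2))} := by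
      refine le_trans ?_ ((mul_le_mul hl1 hl2 (by norm_num) measureReal_nonneg).trans h1)
      rw [Real.exp_neg, inv_le_comm₀ (Real.exp_pos _) (by norm_num)]
      have := Real.add_one_le_exp (1 : ℝ)
      norm_num at this ⊢
      linarith
    refine le_trans ?_ (mul_le_mul h3 h5 (Real.exp_nonneg _) measureReal_nonneg)
    rw [← Real.exp_add, Real.exp_le_exp]
    have e : N' ^ d * n ^ (-(d * (1 - 2 * δ))) =
        N' ^ (m + 1) * n ^ (-((m + 1) * (1 - 2 * δ))) := by
      rw [← hm]; push_cast; rfl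
    rw [e]
    linarith
  refine hprob.trans ?_
  rw [measureReal_def, measureReal_def]
  refine ENNReal.toReal_mono (measure_ne_top P _) (measure_mono_ae ?_)
  filter_upwards [hτ.ae_nonneg] with ω h0 hω
  change N' * μ₁ + ζ * N' < T τ 0 (N' • u) ω
  rw [T_zero_left, ← hy₀]
  have hζN0 : 0 < ζ * N' := by positivity
  -- Path bounds are nonstrict, so an excess 2ζN is proved to get the strict inequality for the
  -- infimum.
  refine lt_of_lt_of_le (show N' * μ₁ + ζ * N' < N' * μ₁ + 2 * (ζ * N') by linarith)
    (le_latticeTime fun γ => ?_)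
  set D : Set (Fin d → ℤ) := {x | ‖F.v (toEuclid x)‖ ≤ A ∧ -N' ≤ F.s (toEuclid x) ∧
    F.s (toEuclid x) ≤ 2 * N'} with hD
  by_cases hγ : ∀ a ∈ γ.support, a ∈ D
  · refine hkg.trans ?_
    refine F.chain_le_pathTime h0 hKL hω.1 k 0 rfl γ (fun a ha => (hγ a ha).1) ?_ ?_ ?_
    · simp [toEuclid_zero]
    · simp only [toEuclid_zero, map_zero, Nat.cast_zero, zero_mul, zero_add]
      linarith
    · rw [hkL]
      linarith [(abs_le.1 hY1).1]
  · push Not at hγ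
    obtain ⟨a, ha, haD⟩ := hγ
    have h0D : (0 : Fin d → ℤ) ∈ D := by
      simp only [hD, Set.mem_ofPred_eq, toEuclid_zero, map_zero, norm_zero]
      exact ⟨by linarith, by linarith, by linarith⟩
    obtain ⟨p, z, γ₁, γ₂, hpz, hpD, hzD, hsum, -⟩ := exists_exit D (fun e => τ e ω) γ h0D ha haD
    obtain ⟨hz1, hz2, hex⟩ := F.exit_excess hτ.timeConstant_nonneg (N := N') (A := A)
      (by linarith) hAK hAN hY1 hY2 hpz hpD.1 hpD.2.1 hpD.2.2 hzD
    have h1 := hω.2.1 z (by rw [toEuclid_zero, sub_zero]; exact hz1) γ₁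
    have h2 := hω.2.2 z hz2
    rw [slowSet_comm] at h2
    rw [← neg_sub (toEuclid y₀) (toEuclid z), hτ.timeConstant_neg] at h2
    have h2 := h2 γ₂
    rw [toEuclid_zero, sub_zero] at h1
    have h3 : 4 * (ζ * N') ≤ min (A ^ 2 / (12 * N' * F.K)) (N' * μ₁) := by
      refine le_min ?_ ?_
      · rw [le_div_iff₀ (by positivity), hA2]
        have : 0 ≤ F.K * ζ * N' ^ 2 := by positivity
        linarith
      · have := mul_le_mul_of_nonneg_right hζμ hN0.le
        linarith
    rw [← hsum]
    linarith

end Core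

/-! ### Heavy balls: the case without fluctuations and the linear excess. -/

section UpperTail

variable {d : ℕ} {Ω : Type*} [MeasurableSpace Ω] {P : Measure Ω} {τ : Edge d → Ω → ℝ}
  {u : EuclideanSpace ℝ (Fin d)} {χ : ℝ}

/-- All edges with an endpoint in the ball of radius `R` about the origin have weight at least
`b`. -/
def heavySet (d : ℕ) (R b : ℝ) : Set (Edge d → ℝ) :=
  {w | ∀ x y (h : (lattice d).Adj x y), ‖toEuclid x‖ ≤ R → b ≤ w ⟨s(x, y), h⟩}

lemma isIncreasing_heavySet (R b : ℝ) : IsIncreasing (heavySet d R b) := by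
  have e : heavySet d R b = {w | ∀ q : {q : (Fin d → ℤ) × (Fin d → ℤ) // (lattice d).Adj q.1 q.2},
      ‖toEuclid q.1.1‖ ≤ R → w ∈ {w : Edge d → ℝ | b ≤ w ⟨s(q.1.1, q.1.2), q.2⟩}} := by
    ext w
    exact ⟨fun h q hq => h _ _ q.2 hq, fun h x y hxy hx => h ⟨(x, y), hxy⟩ hx⟩
  rw [e]
  exact IsIncreasing.forall_imp fun q => isIncreasing_le_weight _ b

/-- There are no loops, so an edge cannot have both ends equal to the exceptional last vertex; every
edge touches the ball. -/
lemma mul_length_le_of_mem_heavySet {R b : ℝ} {w : Edge d → ℝ} (hw : w ∈ heavySet d R b)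
    {x z : Fin d → ℤ} (γ : (lattice d).Walk x z)
    (h : ∀ a ∈ γ.support, a = z ∨ ‖toEuclid a‖ ≤ R) : b * γ.length ≤ pathTime w γ := by
  refine le_pathTime γ fun ⟨e, he⟩ heγ => ?_
  induction e with | _ p q
  have hp := γ.fst_mem_support_of_mem_edges heγ
  have hq := γ.snd_mem_support_of_mem_edges heγ
  have hadj : (lattice d).Adj p q := he
  rcases h p hp with rfl | hp
  · rcases h q hq with rfl | hq
    · exact absurd hadj (SimpleGraph.irrefl _)
    · have h1 := hw q p hadj.symm hq
      rwa [show (⟨s(q, p), hadj.symm⟩ : Edge d) = ⟨s(p, q), he⟩ from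
        Subtype.ext Sym2.eq_swap] at h1
  · exact hw p q hadj hp

/-- A path that stays in the ball has at least |y|₁ heavy edges; one that leaves has at least `R` of
them, the ℓ¹ norm being at least the Euclidean one. -/
lemma mul_min_le_of_mem_heavySet {R b : ℝ} (hb : 0 ≤ b) (hR : 0 ≤ R) {w : Edge d → ℝ}
    (h0 : ∀ e, 0 ≤ w e) (hw : w ∈ heavySet d R b) {y : Fin d → ℤ}
    (γ : (lattice d).Walk 0 y) : b * min R (l1 y) ≤ pathTime w γ := by
  set D : Set (Fin d → ℤ) := {x | ‖toEuclid x‖ ≤ R} with hD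
  by_cases hγ : ∀ a ∈ γ.support, a ∈ D
  · refine le_trans ?_ (mul_length_le_of_mem_heavySet hw γ fun a ha => Or.inr (hγ a ha))
    have h1 := l1_sub_le_length γ
    rw [sub_zero] at h1
    gcongr
    exact (min_le_right _ _).trans h1
  · push Not at hγ
    obtain ⟨a, ha, haD⟩ := hγ
    have h0D : (0 : Fin d → ℤ) ∈ D := by simpa [hD, toEuclid_zero] using hR
    obtain ⟨p, z, γ₁, γ₂, -, -, hzD, hsum, hin⟩ := exists_exit D w γ h0D ha haD
    have h1 := mul_length_le_of_mem_heavySet hw γ₁ hin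
    have h2 := l1_sub_le_length γ₁
    rw [sub_zero, ← l1E_toEuclid] at h2
    have h3 : R ≤ ‖toEuclid z‖ := (not_le.1 hzD).le
    have h4 : b * min R (l1 y) ≤ b * γ₁.length := by
      gcongr
      exact (min_le_left _ _).trans (h3.trans ((norm_le_l1E _).trans h2))
    linarith [pathTime_nonneg h0 γ₂]

variable [IsProbabilityMeasure P]

lemma IsWeights.exists_heavySet_prob (hτ : IsWeights P τ) {b : ℝ}
    (hb : ∀ e, 0 < P {ω | b ≤ τ e ω}) : ∃ c : ℝ, 0 < c ∧ ∀ R : ℝ, 1 ≤ R →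
      Real.exp (-(c * R ^ d)) ≤ P.real {ω | (fun e => τ e ω) ∈ heavySet d R b} := by
  obtain ⟨p, hp0, hp1, hp⟩ : ∃ p : ℝ, 0 < p ∧ p ≤ 1 ∧ ∀ e, p ≤ P.real {ω | b ≤ τ e ω} := by
    rcases isEmpty_or_nonempty (Edge d) with h | ⟨⟨e₀⟩⟩
    · exact ⟨1, one_pos, le_rfl, fun e => h.elim e⟩
    · refine ⟨P.real {ω | b ≤ τ e₀ ω}, ENNReal.toReal_pos (hb e₀).ne' (measure_ne_top _ _),
        measureReal_le_one, fun e => ?_⟩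
      have := (hτ.identDistrib e₀ e).measure_mem_eq (measurableSet_Ici (a := b))
      exact (congrArg ENNReal.toReal this).le
  have hlog : 0 ≤ -Real.log p := neg_nonneg.2 (Real.log_nonpos hp0.le hp1)
  refine ⟨9 ^ d * -Real.log p + 1, by positivity, fun R hR => ?_⟩
  -- Edges are indexed by an endpoint and a displacement; pairs that are not adjacent impose no
  -- condition.
  set S : (Fin d → ℤ) × (Fin d → ℤ) → Set (Edge d → ℝ) := fun q =>
    {w | ∀ h : (lattice d).Adj q.1 (q.1 + q.2), b ≤ w ⟨s(q.1, q.1 + q.2), h⟩} with hS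
  have hinc : ∀ q, IsIncreasing (S q) := fun q => by
    by_cases h : (lattice d).Adj q.1 (q.1 + q.2)
    · simpa only [hS, h, forall_true_left] using isIncreasing_le_weight ⟨_, h⟩ b
    · rw [show S q = Set.univ from Set.eq_univ_of_forall fun w h' => absurd h' h]
      exact isCylinderUpper_univ.isIncreasing
  have h1 := hτ.pow_le_harris (cube 0 R ×ˢ cube 0 1) hinc hp0.le fun q _ => by
    by_cases h : (lattice d).Adj q.1 (q.1 + q.2)
    · refine (hp ⟨_, h⟩).trans (measureReal_mono fun ω hω h' => hω)
    · have : {ω | (fun e => τ e ω) ∈ S q} = Set.univ :=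
        Set.eq_univ_of_forall fun ω h' => absurd h' h
      rw [this, probReal_univ]
      exact hp1
  refine le_trans ?_ (h1.trans (measureReal_mono fun ω hω x y h hx => ?_))
  · rw [← Real.exp_log hp0, ← Real.exp_nat_mul, Real.exp_le_exp, Real.exp_log hp0]
    have h2 : ((cube (0 : Fin d → ℤ) R ×ˢ cube (0 : Fin d → ℤ) 1).card : ℝ) ≤ 9 ^ d * R ^ d := by
      rw [Finset.card_product, Nat.cast_mul]
      calc _ ≤ (2 * R + 1) ^ d * (2 * 1 + 1) ^ d :=
            mul_le_mul (card_cube_le _ (by linarith)) (card_cube_le _ zero_le_one)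
              (by positivity) (by positivity)
        _ ≤ (3 * R) ^ d * 3 ^ d := by
            gcongr
            · linarith
            · norm_num
        _ = 9 ^ d * R ^ d := by rw [mul_pow, mul_right_comm, ← mul_pow]; norm_num
    have h3 := mul_le_mul_of_nonneg_right h2 hlog
    have h4 : 0 ≤ R ^ d := by positivity
    linarith
  · have h2 := hω (x, y - x) (Finset.mem_product.2 ⟨mem_cube ?_, mem_cube ?_⟩)
    · have h3 : x + (y - x) = y := by abel
      have h4 := h2 (by simpa only [h3] using h)
      simpa only [h3] using h4
    · rwa [toEuclid_zero, sub_zero]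
    · rw [toEuclid_zero, sub_zero, toEuclid_sub]
      exact norm_toEuclid_le_of_adj h

/-- A nondegenerate weight exceeds its mean by a fixed amount with positive probability. -/
lemma IsWeights.exists_gt_mean (hτ : IsWeights P τ) (e₀ : Edge d) :
    ∃ b : ℝ, ∫ ω, τ e₀ ω ∂P < b ∧ ∀ e, 0 < P {ω | b ≤ τ e ω} := by
  obtain ⟨C, hC, hb⟩ := hτ.exists_bound
  have hint : Integrable (τ e₀) P :=
    Integrable.of_bound (hτ.measurable e₀).aestronglyMeasurable C (by
      filter_upwards [hb, hτ.ae_nonneg] with ω h h'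
      rw [Real.norm_of_nonneg (h' e₀)]; exact h e₀)
  set m := ∫ ω, τ e₀ ω ∂P with hm
  -- Otherwise the weight is almost surely at most its mean, hence almost surely equal to it,
  -- against nondegeneracy.
  by_contra! hcon
  refine hτ.nondegenerate e₀ ⟨m, ?_⟩
  have hzero : ∀ n : ℕ, P {ω | m + 1 / ((n : ℝ) + 1) ≤ τ e₀ ω} = 0 := fun n => by
    obtain ⟨e, he⟩ := hcon (m + 1 / ((n : ℝ) + 1)) (by linarith [Nat.one_div_pos_of_nat (α := ℝ) (n := n)])
    have := (hτ.identDistrib e₀ e).measure_mem_eq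
      (measurableSet_Ici (a := m + 1 / ((n : ℝ) + 1)))
    exact this.trans (le_antisymm he zero_le)
  have hle : ∀ᵐ ω ∂P, τ e₀ ω ≤ m := by
    filter_upwards [ae_all_iff.2 fun n => (measure_eq_zero_iff_ae_notMem.1 (hzero n))] with ω hω
    by_contra hlt
    obtain ⟨n, hn⟩ := exists_nat_one_div_lt (sub_pos.2 (not_le.1 hlt))
    exact hω n (show _ ≤ _ by linarith)
  have h1 : ∫ ω, (m - τ e₀ ω) ∂P = 0 := by
    rw [integral_sub (integrable_const _) hint]
    simp [hm]
  have h2 := (integral_eq_zero_iff_of_nonneg_ae (by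
    filter_upwards [hle] with ω h using sub_nonneg.2 h) ((integrable_const _).sub hint)).1 h1
  filter_upwards [h2] with ω h
  exact (sub_eq_zero.1 h).symm

/-- The lower bound for the upper tail obtained by making a ball about the origin slow. -/
lemma FullConcentration.ball_upper_tail (hτ : IsWeights P τ) (hχ : FullConcentration P τ χ)
    (hd : 1 ≤ d) (hu : ‖u‖ = 1) {ε : ℝ} (hε : 0 < ε) : ∃ c > 0, ∃ κ > 0, ∃ N₀ : ℝ, 1 ≤ N₀ ∧
      ∀ N : ℕ, N₀ ≤ N → ∀ ζ : ℝ, (N : ℝ) ^ (χ + ε) ≤ ζ * N → ζ ≤ κ →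
      Real.exp (-(c * (ζ * N) ^ d)) ≤
        P.real {ω | N * timeConstant P τ u + ζ * N < T τ 0 ((N : ℝ) • u) ω} := by
  obtain ⟨e₀⟩ : Nonempty (Edge d) := by
    refine ⟨⟨s(0, Pi.single ⟨0, hd⟩ 1), ?_⟩⟩
    change ∑ i, |(0 : Fin d → ℤ) i - Pi.single (M := fun _ => ℤ) ⟨0, hd⟩ 1 i| = 1
    rw [Finset.sum_eq_single ⟨0, hd⟩] <;> simp +contextual
  have hχ0 := hχ.nonneg
  obtain ⟨b, hmb, hb⟩ := hτ.exists_gt_mean e₀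
  set m := ∫ ω, τ e₀ ω ∂P with hm
  have hm0 : 0 ≤ m := integral_nonneg_of_ae (hτ.nonneg e₀)
  obtain ⟨c, hc, hheavy⟩ := hτ.exists_heavySet_prob hb
  obtain ⟨N₁, hN₁, hlower⟩ := hχ.lowerSet_prob hτ (half_pos hε) (B := d + 4)
    (by linarith [Nat.cast_nonneg (α := ℝ) d])
  obtain ⟨C, hC, hCμ⟩ := hτ.exists_timeConstant_le
  have hbm : 0 < b - m := sub_pos.2 hmb
  -- Leaving the ball costs at least `b` per unit of ℓ¹ length, while the time constant charges at
  -- most the mean `m`. The gain over radius `a ζ N` is 3ζN, of which one ζN covers rounding and the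
  -- fluctuations of the remaining path.
  set a := 3 / (b - m) with ha
  have ha0 : 0 < a := by positivity
  have hab : (b - m) * a = 3 := by rw [ha]; field_simp
  obtain ⟨N₂, hN₂⟩ := eventually_atTop.1 (((tendsto_rpow_atTop
    (show 0 < χ + ε by linarith)).eventually_ge_atTop (max (2 * (C * d)) (1 / a))).and
    ((eventually_mul_rpow_le 2 (show χ + ε / 2 < χ + ε by linarith)).and
    (eventually_ge_atTop (max N₁ (2 * d + 1)))))
  refine ⟨(c + 1) * a ^ d, by positivity, 1 / (2 * a), by positivity, max N₂ 1, le_max_right _ _,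
    fun N hN ζ hζ hζκ => ?_⟩
  obtain ⟨h1, h2, h3⟩ := hN₂ N ((le_max_left _ _).trans hN)
  have hN1 : (1 : ℝ) ≤ N := (le_max_right _ _).trans hN
  set N' : ℝ := (N : ℝ) with hN'
  have hN0 : 0 < N' := by linarith
  set μ₁ := timeConstant P τ u with hμ₁
  have hCd : 2 * (C * d) ≤ ζ * N' := ((le_max_left _ _).trans h1).trans hζ
  have hNd : 2 * (d : ℝ) + 1 ≤ N' := (le_max_right _ _).trans h3
  set R := a * (ζ * N') with hR
  have hR1 : 1 ≤ R := by
    have := ((le_max_right _ _).trans h1).trans hζ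
    rw [div_le_iff₀ ha0] at this
    linarith
  have hRN : R ≤ N' / 2 := by
    rw [le_div_iff₀ (by positivity)] at hζκ
    have := mul_le_mul_of_nonneg_right hζκ hN0.le
    rw [hR]
    linarith
  have hζN0 : 0 < ζ * N' := lt_of_lt_of_le (by positivity) hζ
  set y₀ := floorPt (N' • u) with hy₀
  have hY := norm_toEuclid_floorPt_sub_le (N' • u)
  rw [← hy₀] at hY
  have hY1 : ‖N' • u‖ = N' := by rw [norm_smul, hu, mul_one, Real.norm_of_nonneg hN0.le]
  set S := heavySet d R b ∩ lowerSet P τ y₀ ((d + 4) * N') (N' ^ (χ + ε / 2)) with hS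
  have hprob : Real.exp (-((c + 1) * a ^ d * (ζ * N') ^ d)) ≤
      P.real {ω | (fun e => τ e ω) ∈ S} := by
    refine le_trans ?_ (hτ.harris (isIncreasing_heavySet R b) (isIncreasing_lowerSet _ _ _))
    have h5 : Real.exp (-1) ≤ 3 / 4 := by
      rw [Real.exp_neg, inv_le_comm₀ (Real.exp_pos _) (by norm_num)]
      have := Real.add_one_le_exp (1 : ℝ)
      norm_num at this ⊢
      linarith
    refine le_trans ?_ (mul_le_mul (hheavy R hR1) (h5.trans (hlower N'
      ((le_max_left _ _).trans h3) y₀)) (Real.exp_nonneg _) measureReal_nonneg)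
    rw [← Real.exp_add, Real.exp_le_exp, mul_assoc, ← mul_pow, ← hR]
    have := one_le_pow₀ hR1 (n := d)
    linarith
  refine hprob.trans ?_
  rw [measureReal_def, measureReal_def]
  refine ENNReal.toReal_mono (measure_ne_top P _) (measure_mono_ae ?_)
  filter_upwards [hτ.ae_nonneg] with ω h0 hω
  change N' * μ₁ + ζ * N' < T τ 0 (N' • u) ω
  rw [T_zero_left, ← hy₀]
  refine lt_of_lt_of_le (show N' * μ₁ + ζ * N' < N' * μ₁ + 2 * (ζ * N') by linarith)
    (le_latticeTime fun γ => ?_)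
  set D : Set (Fin d → ℤ) := {x | ‖toEuclid x‖ ≤ R} with hD
  have h0D : (0 : Fin d → ℤ) ∈ D := by
    simp only [hD, Set.mem_ofPred_eq, toEuclid_zero, norm_zero]; linarith
  have hyD : y₀ ∉ D := by
    simp only [hD, Set.mem_ofPred_eq, not_le]
    have := norm_sub_norm_le (N' • u) (toEuclid y₀)
    rw [norm_sub_rev] at this
    linarith
  obtain ⟨p, z, γ₁, γ₂, hpz, hpD, hzD, hsum, hin⟩ :=
    exists_exit D (fun e => τ e ω) γ h0D γ.end_mem_support hyD
  have h4 := mul_length_le_of_mem_heavySet hω.1 γ₁ hin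
  have h5 := l1_sub_le_length γ₁
  rw [sub_zero] at h5
  have h6 : R ≤ l1 z := (not_le.1 hzD).le.trans (norm_le_l1E (toEuclid z))
  have h7 : ‖toEuclid z - toEuclid y₀‖ ≤ (d + 4) * N' := by
    have e : toEuclid z - toEuclid y₀ = (toEuclid z - toEuclid p) + toEuclid p -
      (toEuclid y₀ - N' • u) - N' • u := by abel
    rw [e]
    have g1 := norm_sub_le ((toEuclid z - toEuclid p) + toEuclid p - (toEuclid y₀ - N' • u))
      (N' • u)
    have g2 := norm_sub_le ((toEuclid z - toEuclid p) + toEuclid p) (toEuclid y₀ - N' • u)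
    have g3 := norm_add_le (toEuclid z - toEuclid p) (toEuclid p)
    have g4 := norm_toEuclid_le_of_adj hpz
    have g5 : ‖toEuclid p‖ ≤ R := hpD
    have g6 : 0 ≤ (d : ℝ) * N' := by positivity
    linarith
  have h8 := hω.2 z h7
  rw [slowSet_comm] at h8
  have h8 := h8 γ₂
  have h9 : N' * μ₁ ≤ timeConstant P τ (toEuclid z - toEuclid y₀) +
      timeConstant P τ (toEuclid z) + C * d := by
    have g1 := hτ.timeConstant_smul N' u
    rw [abs_of_pos hN0] at g1
    rw [hμ₁, ← g1]
    have g2 := hτ.timeConstant_add_le (-(toEuclid z - toEuclid y₀))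
      (toEuclid z + (N' • u - toEuclid y₀))
    rw [show -(toEuclid z - toEuclid y₀) + (toEuclid z + (N' • u - toEuclid y₀)) = N' • u by abel,
      hτ.timeConstant_neg] at g2
    have g3 := hτ.timeConstant_add_le (toEuclid z) (N' • u - toEuclid y₀)
    have g4 := hCμ (N' • u - toEuclid y₀)
    rw [norm_sub_rev] at g4
    have g5 := mul_le_mul_of_nonneg_left hY hC.le
    linarith
  have h10 := hτ.timeConstant_le_of_meanTime_le hm0 (hτ.meanTime_le_mean e₀) (toEuclid z)
  rw [l1E_toEuclid] at h10
  have h11 : b * l1 z ≤ b * γ₁.length := by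
    have : 0 ≤ b := by linarith
    gcongr
  have h12 : 3 * (ζ * N') ≤ (b - m) * l1 z := by
    have := mul_le_mul_of_nonneg_left h6 hbm.le
    rw [hR, ← mul_assoc, hab] at this
    exact this
  rw [← hsum]
  linarith

/-- If the weights can be so large that the best path costs more than its time constant plus one
per unit length, a linear excess has probability at least `exp (-c N ^ d)`. -/
lemma IsWeights.linear_upper_tail (hτ : IsWeights P τ) (hu : ‖u‖ = 1) {b : ℝ}
    (hb : ∀ e, 0 < P {ω | b ≤ τ e ω}) (hbu : timeConstant P τ u + 1 < b * l1E u) :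
    ∃ c > 0, ∀ᶠ N : ℕ in atTop, Real.exp (-(c * (N : ℝ) ^ d)) ≤
      P.real {ω | N * timeConstant P τ u + N < T τ 0 ((N : ℝ) • u) ω} := by
  obtain ⟨c, hc, hheavy⟩ := hτ.exists_heavySet_prob hb
  have hμ := hτ.timeConstant_nonneg u
  have hl : 1 ≤ l1E u := hu ▸ norm_le_l1E u
  have hb0 : 0 < b := by
    by_contra hcon
    have := mul_nonpos_of_nonpos_of_nonneg (not_lt.1 hcon) (zero_le_one.trans hl)
    linarith
  refine ⟨c * l1E u ^ d, by positivity, ?_⟩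
  filter_upwards [eventually_gt_atTop 0, tendsto_natCast_atTop_atTop.eventually_gt_atTop
    (b * d / (b * l1E u - (timeConstant P τ u + 1)))] with N hN hN2
  have hN1 : (1 : ℝ) ≤ N := by exact_mod_cast hN
  rw [div_lt_iff₀ (sub_pos.2 hbu)] at hN2
  have hR : 1 ≤ N * l1E u := one_le_mul_of_one_le_of_one_le hN1 hl
  have h1 := hheavy (N * l1E u) hR
  rw [mul_pow, mul_comm ((N : ℝ) ^ d), ← mul_assoc] at h1
  refine h1.trans ?_
  rw [measureReal_def, measureReal_def]
  refine ENNReal.toReal_mono (measure_ne_top P _) (measure_mono_ae ?_)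
  filter_upwards [hτ.ae_nonneg] with ω h0 hω
  change _ < T τ 0 ((N : ℝ) • u) ω
  rw [T_zero_left]
  refine lt_of_lt_of_le ?_ (le_latticeTime fun γ =>
    mul_min_le_of_mem_heavySet hb0.le (by linarith) h0 hω γ)
  have h2 : N * l1E u - d ≤ min (N * l1E u) (l1 (floorPt ((N : ℝ) • u))) := by
    refine le_min (by linarith [Nat.cast_nonneg (α := ℝ) d]) ?_
    have h3 := l1E_smul (N : ℝ) u
    rw [abs_of_nonneg (by linarith)] at h3
    rw [← h3, sub_le_iff_le_add, ← l1E_toEuclid]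
    simp only [l1E, toEuclid, floorPt]
    have : ∑ _i : Fin d, (1 : ℝ) = d := by simp
    rw [← this, ← Finset.sum_add_distrib]
    refine Finset.sum_le_sum fun i _ => ?_
    have h4 := Int.floor_le (((N : ℝ) • u) i)
    have h5 := Int.lt_floor_add_one (((N : ℝ) • u) i)
    have h6 := abs_sub_abs_le_abs_sub (((N : ℝ) • u) i) (⌊((N : ℝ) • u) i⌋ : ℝ)
    have h7 : |((N : ℝ) • u) i - (⌊((N : ℝ) • u) i⌋ : ℝ)| ≤ 1 :=
      abs_le.2 ⟨by linarith, by linarith⟩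
    linarith
  refine lt_of_lt_of_le ?_ (mul_le_mul_of_nonneg_left h2 hb0.le)
  linarith

end UpperTail

/-! ### The bound uniform in the excess and the distance. -/

section UniformTail

variable {d : ℕ} {Ω : Type*} [MeasurableSpace Ω] {P : Measure Ω} [IsProbabilityMeasure P]
  {τ : Edge d → Ω → ℝ} {u : EuclideanSpace ℝ (Fin d)} {χ : ℝ}

/-- The lower bound for the upper tail, uniformly in the excess `ζ` per unit length and the
distance. -/
lemma FullConcentration.exp_neg_le_upper_tail (hτ : IsWeights P τ) (hχ : FullConcentration P τ χ)
    (hd : 2 ≤ d) (hu : ‖u‖ = 1) {W : Submodule ℝ (EuclideanSpace ℝ (Fin d))}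
    (hW : IsTangentHyperplane P τ u W) (hfin : FiniteCurvature P τ u W)
    (hpos : PositiveCurvature P τ u W) {ε : ℝ} (hε : 0 < ε) (hεχ : ε < 1 - χ) :
    ∃ ζ₀ > 0, ∀ ζ : ℝ, 0 < ζ → ζ < ζ₀ → ∀ N : ℕ, 1 ≤ N → (N : ℝ) ^ (χ - 1 + ε) ≤ ζ →
      Real.exp (-((N : ℝ) ^ d * ζ ^ ((1 - ε) * (d / (1 - χ))))) ≤
        P.real {ω | N * timeConstant P τ u + ζ * N < T τ 0 ((N : ℝ) • u) ω} := by
  have hχ0 := hχ.nonneg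
  have hχ1 := hχ.lt_one
  have hd0 : (0 : ℝ) < d := by exact_mod_cast (by omega : 0 < d)
  rcases hχ0.eq_or_lt with h0 | h0
  · obtain ⟨c, hc, κ, hκ, N₀, hN₀, h⟩ := hχ.ball_upper_tail hτ (by omega) hu hε
    have hεd : 0 < ε * d := by positivity
    -- The second bound forces N ≥ N₀ through N^(χ-1+ε) ≤ ζ; the third lets ζ^(-εd) absorb the
    -- constant `c`.
    refine ⟨min κ (min (N₀ ^ (χ - 1 + ε)) (c⁻¹ ^ (ε * d)⁻¹)), by positivity,
      fun ζ hζ hζ₀ N hN hNζ => ?_⟩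
    have hN0 : (0 : ℝ) < N := by exact_mod_cast hN
    have h1 := hζ₀.trans_le (min_le_left _ _)
    have h2 := (hζ₀.trans_le (min_le_right _ _)).trans_le (min_le_left _ _)
    have h3 := (hζ₀.trans_le (min_le_right _ _)).trans_le (min_le_right _ _)
    have hNN : N₀ ≤ N := by
      by_contra hcon
      have := Real.rpow_le_rpow_of_nonpos hN0 (not_le.1 hcon).le (by linarith : χ - 1 + ε ≤ 0)
      linarith
    refine le_trans ?_ (h N hNN ζ ?_ h1.le)
    · rw [Real.exp_le_exp, neg_le_neg_iff, mul_pow, ← h0, sub_zero, div_one, sub_mul, one_mul,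
        Real.rpow_sub hζ, Real.rpow_natCast]
      have h4 : ζ ^ (ε * d) ≤ c⁻¹ := by
        have := Real.rpow_le_rpow hζ.le h3.le hεd.le
        rwa [← Real.rpow_mul (by positivity), inv_mul_cancel₀ hεd.ne', Real.rpow_one] at this
      have h5 : c ≤ (ζ ^ (ε * d))⁻¹ := by
        rwa [le_inv_comm₀ hc (by positivity)]
      calc c * (ζ ^ d * (N : ℝ) ^ d) ≤ (ζ ^ (ε * d))⁻¹ * (ζ ^ d * (N : ℝ) ^ d) := by gcongr
        _ = (N : ℝ) ^ d * (ζ ^ d / ζ ^ (ε * d)) := by rw [div_eq_mul_inv]; ring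
    · have h4 := mul_le_mul_of_nonneg_right hNζ hN0.le
      rwa [← Real.rpow_add_one hN0.ne', show χ - 1 + ε + 1 = χ + ε by ring] at h4
  · obtain ⟨F⟩ := exists_curvedFrame hτ hd (norm_ne_zero_iff.1 (by rw [hu]; exact one_ne_zero))
      hW hfin hpos hW.1
    -- Then 1 - χ + 2δ = (1 - χ)(1 + ε/4), and the exponent obtained with n = ζ^(-1/q) loses less
    -- than the factor 1 - ε.
    set δ := ε * (1 - χ) / 8 with hδ
    have h1χ : 0 < 1 - χ := by linarith
    have hδ0 : 0 < δ := by positivity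
    have hε1 : ε < 1 := by linarith
    have hεχ2 : ε * (1 - χ) ≤ 1 - χ := mul_le_of_le_one_left h1χ.le hε1.le
    obtain ⟨n₀, hn₀, h⟩ := F.upper_tail hτ hχ h0 hW.1 hε hεχ hδ0 (by linarith)
    set q := 1 - χ + 2 * δ with hq
    have hq0 : 0 < q := by positivity
    refine ⟨min 1 (n₀ ^ (-q)), by positivity, fun ζ hζ hζ₀ N hN hNζ => ?_⟩
    have hζ1 := (hζ₀.trans_le (min_le_left _ _)).le
    have hζ2 := (hζ₀.trans_le (min_le_right _ _)).le
    have hn : n₀ ≤ ζ ^ (-q⁻¹) := by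
      have := Real.rpow_le_rpow_of_nonpos hζ hζ2 (neg_nonpos.2 (inv_pos.2 hq0).le)
      rwa [← Real.rpow_mul (by linarith), neg_mul_neg, mul_inv_cancel₀ hq0.ne', Real.rpow_one]
        at this
    have e1 : (ζ ^ (-q⁻¹)) ^ (-q) = ζ := by
      rw [← Real.rpow_mul hζ.le, neg_mul_neg, inv_mul_cancel₀ hq0.ne', Real.rpow_one]
    have h1 := h _ hn N hN (by rwa [e1])
    rw [e1, ← Real.rpow_mul hζ.le] at h1
    refine le_trans ?_ h1
    rw [Real.exp_le_exp, neg_le_neg_iff]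
    refine mul_le_mul_of_nonneg_left (Real.rpow_le_rpow_of_exponent_ge hζ hζ1 ?_) (by positivity)
    have e2 : -q⁻¹ * -(d * (1 - 2 * δ)) = (d / (1 - χ)) * ((1 - 2 * δ) / (1 + ε / 4)) := by
      have : q = (1 - χ) * (1 + ε / 4) := by rw [hq, hδ]; ring
      rw [this]
      field_simp
    rw [e2, mul_comm]
    refine mul_le_mul_of_nonneg_left ?_ (by positivity)
    rw [le_div_iff₀ (by positivity)]
    have h2 : 2 * δ ≤ ε / 4 := by
      have := mul_le_mul_of_nonneg_left (show 1 - χ ≤ 1 by linarith) hε.le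
      rw [hδ]; linarith
    have h3 : 0 ≤ ε * ε := by positivity
    linarith

end UniformTail

end FPP

theorem mainTheorem2 {d : ℕ} (hd : 2 ≤ d) {Ω : Type*} [MeasurableSpace Ω]
    (P : Measure Ω) [IsProbabilityMeasure P]
    (τ : FPP.Edge d → Ω → ℝ) (hτ : FPP.IsWeights P τ)
    (u : EuclideanSpace ℝ (Fin d)) (hu : ‖u‖ = 1)
    (W : Submodule ℝ (EuclideanSpace ℝ (Fin d)))
    (hW : FPP.IsTangentHyperplane P τ u W)
    (hfin : FPP.FiniteCurvature P τ u W)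
    (hpos : FPP.PositiveCurvature P τ u W)
    (χ : ℝ) (hχ : FPP.FullConcentration P τ χ) :
    (∀ ε : ℝ, 0 < ε → ∀ a : ℝ, χ + ε ≤ a →
      (a < 1 ∨ (a = 1 ∧ ∃ b : ℝ, (∀ e, 0 < P {ω | b ≤ τ e ω}) ∧
        FPP.timeConstant P τ u + 1 < b * ∑ i, |u i|)) →
      ∀ᶠ N : ℕ in atTop,
      Real.exp (-((N : ℝ) ^ (d * (1 + ε) / (1 - χ) * (a - χ)))) ≤
        P.real {ω | N * FPP.timeConstant P τ u + (N : ℝ) ^ a < FPP.T τ 0 ((N : ℝ) • u) ω}) ∧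
    (∀ ε : ℝ, 0 < ε → ∀ᶠ ζ : ℝ in 𝓝[>] 0,
      ((-(ζ ^ ((1 - ε) * (d / (1 - χ)))) : ℝ) : EReal) ≤
        liminf (fun N : ℕ => ((((N : ℝ) ^ d)⁻¹ : ℝ) : EReal) *
          ENNReal.log (P {ω | N * FPP.timeConstant P τ u + ζ * N <
            FPP.T τ 0 ((N : ℝ) • u) ω})) atTop) := by
  have hχ0 := hχ.nonneg
  have hχ1 := hχ.lt_one
  have h1χ : 0 < 1 - χ := by linarith
  have hd0 : (0 : ℝ) < d := by exact_mod_cast (by omega : 0 < d)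
  refine ⟨fun ε hε a ha ha1 => ?_, fun ε hε => ?_⟩
  · rcases ha1 with ha1 | ⟨rfl, b, hb, hbu⟩
    · have hε1 : ε < 1 := by linarith
      have hεε : ε * ε ≤ ε := mul_le_of_le_one_left hε.le hε1.le
      -- Used with ε² and ζ = N^(a-1). The loss in the exponent is (1-a)ε² times d/(1-χ), at most
      -- the allowed ε(a-χ) times the same factor, since a - χ ≥ ε.
      obtain ⟨ζ₀, hζ₀, h⟩ := hχ.exp_neg_le_upper_tail hτ hd hu hW hfin hpos
        (mul_pos hε hε) (by linarith)
      have hlim := (tendsto_rpow_neg_atTop (sub_pos.2 ha1)).comp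
        (tendsto_natCast_atTop_atTop (R := ℝ))
      filter_upwards [hlim.eventually_lt_const hζ₀, eventually_ge_atTop 1] with N hNζ hN
      have hN1 : (1 : ℝ) ≤ N := by exact_mod_cast hN
      have hN0 : (0 : ℝ) < N := by linarith
      simp only [Function.comp, neg_sub] at hNζ
      have h1 := h _ (by positivity) hNζ N hN
        (Real.rpow_le_rpow_of_exponent_le hN1 (by linarith))
      rw [← Real.rpow_add_one hN0.ne', sub_add_cancel, ← Real.rpow_natCast, ← Real.rpow_mul hN0.le,
        ← Real.rpow_add hN0] at h1
      refine le_trans ?_ h1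
      rw [Real.exp_le_exp, neg_le_neg_iff]
      refine Real.rpow_le_rpow_of_exponent_le hN1 ?_
      have e1 : d + (a - 1) * ((1 - ε * ε) * (d / (1 - χ))) =
          d / (1 - χ) * ((1 - χ) + (a - 1) * (1 - ε * ε)) := by field_simp
      have e2 : d * (1 + ε) / (1 - χ) * (a - χ) = d / (1 - χ) * ((1 + ε) * (a - χ)) := by ring
      rw [e1, e2]
      refine mul_le_mul_of_nonneg_left ?_ (by positivity)
      have h2 := mul_le_mul_of_nonneg_left (show ε ≤ a - χ by linarith) hε.le
      have h3 := mul_nonneg (show 0 ≤ a by linarith) (mul_pos hε hε).le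
      linarith
    · obtain ⟨c, hc, h⟩ := hτ.linear_upper_tail hu hb hbu
      have hdε : (d : ℝ) < d * (1 + ε) := lt_mul_of_one_lt_right hd0 (by linarith)
      filter_upwards [h, (tendsto_natCast_atTop_atTop (R := ℝ)).eventually
        (FPP.eventually_mul_rpow_le c hdε)] with N h1 h2
      rw [div_mul_cancel₀ _ h1χ.ne', Real.rpow_one]
      refine le_trans ?_ h1
      rw [Real.exp_le_exp, neg_le_neg_iff]
      rwa [Real.rpow_natCast] at h2
  -- The uniform bound needs ε < 1 - χ; a smaller ε gives a stronger statement because ζ < 1.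
  · set ε' := min ε ((1 - χ) / 2) with hε'
    have hε'0 : 0 < ε' := by positivity
    have hε'1 : ε' < 1 - χ := (min_le_right _ _).trans_lt (by linarith)
    obtain ⟨ζ₀, hζ₀, h⟩ := hχ.exp_neg_le_upper_tail hτ hd hu hW hfin hpos hε'0 hε'1
    filter_upwards [Ioo_mem_nhdsGT (lt_min hζ₀ one_pos)] with ζ hζ
    have hζ1 := hζ.2.le.trans (min_le_right _ _)
    have hlim := (tendsto_rpow_neg_atTop (sub_pos.2 hε'1)).comp
      (tendsto_natCast_atTop_atTop (R := ℝ))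
    refine le_liminf_of_le (by isBoundedDefault) ?_
    filter_upwards [hlim.eventually_le_const hζ.1, eventually_ge_atTop 1] with N hNζ hN
    have hN0 : (0 : ℝ) < N := by exact_mod_cast hN
    have hNd : (0 : ℝ) < (N : ℝ) ^ d := by positivity
    simp only [Function.comp] at hNζ
    rw [show -(1 - χ - ε') = χ - 1 + ε' by ring] at hNζ
    have h1 := h ζ hζ.1 (hζ.2.trans_le (min_le_left _ _)) N hN hNζ
    have h2 : ζ ^ ((1 - ε') * (d / (1 - χ))) ≤ ζ ^ ((1 - ε) * (d / (1 - χ))) := by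
      refine Real.rpow_le_rpow_of_exponent_ge hζ.1 hζ1 ?_
      have : ε' ≤ ε := min_le_left _ _
      gcongr
    set E := {ω | N * FPP.timeConstant P τ u + ζ * N < FPP.T τ 0 ((N : ℝ) • u) ω} with hE
    have h3 : ENNReal.ofReal (Real.exp (-((N : ℝ) ^ d * ζ ^ ((1 - ε) * (d / (1 - χ)))))) ≤ P E := by
      rw [ENNReal.ofReal_le_iff_le_toReal (measure_ne_top P E), ← measureReal_def]
      refine le_trans ?_ h1
      gcongr
    have h4 := ENNReal.log_monotone h3
    rw [ENNReal.log_ofReal_of_pos (Real.exp_pos _), Real.log_exp] at h4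
    have h5 := mul_le_mul_of_nonneg_left h4
      (show (0 : EReal) ≤ ((((N : ℝ) ^ d)⁻¹ : ℝ) : EReal) by exact_mod_cast (inv_pos.2 hNd).le)
    refine le_trans (le_of_eq ?_) h5
    rw [← EReal.coe_mul]
    congr 1
    field_simp
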